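/- Let $Q$ be a finite quiver (loops and multiple edges allowed) with vertex set $I$ and edge set $E$, and let $\mathbb{F}=\mathbb{Q}(q,t_e)_{e\in E}$. For $i,j\in I$ put $$\zeta_{ij}(x)=\left(\frac{1-xq^{-1}}{1-x}\right)^{\delta^i_j}\prod_{e=\overrightarrow{ij}}(1-t_ex)\prod_{e=\overrightarrow{ji}}\left(1-\frac{qx}{t_e}\right).$$ For $\boldsymbol n\in\mathbb{N}^I$ let $\mathcal{S}_{\boldsymbol n}$ be the space of Laurent polynomials $R$ over $\mathbb{F}$ in variables $z_{ia}$ ($i\in I$, $1\le a\le n_i$), symmetric in $z_{i1},\dots,z_{in_i}$ for each $i$ separately, which satisfy the wheel conditions $$R\big|_{z_{ia}=\frac{qz_{jb}}{t_e}=qz_{ic}}=R\big|_{z_{ja}=t_ez_{ib}=qz_{jc}}=0$$ for all edges $e=\overrightarrow{ij}$ and all indices for which the three variables involved are distinct. Let $\mathcal{S}=\bigoplus_{\boldsymbol n}\mathcal{S}_{\boldsymbol n}$, with the shuffle product of $R\in\mathcal{S}_{\boldsymbol n}$ and $R'\in\mathcal{S}_{\boldsymbol n'}$ given by $$R*R'=\mathrm{Sym}\left[\frac{R(\dots,z_{i1},\dots,z_{in_i},\dots)\,R'(\dots,z_{i,n_i+1},\dots,z_{i,n_i+n_i'},\dots)}{\prod_i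 n_i!\,\prod_i n_i'!}\prod_{i,j\in I}\ \prod_{1\le a\le n_i}\ \prod_{n_j<b\le n_j+n_j'}\zeta_{ij}\left(\frac{z_{ia}}{z_{jb}}\right)\right],$$ where $\mathrm{Sym}$ is the sum over all permutations of the variables $z_{i1},\dots,z_{i,n_i+n'_i}$ for each $i$ separately. Fix a total order on $I$, and order the letters $i^{(d)}$ ($i\in I$, $d\in\mathbb{Z}$) by: $i^{(d)}<j^{(e)}$ if $d>e$, or if $d=e$ and $i<j$. Words are finite sequences of letters, ordered lexicographically (a proper prefix of a word is smaller than the word). For a word $w=[i_1^{(d_1)}\dots i_n^{(d_n)}]$ let $e_w=z_{i_11}^{d_1}*\dots*z_{i_n1}^{d_n}\in\mathcal{S}$, the product of the one-variable elements $z_{i_k1}^{d_k}$ (and $e_w=1$ if $w$ is empty). A word $v$ is called standard if $e_v$ is not an $\mathbb{F}$-linear combination of elements $e_w$ with $w>v$. The monomial of the word $w$ is $z_{i_1a_1}^{d_1}\cdots z_{i_na_n}^{d_n}$, where $a_k$ is the number of $l\le k$ with $i_l=i_k$; it belongs to the component of $\mathcal{S}$ indexed by the $\boldsymbol n$ for which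 $n_i$ is the number of $k$ with $i_k=i$. The leading word of a non-zero $R\in\mathcal{S}$ is the largest word whose monomial has non-zero coefficient in $R$. **Proposition.** A word $v$ is standard if and only if it is the leading word of some non-zero $R\in\mathcal{S}$. -/

import Mathlib

open scoped DirectSum BigOperators

noncomputable section

namespace QuiverShuffle

/-! ### The ground field and the variables -/

/-- The canonical map from a ring to its fraction ring. -/
abbrev fractionRingAlgebra (A : Type*) [CommRing A] : Algebra A (FractionRing A) := inferInstance

theorem fractionRing_isFractionRing (A : Type*) [CommRing A] :
    IsFractionRing A (FractionRing A) := inferInstance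

/-- The field `𝔽 = ℚ(q, t_e)` of rational functions in the independent variables `q` and `t_e`,
one for each arrow `e` of the quiver `I`; it is the fraction field of `ℤ[q^±1, t_e^±1]`. -/
def BaseField (I : Type*) [Quiver I] : Type _ :=
  FractionRing (MvPolynomial (Option (Quiver.Total I)) ℚ)

instance (I : Type*) [Quiver I] : Field (BaseField I) :=
  inferInstanceAs (Field (FractionRing (MvPolynomial (Option (Quiver.Total I)) ℚ)))

instance (I : Type*) [Quiver I] :
    Algebra (MvPolynomial (Option (Quiver.Total I)) ℚ) (BaseField I) :=
  fractionRingAlgebra (MvPolynomial (Option (Quiver.Total I)) ℚ)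

instance (I : Type*) [Quiver I] :
    IsFractionRing (MvPolynomial (Option (Quiver.Total I)) ℚ) (BaseField I) :=
  fractionRing_isFractionRing (MvPolynomial (Option (Quiver.Total I)) ℚ)

/-- The parameter `q`. -/
def qPar (I : Type*) [Quiver I] : BaseField I :=
  algebraMap (MvPolynomial (Option (Quiver.Total I)) ℚ) _ (MvPolynomial.X none)

/-- The parameter `t_e` of an arrow `e : i ⟶ j`. -/
def tPar {I : Type*} [Quiver I] {i j : I} (e : i ⟶ j) : BaseField I :=
  algebraMap (MvPolynomial (Option (Quiver.Total I)) ℚ) _ (MvPolynomial.X (some ⟨i, j, e⟩))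

/-- The index set of the variables `z_{ia}`, where `i` is a vertex and `a` runs over `n i` values
(numbered from `0`). -/
abbrev Vars {I : Type*} (n : I → ℕ) : Type _ := Σ i : I, Fin (n i)

/-- The field `𝔽(…, z_{ia}, …)` of rational functions in the variables `z_{ia}`, `a < n i`. -/
def RatFun {I : Type*} [Quiver I] (n : I → ℕ) : Type _ :=
  FractionRing (MvPolynomial (Vars n) (BaseField I))

instance {I : Type*} [Quiver I] (n : I → ℕ) : Field (RatFun n) :=
  inferInstanceAs (Field (FractionRing (MvPolynomial (Vars n) (BaseField I))))

instance {I : Type*} [Quiver I] (n : I → ℕ) :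
    Algebra (MvPolynomial (Vars n) (BaseField I)) (RatFun n) :=
  inferInstanceAs (Algebra (MvPolynomial (Vars n) (BaseField I))
    (FractionRing (MvPolynomial (Vars n) (BaseField I))))

instance {I : Type*} [Quiver I] (n : I → ℕ) :
    IsFractionRing (MvPolynomial (Vars n) (BaseField I)) (RatFun n) :=
  inferInstanceAs (IsFractionRing (MvPolynomial (Vars n) (BaseField I))
    (FractionRing (MvPolynomial (Vars n) (BaseField I))))

instance {I : Type*} [Quiver I] (n : I → ℕ) : Algebra (BaseField I) (RatFun n) :=
  inferInstanceAs (Algebra (BaseField I) (FractionRing (MvPolynomial (Vars n) (BaseField I))))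

instance {I : Type*} [Quiver I] (n : I → ℕ) :
    IsScalarTower (BaseField I) (MvPolynomial (Vars n) (BaseField I)) (RatFun n) :=
  inferInstanceAs (IsScalarTower (BaseField I) (MvPolynomial (Vars n) (BaseField I))
    (FractionRing (MvPolynomial (Vars n) (BaseField I))))

/-- The variable `z_{ia}` as a rational function. -/
def zVar {I : Type*} [Quiver I] {n : I → ℕ} (x : Vars n) : RatFun n :=
  algebraMap (MvPolynomial (Vars n) (BaseField I)) (RatFun n) (MvPolynomial.X x)

/-- Scalars of `𝔽` as constant rational functions. -/
def const {I : Type*} [Quiver I] (n : I → ℕ) (c : BaseField I) : RatFun n :=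
  algebraMap (BaseField I) (RatFun n) c

theorem algebraMap_comp_rename_injective {I : Type*} [Quiver I] {m n : I → ℕ} (f : Vars m → Vars n)
    (hf : Function.Injective f) :
    Function.Injective ((algebraMap (MvPolynomial (Vars n) (BaseField I)) (RatFun n)).comp
      (MvPolynomial.rename f : MvPolynomial (Vars m) (BaseField I) →ₐ[BaseField I]
        MvPolynomial (Vars n) (BaseField I)).toRingHom) := by
  intro x y h
  exact MvPolynomial.rename_injective f hf
    (IsFractionRing.injective (MvPolynomial (Vars n) (BaseField I)) (RatFun n) h)

/-- The homomorphism of fields of rational functions that replaces every variable `z_x` by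
`z_{f x}`, for an injective `f`. -/
def renameVars {I : Type*} [Quiver I] {m n : I → ℕ} (f : Vars m → Vars n)
    (hf : Function.Injective f) : RatFun m →+* RatFun n :=
  IsFractionRing.lift (algebraMap_comp_rename_injective f hf)

/-! ### The shuffle product -/

open Classical in
/-- The function `ζ_{ij}(x) = ((1 - x q⁻¹) / (1 - x))^{δ_{ij}} ∏_{e : i ⟶ j} (1 - t_e x)
∏_{e : j ⟶ i} (1 - q x / t_e)`, at an element `x` of a field of rational functions. -/
def zeta {I : Type*} [Quiver I] [∀ i j : I, Fintype (i ⟶ j)] {n : I → ℕ}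
    (i j : I) (x : RatFun n) : RatFun n :=
  (if i = j then (1 - x * (const n (qPar I))⁻¹) / (1 - x) else 1) *
    (∏ e : i ⟶ j, (1 - const n (tPar e) * x)) *
    ∏ e : j ⟶ i, (1 - const n (qPar I) * x / const n (tPar e))

/-- The first `n i` of the `n i + n' i` variables of each vertex `i`. -/
def inFirst {I : Type*} (n n' : I → ℕ) (x : Vars n) : Vars (n + n') :=
  ⟨x.1, Fin.castAdd (n' x.1) x.2⟩

/-- The last `n' i` of the `n i + n' i` variables of each vertex `i`. -/
def inLast {I : Type*} (n n' : I → ℕ) (x : Vars n') : Vars (n + n') :=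
  ⟨x.1, Fin.natAdd (n x.1) x.2⟩

theorem inFirst_injective {I : Type*} (n n' : I → ℕ) : Function.Injective (inFirst n n') := by
  rintro ⟨i, a⟩ ⟨j, b⟩ h
  obtain ⟨rfl, h2⟩ := Sigma.mk.inj_iff.1 h
  exact congrArg _ (Fin.castAdd_injective _ _ (eq_of_heq h2))

theorem inLast_injective {I : Type*} (n n' : I → ℕ) : Function.Injective (inLast n n') := by
  rintro ⟨i, a⟩ ⟨j, b⟩ h
  obtain ⟨rfl, h2⟩ := Sigma.mk.inj_iff.1 h
  exact congrArg _ (Fin.natAdd_injective _ _ (eq_of_heq h2))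

/-- A family of permutations, one for each vertex `i`, permuting the variables `z_{ia}` of each
vertex separately. -/
def permVars {I : Type*} {n : I → ℕ} (s : ∀ i, Equiv.Perm (Fin (n i))) : Equiv.Perm (Vars n) :=
  Equiv.sigmaCongrRight s

open Classical in
/-- Symmetrization with respect to the variables `z_{ia}` of each vertex `i` separately: the sum
(not the average) over all families of permutations. -/
def sym {I : Type*} [Quiver I] [Fintype I] {n : I → ℕ} (R : RatFun n) : RatFun n :=
  ∑ s : ∀ i, Equiv.Perm (Fin (n i)), renameVars (permVars s) (permVars s).injective R

/-- The shuffle product `R * R'`: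
`Sym [ R(z_{ia})_{a ≤ n_i} R'(z_{jb})_{b > n_j} / (∏ n_i! ∏ n'_i!) ∏ ζ_{ij}(z_{ia} / z_{jb}) ]`, the
last product running over all `i, j`, all `a ≤ n_i` and all `n_j < b ≤ n_j + n'_j`. -/
def shuffleMul {I : Type*} [Quiver I] [Fintype I] [∀ i j : I, Fintype (i ⟶ j)] {n n' : I → ℕ}
    (R : RatFun n) (R' : RatFun n') : RatFun (n + n') :=
  sym (renameVars (inFirst n n') (inFirst_injective n n') R *
      renameVars (inLast n n') (inLast_injective n n') R' /
      ((∏ i, ((n i).factorial : RatFun (n + n'))) * ∏ i, ((n' i).factorial : RatFun (n + n'))) *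
    ∏ x : Vars n, ∏ y : Vars n',
      zeta x.1 y.1 (zVar (inFirst n n' x) / zVar (inLast n n' y)))

/-! ### Laurent polynomials and the shuffle algebra -/

/-- Laurent polynomials over `𝔽` in the variables `z_{ia}`, `a < n i`, as finitely supported
families of coefficients indexed by the exponents of the monomials. -/
abbrev Laurent {I : Type*} [Quiver I] (n : I → ℕ) : Type _ := (Vars n → ℤ) →₀ BaseField I

/-- The value `∑ c_k ∏ g_x ^ k_x` of a Laurent polynomial `∑ c_k z^k` when every variable `z_x` is
replaced by the rational function `g x`. -/
def Laurent.subst {I : Type*} [Quiver I] [Fintype I] {n : I → ℕ} (g : Vars n → RatFun n) :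
    Laurent (I := I) n →ₗ[BaseField I] RatFun (I := I) n :=
  Finsupp.linearCombination (BaseField I) fun k : Vars n → ℤ => ∏ x, g x ^ k x

/-- A Laurent polynomial regarded as a rational function. -/
def Laurent.toRat {I : Type*} [Quiver I] [Fintype I] (n : I → ℕ) :
    Laurent (I := I) n →ₗ[BaseField I] RatFun (I := I) n :=
  Laurent.subst zVar

/-- Symmetry in the variables `z_{i1}, …, z_{in_i}`, for each vertex `i` separately. -/
def Laurent.IsSymmetric {I : Type*} [Quiver I] {n : I → ℕ} (P : Laurent (I := I) n) : Prop :=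
  ∀ (s : ∀ i, Equiv.Perm (Fin (n i))) (k : Vars n → ℤ), P (k ∘ permVars s) = P k

open Classical in
/-- The restriction of `P` to the locus `z_x = u z_y`, `z_w = v z_y`. -/
def Laurent.restrict {I : Type*} [Quiver I] [Fintype I] {n : I → ℕ} (x w y : Vars n)
    (u v : BaseField I) : Laurent (I := I) n →ₗ[BaseField I] RatFun (I := I) n :=
  Laurent.subst (Function.update
    (Function.update zVar x (const n u * zVar y)) w (const n v * zVar y))

/-- The wheel conditions: for every arrow `e : i ⟶ j`, `P` vanishes on the locus
`z_{ia} = q z_{jb} / t_e = q z_{ic}` and on the locus `z_{ja} = t_e z_{ib} = q z_{jc}`, whenever the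
three variables are distinct. -/
def Laurent.Wheel {I : Type*} [Quiver I] [Fintype I] {n : I → ℕ} (P : Laurent (I := I) n) : Prop :=
  ∀ (i j : I) (e : i ⟶ j),
    (∀ (a c : Fin (n i)) (b : Fin (n j)), a ≠ c →
      (⟨j, b⟩ : Vars n) ≠ ⟨i, a⟩ → (⟨j, b⟩ : Vars n) ≠ ⟨i, c⟩ →
      P.restrict ⟨i, a⟩ ⟨j, b⟩ ⟨i, c⟩ (qPar I) (tPar e) = 0) ∧
    (∀ (a c : Fin (n j)) (b : Fin (n i)), a ≠ c →
      (⟨i, b⟩ : Vars n) ≠ ⟨j, a⟩ → (⟨i, b⟩ : Vars n) ≠ ⟨j, c⟩ →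
      P.restrict ⟨j, a⟩ ⟨i, b⟩ ⟨j, c⟩ (qPar I) (qPar I / tPar e) = 0)

/-- The symmetric Laurent polynomials that satisfy the wheel conditions. -/
def wheelLaurent {I : Type*} [Quiver I] [Fintype I] (n : I → ℕ) :
    Submodule (BaseField I) (Laurent (I := I) n) where
  carrier := {P | P.IsSymmetric ∧ P.Wheel}
  add_mem' := by
    rintro P P' ⟨h1, h2⟩ ⟨h1', h2'⟩
    refine ⟨fun s k => by simp [h1 s k, h1' s k], fun i j e => ⟨fun a c b h h' h'' => ?_,
      fun a c b h h' h'' => ?_⟩⟩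
    · rw [map_add, (h2 i j e).1 a c b h h' h'', (h2' i j e).1 a c b h h' h'', add_zero]
    · rw [map_add, (h2 i j e).2 a c b h h' h'', (h2' i j e).2 a c b h h' h'', add_zero]
  zero_mem' := ⟨fun _ _ => rfl, fun i j e => ⟨fun _ _ _ _ _ _ => map_zero _,
    fun _ _ _ _ _ _ => map_zero _⟩⟩
  smul_mem' := by
    rintro r P ⟨h1, h2⟩
    refine ⟨fun s k => by simp [h1 s k], fun i j e => ⟨fun a c b h h' h'' => ?_,
      fun a c b h h' h'' => ?_⟩⟩
    · rw [map_smul, (h2 i j e).1 a c b h h' h'', smul_zero]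
    · rw [map_smul, (h2 i j e).2 a c b h h' h'', smul_zero]

/-- The ambient graded vector space `⨁_n 𝔽(…, z_{ia}, …)`. -/
abbrev Ambient (I : Type*) [Quiver I] : Type _ := ⨁ n : I → ℕ, RatFun (I := I) n

instance (I : Type*) [Quiver I] : Module (BaseField I) (Ambient I) := DirectSum.instModule

/-- The shuffle algebra `𝒮 = ⨁_n 𝒮_n`, where `𝒮_n` consists of the rational functions that are
symmetric Laurent polynomials satisfying the wheel conditions. -/
def shuffleAlgebra (I : Type*) [Quiver I] [Fintype I] : Submodule (BaseField I) (Ambient I) :=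
  ⨅ n : I → ℕ, ((wheelLaurent (I := I) n).map (Laurent.toRat n)).comap
    (DirectSum.component (BaseField I) (I → ℕ) (fun n => RatFun (I := I) n) n)

/-! ### Words -/

/-- A word `[i_1^{(d_1)} … i_n^{(d_n)}]` is a finite sequence of letters; the letter `i^{(d)}` is
the pair `(i, d)`. -/
abbrev Word (I : Type*) : Type _ := List (I × ℤ)

/-- The order on letters: `i^{(d)} < j^{(e)}` if `d > e`, or `d = e` and `i < j`. -/
def letterLT {I : Type*} [LinearOrder I] (x y : I × ℤ) : Prop :=
  y.2 < x.2 ∨ (x.2 = y.2 ∧ x.1 < y.1)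

/-- The lexicographic order on words; a proper prefix of a word is smaller than the word. -/
def wordLT {I : Type*} [LinearOrder I] (v w : Word I) : Prop :=
  List.Lex letterLT v w

open Classical in
/-- The dimension vector `ς_{i_1} + … + ς_{i_n}` of a word. -/
def wordDim {I : Type*} : Word I → (I → ℕ)
  | [] => 0
  | l :: w => Pi.single l.1 1 + wordDim w

open Classical in
/-- The element `e_{i,d} = z_{i1}^d`. -/
def letterElt {I : Type*} [Quiver I] (l : I × ℤ) : RatFun (I := I) (Pi.single l.1 1) :=
  zVar (⟨l.1, ⟨0, by simp⟩⟩ : Vars (Pi.single l.1 1)) ^ l.2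

/-- The element `e_w = e_{i_1,d_1} * … * e_{i_n,d_n}`, as a rational function; the empty product
is `1`. -/
def wordRat {I : Type*} [Quiver I] [Fintype I] [∀ i j : I, Fintype (i ⟶ j)] :
    (w : Word I) → RatFun (I := I) (wordDim w)
  | [] => 1
  | l :: w => shuffleMul (letterElt l) (wordRat w)

open Classical in
/-- The element `e_w` in the graded vector space. -/
def wordElt {I : Type*} [Quiver I] [Fintype I] [∀ i j : I, Fintype (i ⟶ j)] (w : Word I) :
    Ambient I :=
  DirectSum.of (fun n : I → ℕ => RatFun (I := I) n) (wordDim w) (wordRat w)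

/-- A word `v` is standard if `e_v` is not a linear combination of the `e_w` with `w > v`. -/
def IsStandard {I : Type*} [Quiver I] [Fintype I] [∀ i j : I, Fintype (i ⟶ j)] [LinearOrder I]
    (v : Word I) : Prop :=
  wordElt v ∉ Submodule.span (BaseField I) (wordElt '' {w : Word I | wordLT v w})

open Classical in
/-- The exponents of the monomial `z_{i_1 a_1}^{d_1} … z_{i_n a_n}^{d_n}` of a word, in which the
successive occurrences of a vertex `i` in the word are given the variables `z_{i1}, z_{i2}, …`. -/
def wordExp {I : Type*} : (w : Word I) → Vars (wordDim w) → ℤ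
  | [] => fun _ => 0
  | l :: w => fun x => Fin.append (fun _ : Fin (Pi.single (M := fun _ => ℕ) l.1 1 x.1) => l.2)
      (fun b => wordExp w ⟨x.1, b⟩) x.2

/-- `v` is the leading word of `R`: the components of `R` are Laurent polynomials, the monomial of
`v` occurs in `R`, and the monomial of no word `w > v` does. -/
def IsLeadingWord {I : Type*} [Quiver I] [Fintype I] [LinearOrder I]
    (R : Ambient I) (v : Word I) : Prop :=
  ∃ P : ∀ n : I → ℕ, Laurent (I := I) n, (∀ n, Laurent.toRat n (P n) = R n) ∧
    P (wordDim v) (wordExp v) ≠ 0 ∧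
    ∀ w : Word I, wordLT v w → P (wordDim w) (wordExp w) = 0

end QuiverShuffle

end

noncomputable section

namespace QuiverShuffle

/-! ### Partial evaluation of fractions -/

section EvalsTo

variable {A K L : Type*} [CommRing A] [Field K] [Algebra A K] [Field L]

/-- The fraction `f` of elements of `A` can be evaluated along the homomorphism `φ`, and its value
is `v`. -/
def EvalsTo (φ : A →+* L) (f : K) (v : L) : Prop :=
  ∃ a b : A, φ b ≠ 0 ∧ f * algebraMap A K b = algebraMap A K a ∧ v * φ b = φ a

namespace EvalsTo

variable {φ : A →+* L} {f g : K} {v w : L}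

theorem of_algebraMap (φ : A →+* L) (a : A) : EvalsTo φ (algebraMap A K a) (φ a) :=
  ⟨a, 1, by simp, by simp, by simp⟩

theorem zero : EvalsTo φ (0 : K) 0 := by simpa using of_algebraMap (K := K) φ 0

theorem one : EvalsTo φ (1 : K) 1 := by simpa using of_algebraMap (K := K) φ 1

theorem add (hf : EvalsTo φ f v) (hg : EvalsTo φ g w) : EvalsTo φ (f + g) (v + w) := by
  obtain ⟨a, b, hb, h1, h2⟩ := hf
  obtain ⟨a', b', hb', h1', h2'⟩ := hg
  refine ⟨a * b' + a' * b, b * b', by simp [hb, hb'], ?_, ?_⟩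
  · simp only [map_mul, map_add, ← h1, ← h1']; ring
  · simp only [map_mul, map_add, ← h2, ← h2']; ring

theorem mul (hf : EvalsTo φ f v) (hg : EvalsTo φ g w) : EvalsTo φ (f * g) (v * w) := by
  obtain ⟨a, b, hb, h1, h2⟩ := hf
  obtain ⟨a', b', hb', h1', h2'⟩ := hg
  refine ⟨a * a', b * b', by simp [hb, hb'], ?_, ?_⟩
  · simp only [map_mul, ← h1, ← h1']; ring
  · simp only [map_mul, ← h2, ← h2']; ring

theorem neg (hf : EvalsTo φ f v) : EvalsTo φ (-f) (-v) := by
  obtain ⟨a, b, hb, h1, h2⟩ := hf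
  exact ⟨-a, b, hb, by simp [← h1], by simp [← h2]⟩

theorem sub (hf : EvalsTo φ f v) (hg : EvalsTo φ g w) : EvalsTo φ (f - g) (v - w) := by
  simpa [sub_eq_add_neg] using hf.add hg.neg

theorem sum {ι : Type*} (s : Finset ι) {f : ι → K} {v : ι → L}
    (h : ∀ i ∈ s, EvalsTo φ (f i) (v i)) : EvalsTo φ (∑ i ∈ s, f i) (∑ i ∈ s, v i) := by
  classical
  induction s using Finset.induction_on with
  | empty => simpa using zero
  | insert i s hi ih =>
    rw [Finset.sum_insert hi, Finset.sum_insert hi]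
    exact (h i (by simp)).add (ih fun j hj => h j (by simp [hj]))

theorem prod {ι : Type*} (s : Finset ι) {f : ι → K} {v : ι → L}
    (h : ∀ i ∈ s, EvalsTo φ (f i) (v i)) : EvalsTo φ (∏ i ∈ s, f i) (∏ i ∈ s, v i) := by
  classical
  induction s using Finset.induction_on with
  | empty => simpa using one
  | insert i s hi ih =>
    rw [Finset.prod_insert hi, Finset.prod_insert hi]
    exact (h i (by simp)).mul (ih fun j hj => h j (by simp [hj]))

theorem pow (hf : EvalsTo φ f v) (n : ℕ) : EvalsTo φ (f ^ n) (v ^ n) := by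
  induction n with
  | zero => simpa using one
  | succ n ih => rw [pow_succ, pow_succ]; exact ih.mul hf

section

variable [IsFractionRing A K]

theorem unique (hf : EvalsTo φ f v) (hg : EvalsTo φ f w) : v = w := by
  obtain ⟨a, b, hb, h1, h2⟩ := hf
  obtain ⟨a', b', hb', h1', h2'⟩ := hg
  have h : a * b' = a' * b := by
    apply IsFractionRing.injective A K
    simp only [map_mul, ← h1, ← h1']; ring
  have h3 := congrArg φ h
  simp only [map_mul, ← h2, ← h2'] at h3
  apply mul_right_cancel₀ (mul_ne_zero hb hb')
  linear_combination h3

theorem eq_zero (hf : EvalsTo φ (0 : K) v) : v = 0 := hf.unique zero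

theorem inv (hf : EvalsTo φ f v) (hv : v ≠ 0) : EvalsTo φ f⁻¹ v⁻¹ := by
  obtain ⟨a, b, hb, h1, h2⟩ := hf
  have ha : φ a ≠ 0 := by rw [← h2]; exact mul_ne_zero hv hb
  have ha' : algebraMap A K a ≠ 0 := fun h => ha <| by
    rw [(map_eq_zero_iff _ (IsFractionRing.injective A K)).1 h, map_zero]
  have hf0 : f ≠ 0 := fun h => ha' (by rw [← h1, h, zero_mul])
  refine ⟨b, a, ha, ?_, ?_⟩
  · rw [← h1]; field_simp
  · rw [← h2]; field_simp

theorem div (hf : EvalsTo φ f v) (hg : EvalsTo φ g w) (hw : w ≠ 0) : EvalsTo φ (f / g) (v / w) := by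
  rw [div_eq_mul_inv, div_eq_mul_inv]; exact hf.mul (hg.inv hw)

theorem zpow (hf : EvalsTo φ f v) (hv : v ≠ 0) (n : ℤ) : EvalsTo φ (f ^ n) (v ^ n) := by
  cases n with
  | ofNat n => simpa using hf.pow n
  | negSucc n => rw [zpow_negSucc, zpow_negSucc]; exact (hf.pow _).inv (pow_ne_zero _ hv)

end

end EvalsTo

end EvalsTo

/-! ### Values of Laurent polynomials -/

section ev

variable {X F L M : Type*} [Fintype X] [Field F] [Field L] [Field M]

/-- The value of a Laurent polynomial at the point `u`, its coefficients being mapped by `ι`. -/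
def ev (ι : F →+* L) (u : X → L) : ((X → ℤ) →₀ F) →+ L :=
  Finsupp.liftAddHom fun p => (AddMonoidHom.mulRight (∏ x, u x ^ p x)).comp ι.toAddMonoidHom

theorem ev_apply (ι : F →+* L) (u : X → L) (R : (X → ℤ) →₀ F) :
    ev ι u R = R.sum fun p c => ι c * ∏ x, u x ^ p x := rfl

theorem ev_single (ι : F →+* L) (u : X → L) (p : X → ℤ) (c : F) :
    ev ι u (Finsupp.single p c) = ι c * ∏ x, u x ^ p x := by
  simp [ev]

end ev

section

variable {I : Type*} [Quiver I] {n : I → ℕ} {L : Type*} [Field L]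

theorem evalsTo_zVar (ι : BaseField I →+* L) (v : Vars n → L) (x : Vars n) :
    EvalsTo (MvPolynomial.eval₂Hom ι v) (zVar x : RatFun n) (v x) := by
  have h := EvalsTo.of_algebraMap (K := RatFun n) (MvPolynomial.eval₂Hom ι v) (MvPolynomial.X x)
  rw [MvPolynomial.eval₂Hom_X'] at h
  exact h

theorem evalsTo_const (ι : BaseField I →+* L) (v : Vars n → L) (c : BaseField I) :
    EvalsTo (MvPolynomial.eval₂Hom ι v) (const n c) (ι c) := by
  have h := EvalsTo.of_algebraMap (K := RatFun n) (MvPolynomial.eval₂Hom ι v) (MvPolynomial.C c)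
  rw [← MvPolynomial.algebraMap_eq, ← IsScalarTower.algebraMap_apply] at h
  simpa [const] using h

theorem zVar_ne_zero (x : Vars n) : (zVar x : RatFun n) ≠ 0 := by
  rw [zVar, Ne, map_eq_zero_iff _ (IsFractionRing.injective _ _)]
  exact MvPolynomial.X_ne_zero x

theorem zVar_injective : Function.Injective (zVar : Vars n → RatFun n) :=
  (IsFractionRing.injective (MvPolynomial (Vars n) (BaseField I)) (RatFun n)).comp
    MvPolynomial.X_injective

variable [Fintype I]

theorem evalsTo_subst (ι : BaseField I →+* L) (v : Vars n → L) (g : Vars n → RatFun n)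
    (w : Vars n → L) (hw : ∀ x, w x ≠ 0)
    (h : ∀ x, EvalsTo (MvPolynomial.eval₂Hom ι v) (g x) (w x)) (P : Laurent (I := I) n) :
    EvalsTo (MvPolynomial.eval₂Hom ι v) (Laurent.subst g P) (ev ι w P) := by
  rw [Laurent.subst, Finsupp.linearCombination_apply, ev_apply]
  refine EvalsTo.sum _ fun p _ => ?_
  dsimp only
  rw [Algebra.smul_def]
  exact (evalsTo_const ι v _).mul (EvalsTo.prod _ fun x _ => (h x).zpow (hw x) _)

theorem evalsTo_toRat (ι : BaseField I →+* L) (v : Vars n → L) (hv : ∀ x, v x ≠ 0)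
    (P : Laurent (I := I) n) :
    EvalsTo (MvPolynomial.eval₂Hom ι v) (Laurent.toRat n P) (ev ι v P) :=
  evalsTo_subst ι v zVar v hv (evalsTo_zVar ι v) P

theorem toRat_apply (P : Laurent (I := I) n) :
    Laurent.toRat n P = ∑ p ∈ P.support, const n (P p) * ∏ x, (zVar x : RatFun n) ^ p x := by
  rw [Laurent.toRat, Laurent.subst, Finsupp.linearCombination_apply, Finsupp.sum]
  simp only [Algebra.smul_def, const]

/-- A Laurent polynomial becomes a polynomial after multiplication by a monomial. -/
theorem exists_shift (P : Laurent (I := I) n) : ∃ N : ℕ, ∀ p ∈ P.support, ∀ x, 0 ≤ p x + N := by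
  classical
  refine ⟨P.support.sup fun p => Finset.univ.sup fun x => (p x).natAbs, fun p hp x => ?_⟩
  have h1 : (p x).natAbs ≤ P.support.sup fun p => Finset.univ.sup fun x => (p x).natAbs :=
    (Finset.le_sup (f := fun x => (p x).natAbs) (Finset.mem_univ x)).trans
      (Finset.le_sup (f := fun p : Vars n → ℤ => Finset.univ.sup fun x => (p x).natAbs) hp)
  omega

theorem toRat_injective : Function.Injective (Laurent.toRat (I := I) n) := by
  classical
  rw [← LinearMap.ker_eq_bot, LinearMap.ker_eq_bot']
  intro P hP
  obtain ⟨N, hN⟩ := exists_shift P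
  let e : (Vars n → ℤ) → (Vars n →₀ ℕ) := fun p =>
    Finsupp.equivFunOnFinite.symm fun x => (p x + N).toNat
  let Q : MvPolynomial (Vars n) (BaseField I) :=
    ∑ p ∈ P.support, MvPolynomial.monomial (e p) (P p)
  have hQ : algebraMap _ (RatFun n) Q = Laurent.toRat n P * ∏ x, (zVar x : RatFun n) ^ (N : ℤ) := by
    rw [toRat_apply, Finset.sum_mul, map_sum]
    refine Finset.sum_congr rfl fun p hp => ?_
    rw [MvPolynomial.monomial_eq, map_mul, ← MvPolynomial.algebraMap_eq,
      ← IsScalarTower.algebraMap_apply, mul_assoc, ← Finset.prod_mul_distrib, const]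
    congr 1
    rw [Finsupp.prod_fintype _ _ (by simp), map_prod]
    refine Finset.prod_congr rfl fun x _ => ?_
    rw [map_pow, ← zpow_add₀ (zVar_ne_zero x), ← zpow_natCast]
    congr 1
    simpa [e] using hN p hp x
  rw [hP, zero_mul, map_eq_zero_iff _ (IsFractionRing.injective _ _)] at hQ
  ext p
  by_contra hp
  have hp' : p ∈ P.support := Finsupp.mem_support_iff.2 hp
  have h := congrArg (MvPolynomial.coeff (e p)) hQ
  simp only [Q, MvPolynomial.coeff_sum, MvPolynomial.coeff_monomial, MvPolynomial.coeff_zero] at h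
  rw [Finset.sum_eq_single p] at h
  · simp at h; exact hp h
  · intro p' hp2 hne
    rw [if_neg]
    intro he
    apply hne
    funext x
    have hx := DFunLike.congr_fun he x
    simp only [e, Finsupp.equivFunOnFinite_symm_apply_apply] at hx
    have h1 := hN p hp' x
    have h2 := hN p' hp2 x
    omega
  · intro h3; exact absurd hp' h3

end

end QuiverShuffle
end


noncomputable section

namespace QuiverShuffle

/-! ### The structure function as a product over weights -/

section weights

variable {I : Type*} [Quiver I]

theorem algebraMap_base_injective :
    Function.Injective (algebraMap (MvPolynomial (Option (Quiver.Total I)) ℚ) (BaseField I)) :=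
  IsFractionRing.injective _ _

theorem qPar_ne_zero : qPar I ≠ 0 := by
  rw [qPar, Ne, map_eq_zero_iff _ algebraMap_base_injective]
  exact MvPolynomial.X_ne_zero _

theorem tPar_ne_zero {i j : I} (e : i ⟶ j) : tPar e ≠ 0 := by
  rw [tPar, Ne, map_eq_zero_iff _ algebraMap_base_injective]
  exact MvPolynomial.X_ne_zero _

theorem tPar_injective (i j : I) : Function.Injective (tPar : (i ⟶ j) → BaseField I) := by
  intro e e' h
  have h1 := MvPolynomial.X_injective (algebraMap_base_injective h)
  simpa using h1

theorem tPar_mul_ne {i j k l : I} (e : i ⟶ j) (e' : k ⟶ l) : tPar e * tPar e' ≠ qPar I := by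
  intro h
  rw [tPar, tPar, qPar, ← map_mul] at h
  have h1 := congrArg MvPolynomial.totalDegree (algebraMap_base_injective h)
  rw [MvPolynomial.totalDegree_mul_of_isDomain (MvPolynomial.X_ne_zero _)
    (MvPolynomial.X_ne_zero _)] at h1
  simp at h1

instance : CharZero (BaseField I) :=
  charZero_of_injective_algebraMap
    (algebraMap_base_injective (I := I))

instance (n : I → ℕ) : CharZero (RatFun n) :=
  charZero_of_injective_algebraMap (algebraMap (BaseField I) (RatFun n)).injective

variable [∀ i j : I, Fintype (i ⟶ j)]

open Classical in
/-- The coefficients `c` of the factors `1 - c x` of `ζ_{ij}(x)` that come from the arrows. -/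
def weights (i j : I) : Finset (BaseField I) :=
  Finset.univ.image (fun e : i ⟶ j => tPar e) ∪ Finset.univ.image (fun e : j ⟶ i => qPar I / tPar e)

theorem mem_weights {i j : I} {c : BaseField I} :
    c ∈ weights i j ↔ (∃ e : i ⟶ j, tPar e = c) ∨ ∃ e : j ⟶ i, qPar I / tPar e = c := by
  simp [weights]

theorem weights_ne_zero {i j : I} {c : BaseField I} (hc : c ∈ weights i j) : c ≠ 0 := by
  rcases mem_weights.1 hc with ⟨e, rfl⟩ | ⟨e, rfl⟩
  · exact tPar_ne_zero e
  · exact div_ne_zero qPar_ne_zero (tPar_ne_zero e)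

theorem div_mem_weights {i j : I} {c : BaseField I} (hc : c ∈ weights i j) :
    qPar I / c ∈ weights j i := by
  rw [mem_weights] at hc ⊢
  rcases hc with ⟨e, rfl⟩ | ⟨e, rfl⟩
  · exact Or.inr ⟨e, rfl⟩
  · refine Or.inl ⟨e, ?_⟩
    have := tPar_ne_zero e
    have := qPar_ne_zero (I := I)
    field_simp

open Classical in
theorem prod_weights {M : Type*} [CommMonoid M] (i j : I) (f : BaseField I → M) :
    ∏ c ∈ weights i j, f c = (∏ e : i ⟶ j, f (tPar e)) * ∏ e : j ⟶ i, f (qPar I / tPar e) := by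
  rw [weights, Finset.prod_union, Finset.prod_image, Finset.prod_image]
  · intro e _ e' _ h
    apply tPar_injective
    have h : qPar I / tPar e = qPar I / tPar e' := h
    have := tPar_ne_zero e
    have := tPar_ne_zero e'
    have hq := qPar_ne_zero (I := I)
    field_simp at h
    exact h.symm
  · exact fun e _ e' _ h => tPar_injective i j h
  · rw [Finset.disjoint_left]
    intro c h1 h2
    simp only [Finset.mem_image, Finset.mem_univ, true_and] at h1 h2
    obtain ⟨e, rfl⟩ := h1
    obtain ⟨e', h⟩ := h2
    rw [div_eq_iff (tPar_ne_zero e')] at h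
    exact tPar_mul_ne e e' h.symm

variable {L M : Type*} [Field L] [Field M]

open Classical in
/-- The value of `ζ_{ij}` at an element of a field. -/
def zetaAt (ι : BaseField I →+* L) (i j : I) (x : L) : L :=
  (if i = j then (1 - x * (ι (qPar I))⁻¹) / (1 - x) else 1) * ∏ c ∈ weights i j, (1 - ι c * x)

theorem zeta_eq_zetaAt {n : I → ℕ} (i j : I) (x : RatFun n) :
    zeta i j x = zetaAt (algebraMap (BaseField I) (RatFun n)) i j x := by
  classical
  rw [zeta, zetaAt, prod_weights, mul_assoc]
  congr 2
  refine Finset.prod_congr rfl fun e _ => ?_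
  rw [map_div₀, const, const]
  ring

theorem map_zetaAt (ψ : L →+* M) (ι : BaseField I →+* L) (i j : I) (x : L) :
    ψ (zetaAt ι i j x) = zetaAt (ψ.comp ι) i j (ψ x) := by
  classical
  rw [zetaAt, zetaAt, map_mul, map_prod]
  congr 1
  · split_ifs <;> simp
  · simp

/-- The product of `ζ_{ij}(u_x / u_y)` over all pairs `x`, `y` such that `x` occurs before `y` in a
list of variables, `i` and `j` being the colours of `x` and `y`. -/
def zetaList {n : I → ℕ} (ι : BaseField I →+* L) (u : Vars n → L) : List (Vars n) → L
  | [] => 1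
  | x :: l => (l.map fun a => zetaAt ι x.1 a.1 (u x / u a)).prod * zetaList ι u l

theorem map_zetaList {n : I → ℕ} (ψ : L →+* M) (ι : BaseField I →+* L) (u : Vars n → L)
    (l : List (Vars n)) :
    ψ (zetaList ι u l) = zetaList (ψ.comp ι) (fun x => ψ (u x)) l := by
  induction l with
  | nil => simp [zetaList]
  | cons x l ih =>
    rw [zetaList, zetaList, map_mul, ih, map_list_prod, List.map_map]
    congr 3
    funext a
    simp [map_zetaAt]

theorem zetaList_map {m n : I → ℕ} (ι : BaseField I →+* L) (u : Vars n → L)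
    (f : Vars m → Vars n) (hf : ∀ x, (f x).1 = x.1) (l : List (Vars m)) :
    zetaList ι u (l.map f) = zetaList ι (u ∘ f) l := by
  induction l with
  | nil => simp [zetaList]
  | cons x l ih =>
    rw [List.map_cons, zetaList, zetaList, ih, List.map_map]
    congr 3
    funext a
    simp [hf]

end weights

/-! ### Renaming of variables -/

theorem permVars_apply {I : Type*} {n : I → ℕ} (s : ∀ i, Equiv.Perm (Fin (n i))) (x : Vars n) :
    permVars s x = ⟨x.1, s x.1 x.2⟩ := rfl

section rename

variable {I : Type*} [Quiver I] {m n k : I → ℕ}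

theorem ratFun_ringHom_ext {L : Type*} [Field L] {f g : RatFun n →+* L}
    (h1 : ∀ c, f (const n c) = g (const n c)) (h2 : ∀ x, f (zVar x) = g (zVar x)) : f = g := by
  apply IsLocalization.ringHom_ext (nonZeroDivisors (MvPolynomial (Vars n) (BaseField I)))
  apply MvPolynomial.ringHom_ext
  · intro c
    have h := h1 c
    rw [const, IsScalarTower.algebraMap_apply (BaseField I) (MvPolynomial (Vars n) (BaseField I)),
      MvPolynomial.algebraMap_eq] at h
    exact h
  · exact h2

theorem renameVars_zVar (f : Vars m → Vars n) (hf : Function.Injective f) (x : Vars m) :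
    renameVars f hf (zVar x) = zVar (f x) := by
  rw [renameVars, zVar, IsFractionRing.lift_algebraMap]
  simp [zVar]

theorem renameVars_const (f : Vars m → Vars n) (hf : Function.Injective f) (c : BaseField I) :
    renameVars f hf (const m c) = const n c := by
  rw [renameVars, const,
    IsScalarTower.algebraMap_apply (BaseField I) (MvPolynomial (Vars m) (BaseField I)),
    IsFractionRing.lift_algebraMap, MvPolynomial.algebraMap_eq, const,
    IsScalarTower.algebraMap_apply (BaseField I) (MvPolynomial (Vars n) (BaseField I)),
    MvPolynomial.algebraMap_eq]
  simp

theorem renameVars_comp_algebraMap (f : Vars m → Vars n) (hf : Function.Injective f) :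
    (renameVars f hf).comp (algebraMap (BaseField I) (RatFun m)) =
      algebraMap (BaseField I) (RatFun n) :=
  RingHom.ext (renameVars_const f hf)

theorem renameVars_renameVars (f : Vars m → Vars n) (hf : Function.Injective f)
    (g : Vars n → Vars k) (hg : Function.Injective g) (R : RatFun m) :
    renameVars g hg (renameVars f hf R) = renameVars (g ∘ f) (hg.comp hf) R := by
  have h : (renameVars g hg).comp (renameVars f hf) = renameVars (g ∘ f) (hg.comp hf) := by
    apply ratFun_ringHom_ext
    · simp [renameVars_const]
    · simp [renameVars_zVar]
  exact RingHom.congr_fun h R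

variable [Fintype I]

theorem sym_sum {α : Type*} (s : Finset α) (R : α → RatFun n) :
    sym (∑ a ∈ s, R a) = ∑ a ∈ s, sym (R a) := by
  simp only [sym, map_sum]
  exact Finset.sum_comm

theorem sym_const_mul (c : BaseField I) (R : RatFun n) :
    sym (const n c * R) = const n c * sym R := by
  simp [sym, Finset.mul_sum, renameVars_const]

theorem sym_renameVars (t : ∀ i, Equiv.Perm (Fin (n i))) (R : RatFun n) :
    sym (renameVars (permVars t) (permVars t).injective R) = sym R := by
  classical
  unfold sym
  refine Fintype.sum_equiv (Equiv.mulRight t) _ _ fun s => ?_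
  rw [renameVars_renameVars]
  congr 1

theorem renameVars_sym (t : ∀ i, Equiv.Perm (Fin (n i))) (R : RatFun n) :
    renameVars (permVars t) (permVars t).injective (sym R) = sym R := by
  classical
  unfold sym
  rw [map_sum]
  refine Fintype.sum_equiv (Equiv.mulLeft t) _ _ fun s => ?_
  rw [renameVars_renameVars]
  congr 1

end rename

/-! ### The elements of words as symmetrizations -/

section words

variable {I : Type*}

open Classical in
/-- The variables `l`, preceded by one new variable of colour `i`. -/
def consVars (i : I) {n : I → ℕ} (l : List (Vars n)) : List (Vars (Pi.single i 1 + n)) :=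
  inFirst (Pi.single i 1) n ⟨i, ⟨0, by simp⟩⟩ :: l.map (inLast (Pi.single i 1) n)

open Classical in
/-- The exponents `e`, extended by the exponent `d` of a new variable of colour `i`. -/
def consExp (i : I) {n : I → ℕ} (d : ℤ) (e : Vars n → ℤ) : Vars (Pi.single i 1 + n) → ℤ :=
  fun x => Fin.append (fun _ : Fin (Pi.single (M := fun _ => ℕ) i 1 x.1) => d)
    (fun b => e ⟨x.1, b⟩) x.2

/-- The variables of a word in the order in which the word uses them. -/
def wordVars : (w : Word I) → List (Vars (wordDim w))
  | [] => []
  | l :: w => consVars l.1 (wordVars w)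

open Classical in
theorem eq_of_vars_single (i : I) (x : Vars (Pi.single i 1 : I → ℕ)) :
    x = ⟨i, ⟨0, by simp⟩⟩ := by
  obtain ⟨j, a, ha⟩ := x
  by_cases h : j = i
  · subst h
    have : a = 0 := by simpa using ha
    subst this; rfl
  · simp [h] at ha

theorem inFirst_ne_inLast (n n' : I → ℕ) (x : Vars n) (y : Vars n') :
    inFirst n n' x ≠ inLast n n' y := by
  obtain ⟨i, a⟩ := x
  obtain ⟨j, b⟩ := y
  intro h
  obtain ⟨rfl, h2⟩ := Sigma.mk.inj_iff.1 h
  have h3 := congrArg Fin.val (eq_of_heq h2)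
  simp at h3
  omega

theorem eq_inFirst_or_inLast {n n' : I → ℕ} (x : Vars (n + n')) :
    (∃ y, x = inFirst n n' y) ∨ ∃ y, x = inLast n n' y := by
  obtain ⟨i, a⟩ := x
  refine Fin.addCases (m := n i) (n := n' i)
    (motive := fun a => (∃ y, (⟨i, a⟩ : Vars (n + n')) = inFirst n n' y) ∨
      ∃ y, (⟨i, a⟩ : Vars (n + n')) = inLast n n' y) ?_ ?_ a
  · exact fun b => Or.inl ⟨⟨i, b⟩, rfl⟩
  · exact fun b => Or.inr ⟨⟨i, b⟩, rfl⟩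

section cons

variable (i : I) {n : I → ℕ}

theorem consVars_nodup {l : List (Vars n)} (hl : l.Nodup) : (consVars i l).Nodup := by
  rw [consVars, List.nodup_cons]
  refine ⟨?_, hl.map (inLast_injective _ _)⟩
  rw [List.mem_map]
  rintro ⟨y, _, h⟩
  exact inFirst_ne_inLast _ _ _ _ h.symm

theorem mem_consVars {l : List (Vars n)} (hl : ∀ x, x ∈ l) (x) : x ∈ consVars i l := by
  rw [consVars, List.mem_cons]
  rcases eq_inFirst_or_inLast x with ⟨y, rfl⟩ | ⟨y, rfl⟩
  · left; rw [eq_of_vars_single i y]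
  · right; exact List.mem_map_of_mem (hl y)

theorem consExp_inFirst (d : ℤ) (e : Vars n → ℤ) (y) : consExp i d e (inFirst _ n y) = d := by
  simp [consExp, inFirst]

theorem consExp_inLast (d : ℤ) (e : Vars n → ℤ) (y) : consExp i d e (inLast _ n y) = e y := by
  simp [consExp, inLast]

theorem map_consVars (d : ℤ) (e : Vars n → ℤ) (l : List (Vars n)) :
    (consVars i l).map (fun x => (x.1, consExp i d e x)) =
      (i, d) :: l.map fun x => (x.1, e x) := by
  rw [consVars, List.map_cons, List.map_map, consExp_inFirst]
  congr 1
  refine List.map_congr_left fun x _ => ?_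
  rw [Function.comp_apply, consExp_inLast]
  simp [inLast]

end cons

theorem wordVars_nodup (w : Word I) : (wordVars w).Nodup := by
  induction w with
  | nil => simp [wordVars]
  | cons l w ih => exact consVars_nodup l.1 ih

theorem mem_wordVars (w : Word I) (x : Vars (wordDim w)) : x ∈ wordVars w := by
  induction w with
  | nil => exact absurd x.2.2 (by simp [wordDim])
  | cons l w ih => exact mem_consVars l.1 ih x

theorem map_wordVars (w : Word I) : (wordVars w).map (fun x => (x.1, wordExp w x)) = w := by
  induction w with
  | nil => simp [wordVars]
  | cons l w ih =>
    refine (map_consVars l.1 l.2 (wordExp w) (wordVars w)).trans ?_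
    rw [ih]

theorem list_prod_map_eq {α M : Type*} [Fintype α] [CommMonoid M] (l : List α) (hl : l.Nodup)
    (hl' : ∀ x, x ∈ l) (f : α → M) : (l.map f).prod = ∏ x, f x := by
  classical
  rw [← List.prod_toFinset f hl]
  congr 1
  ext x; simp [hl' x]

/-- The extension of permutations of the last variables by the identity on the first ones. -/
def extendPerm (n : I → ℕ) {n' : I → ℕ} (s : ∀ i, Equiv.Perm (Fin (n' i))) :
    ∀ i, Equiv.Perm (Fin ((n + n') i)) := fun i =>
  (finSumFinEquiv (m := n i) (n := n' i)).permCongr (Equiv.sumCongr (Equiv.refl _) (s i))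

theorem extendPerm_inFirst (n : I → ℕ) {n' : I → ℕ} (s : ∀ i, Equiv.Perm (Fin (n' i)))
    (x : Vars n) : permVars (extendPerm n s) (inFirst n n' x) = inFirst n n' x := by
  rw [permVars_apply]
  refine Sigma.ext rfl (heq_of_eq ?_)
  change finSumFinEquiv (Equiv.sumCongr (Equiv.refl _) (s x.1)
    (finSumFinEquiv.symm (Fin.castAdd _ x.2))) = Fin.castAdd _ x.2
  simp

theorem extendPerm_inLast (n : I → ℕ) {n' : I → ℕ} (s : ∀ i, Equiv.Perm (Fin (n' i)))
    (x : Vars n') : permVars (extendPerm n s) (inLast n n' x) = inLast n n' (permVars s x) := by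
  rw [permVars_apply]
  refine Sigma.ext rfl (heq_of_eq ?_)
  change finSumFinEquiv (Equiv.sumCongr (Equiv.refl _) (s x.1)
    (finSumFinEquiv.symm (Fin.natAdd _ x.2))) = Fin.natAdd _ (s x.1 x.2)
  simp

section

variable [Fintype I]

open Classical in
theorem prod_vars_single {M : Type*} [CommMonoid M] (i : I)
    (f : Vars (Pi.single i 1 : I → ℕ) → M) : ∏ x, f x = f ⟨i, ⟨0, by simp⟩⟩ := by
  rw [Fintype.prod_eq_single ⟨i, ⟨0, by simp⟩⟩]
  intro x hx
  exact absurd (eq_of_vars_single i x) hx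

theorem prod_vars_add {M : Type*} [CommMonoid M] {n n' : I → ℕ} (f : Vars (n + n') → M) :
    ∏ x, f x = (∏ x, f (inFirst n n' x)) * ∏ x, f (inLast n n' x) := by
  classical
  rw [← Finset.prod_image (s := Finset.univ) (f := f) (g := inFirst n n')
    (fun x _ y _ h => inFirst_injective n n' h),
    ← Finset.prod_image (s := Finset.univ) (f := f) (g := inLast n n')
    (fun x _ y _ h => inLast_injective n n' h), ← Finset.prod_union]
  · congr 1
    ext x
    have := eq_inFirst_or_inLast x
    simp only [Finset.mem_univ, Finset.mem_union, Finset.mem_image, true_and, true_iff]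
    rcases this with ⟨y, rfl⟩ | ⟨y, rfl⟩
    · exact Or.inl ⟨y, rfl⟩
    · exact Or.inr ⟨y, rfl⟩
  · rw [Finset.disjoint_left]
    intro x hx hx'
    simp only [Finset.mem_univ, Finset.mem_image, true_and] at hx hx'
    obtain ⟨y, rfl⟩ := hx
    obtain ⟨y', hy⟩ := hx'
    exact inFirst_ne_inLast _ _ _ _ hy.symm

end

variable [Quiver I] [∀ i j : I, Fintype (i ⟶ j)] [Fintype I]

/-- The rational function whose symmetrization is the element of the word with the variables `l` and
the exponents `d`. -/
def wordTerm {n : I → ℕ} (l : List (Vars n)) (d : Vars n → ℤ) : RatFun n :=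
  (∏ x, zVar x ^ d x) * zetaList (algebraMap (BaseField I) (RatFun n)) zVar l

theorem renameVars_wordTerm {n m : I → ℕ} (f : Vars n → Vars m) (hf : Function.Injective f)
    (l : List (Vars n)) (d : Vars n → ℤ) :
    renameVars f hf (wordTerm l d) = (∏ x, zVar (f x) ^ d x) *
      zetaList (algebraMap (BaseField I) (RatFun m)) (fun x => zVar (f x)) l := by
  rw [wordTerm, map_mul, map_zetaList, renameVars_comp_algebraMap]
  simp [renameVars_zVar]

theorem wordTerm_cons (i : I) (d : ℤ) {n : I → ℕ} {l : List (Vars n)} (hl : l.Nodup)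
    (hl' : ∀ x, x ∈ l) (e : Vars n → ℤ) :
    wordTerm (consVars i l) (consExp i d e) =
      renameVars _ (inFirst_injective _ n) (letterElt (i, d)) *
      renameVars _ (inLast_injective _ n) (wordTerm l e) *
      ∏ x, ∏ y : Vars n, zeta x.1 y.1 (zVar (inFirst _ n x) / zVar (inLast _ n y)) := by
  classical
  rw [renameVars_wordTerm, wordTerm, letterElt, map_zpow₀, renameVars_zVar, prod_vars_single,
    consVars, zetaList, List.map_map, list_prod_map_eq _ hl hl',
    zetaList_map _ _ (inLast (Pi.single i 1) n) (fun _ => rfl)]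
  have h : ∏ x, (zVar x : RatFun (Pi.single i 1 + n)) ^ consExp i d e x =
      zVar (inFirst (Pi.single i 1) n ⟨i, ⟨0, by simp⟩⟩) ^ d *
      ∏ x, zVar (inLast (Pi.single i 1) n x) ^ e x := by
    rw [prod_vars_add, prod_vars_single, consExp_inFirst]
    congr 1
    exact Finset.prod_congr rfl fun x _ => by rw [consExp_inLast]
  rw [h]
  simp only [zeta_eq_zetaAt, Function.comp_def]
  simp only [inFirst, inLast]
  ring

theorem wordRat_eq_sym (w : Word I) :
    wordRat w = sym (wordTerm (wordVars w) (wordExp w)) := by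
  classical
  induction w with
  | nil =>
    rw [wordRat, sym, Fintype.sum_eq_single 1]
    · have : IsEmpty (Vars (wordDim ([] : Word I))) := ⟨fun x => absurd x.2.2 (by simp [wordDim])⟩
      simp [wordTerm, wordVars, zetaList]
    · intro s hs
      exact absurd (funext fun i => Equiv.ext fun a => absurd a.2 (by simp [wordDim])) hs
  | cons l w ih =>
    rw [wordRat, shuffleMul, ih]
    set c : ℕ := ∏ i, (wordDim w i).factorial with hc
    have hc0 : (c : BaseField I) ≠ 0 := by
      rw [Nat.cast_ne_zero]; exact Finset.prod_ne_zero_iff.2 fun i _ => Nat.factorial_ne_zero _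
    have h1 : ∏ i, ((Pi.single (M := fun _ => ℕ) l.1 1 i).factorial :
        RatFun (Pi.single l.1 1 + wordDim w)) = 1 := by
      refine Finset.prod_eq_one fun i _ => ?_
      by_cases h : i = l.1
      · subst h; simp
      · simp [h]
    rw [h1, one_mul]
    have h2 : renameVars _ (inFirst_injective _ (wordDim w)) (letterElt l) *
        renameVars _ (inLast_injective _ (wordDim w)) (sym (wordTerm (wordVars w) (wordExp w))) /
        (∏ i, ((wordDim w i).factorial : RatFun (Pi.single l.1 1 + wordDim w))) *
        ∏ x, ∏ y : Vars (wordDim w),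
        zeta x.1 y.1 (zVar (inFirst _ (wordDim w) x) / zVar (inLast _ (wordDim w) y)) =
        const _ (c : BaseField I)⁻¹ * ∑ s : ∀ i, Equiv.Perm (Fin (wordDim w i)),
          renameVars (permVars (extendPerm (Pi.single l.1 1) s)) (permVars _).injective
            (wordTerm (consVars l.1 (wordVars w)) (consExp l.1 l.2 (wordExp w))) := by
      have h3 : (∏ i, ((wordDim w i).factorial : RatFun (Pi.single l.1 1 + wordDim w))) =
          const _ (c : BaseField I) := by
        rw [const, hc]; simp
      rw [h3, div_eq_mul_inv, const, const, map_inv₀, sym, map_sum, Finset.mul_sum, Finset.sum_mul,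
        Finset.sum_mul, Finset.mul_sum]
      refine Finset.sum_congr rfl fun s _ => ?_
      rw [wordTerm_cons _ _ (wordVars_nodup w) (mem_wordVars w), map_mul, map_mul, renameVars_renameVars, renameVars_renameVars,
        renameVars_renameVars]
      have e1 : (permVars (extendPerm (Pi.single l.1 1) s) ∘ inFirst (Pi.single l.1 1) (wordDim w))
          = inFirst (Pi.single l.1 1) (wordDim w) := funext (extendPerm_inFirst _ s)
      have e2 : (permVars (extendPerm (Pi.single l.1 1) s) ∘ inLast (Pi.single l.1 1) (wordDim w))
          = inLast (Pi.single l.1 1) (wordDim w) ∘ permVars s := funext (extendPerm_inLast _ s)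
      have e3 : renameVars (permVars (extendPerm (Pi.single l.1 1) s)) (permVars _).injective
          (∏ x, ∏ y : Vars (wordDim w),
          zeta x.1 y.1 (zVar (inFirst _ (wordDim w) x) / zVar (inLast _ (wordDim w) y))) =
          ∏ x, ∏ y : Vars (wordDim w),
          zeta x.1 y.1 (zVar (inFirst (Pi.single l.1 1) (wordDim w) x) /
            zVar (inLast _ (wordDim w) y)) := by
        simp only [map_prod, zeta_eq_zetaAt, map_zetaAt, renameVars_comp_algebraMap, map_div₀,
          renameVars_zVar, extendPerm_inFirst, extendPerm_inLast]
        refine Finset.prod_congr rfl fun x _ => ?_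
        exact Fintype.prod_equiv (permVars s) _ _ fun y => rfl
      rw [e3]
      simp only [e1, e2]
      ring
    have h4 := congrArg sym h2
    refine h4.trans ?_
    rw [sym_const_mul, sym_sum]
    simp only [sym_renameVars]
    rw [Finset.sum_const, Finset.card_univ, Fintype.card_pi, nsmul_eq_mul, ← mul_assoc]
    simp only [Fintype.card_perm, Fintype.card_fin]
    rw [← hc]
    have h5 : const (Pi.single l.1 1 + wordDim w) (c : BaseField I)⁻¹ * (c : RatFun _) = 1 := by
      rw [const, map_inv₀, map_natCast]
      exact inv_mul_cancel₀ (by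
        have := (Nat.cast_ne_zero (R := BaseField I)).1 hc0
        exact Nat.cast_ne_zero.2 this)
    rw [h5]
    exact one_mul _

end words

end QuiverShuffle
end


noncomputable section

namespace QuiverShuffle

/-! ### Products over ordered pairs of a list -/

section Before

variable {α β M : Type*}

/-- `x` occurs before `y` in a list. -/
def Before : List α → α → α → Prop
  | [], _, _ => False
  | a :: l, x, y => (x = a ∧ y ∈ l) ∨ Before l x y

theorem Before.mem_left {l : List α} {x y : α} (h : Before l x y) : x ∈ l := by
  induction l with
  | nil => exact h.elim
  | cons a l ih =>
    rcases h with ⟨rfl, _⟩ | h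
    · simp
    · exact List.mem_cons_of_mem _ (ih h)

theorem Before.mem_right {l : List α} {x y : α} (h : Before l x y) : y ∈ l := by
  induction l with
  | nil => exact h.elim
  | cons a l ih =>
    rcases h with ⟨_, h⟩ | h
    · exact List.mem_cons_of_mem _ h
    · exact List.mem_cons_of_mem _ (ih h)

theorem Before.asymm {l : List α} (hl : l.Nodup) {x y : α} (h : Before l x y) :
    ¬ Before l y x := by
  induction l with
  | nil => exact h.elim
  | cons a l ih =>
    rw [List.nodup_cons] at hl
    rintro (⟨rfl, h2⟩ | h2)
    · rcases h with ⟨rfl, h1⟩ | h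
      · exact hl.1 h1
      · exact hl.1 h.mem_right
    · rcases h with ⟨rfl, h1⟩ | h
      · exact hl.1 h2.mem_right
      · exact ih hl.2 h h2

theorem Before.ne {l : List α} (hl : l.Nodup) {x y : α} (h : Before l x y) : x ≠ y := by
  rintro rfl
  exact h.asymm hl h

theorem before_total {l : List α} {x y : α} (hx : x ∈ l) (hy : y ∈ l) (hxy : x ≠ y) :
    Before l x y ∨ Before l y x := by
  induction l with
  | nil => simp at hx
  | cons a l ih =>
    rcases List.mem_cons.1 hx with hxa | hxl <;> rcases List.mem_cons.1 hy with hya | hyl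
    · exact absurd (hxa.trans hya.symm) hxy
    · exact Or.inl (Or.inl ⟨hxa, hyl⟩)
    · exact Or.inr (Or.inl ⟨hya, hxl⟩)
    · exact (ih hxl hyl).imp Or.inr Or.inr

theorem before_map {f : α → β} (hf : Function.Injective f) {l : List α} {x y : α} :
    Before (l.map f) (f x) (f y) ↔ Before l x y := by
  induction l with
  | nil => simp [Before]
  | cons a l ih => simp [Before, ih, hf.eq_iff]

open Classical in
theorem prod_before_cons [CommMonoid M] [Fintype α] {a : α} {l : List α} (hl : (a :: l).Nodup)
    (f : α → α → M) :
    ∏ x, ∏ y, (if Before (a :: l) x y then f x y else 1) =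
      (l.map (f a)).prod * ∏ x, ∏ y, if Before l x y then f x y else 1 := by
  rw [List.nodup_cons] at hl
  have h1 : (l.map (f a)).prod = ∏ x, ∏ y, if x = a ∧ y ∈ l then f x y else 1 := by
    rw [Fintype.prod_eq_single a]
    · rw [← List.prod_toFinset _ hl.2, ← Finset.prod_filter]
      refine Finset.prod_congr ?_ fun _ _ => rfl
      ext y; simp
    · intro x hx
      simp [hx]
  rw [h1, ← Finset.prod_mul_distrib]
  refine Finset.prod_congr rfl fun x _ => ?_
  rw [← Finset.prod_mul_distrib]
  refine Finset.prod_congr rfl fun y _ => ?_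
  by_cases h2 : Before l x y
  · have : ¬ (x = a ∧ y ∈ l) := fun h => hl.1 (h.1 ▸ h2.mem_left)
    simp [Before, h2, this]
  · simp [Before, h2]

end Before

section

variable {I : Type*} [Quiver I] [∀ i j : I, Fintype (i ⟶ j)] [Fintype I] {n : I → ℕ}
  {L : Type*} [Field L]

open Classical in
theorem zetaList_eq_prod (ι : BaseField I →+* L) (u : Vars n → L) {l : List (Vars n)}
    (hl : l.Nodup) :
    zetaList ι u l = ∏ x, ∏ y, if Before l x y then zetaAt ι x.1 y.1 (u x / u y) else 1 := by
  induction l with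
  | nil => simp [zetaList, Before]
  | cons a l ih => rw [prod_before_cons hl, zetaList, ih (List.nodup_cons.1 hl).2]

end

/-! ### Rational functions that are Laurent polynomials -/

section Laurent

variable {I : Type*} [Quiver I] [Fintype I] {n : I → ℕ}

/-- The rational function becomes a polynomial after multiplication by a monomial. -/
def IsLaurent (f : RatFun n) : Prop :=
  ∃ (N : ℕ) (Q : MvPolynomial (Vars n) (BaseField I)),
    f * (∏ x, zVar x) ^ N = algebraMap _ (RatFun n) Q

namespace IsLaurent

variable {f g : RatFun n}

theorem of_algebraMap (Q : MvPolynomial (Vars n) (BaseField I)) :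
    IsLaurent (algebraMap _ (RatFun n) Q) := ⟨0, Q, by simp⟩

theorem const (c : BaseField I) : IsLaurent (const n c) := by
  rw [QuiverShuffle.const,
    IsScalarTower.algebraMap_apply (BaseField I) (MvPolynomial (Vars n) (BaseField I))]
  exact of_algebraMap _

theorem one : IsLaurent (1 : RatFun n) := by simpa using of_algebraMap (n := n) (1 : MvPolynomial _ _)

theorem zero : IsLaurent (0 : RatFun n) := by
  simpa using of_algebraMap (n := n) (0 : MvPolynomial _ _)

theorem zVar_eq (x : Vars n) : IsLaurent (zVar x : RatFun n) := of_algebraMap _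

theorem prod_zVar_eq : (∏ x, zVar x : RatFun n) =
    algebraMap _ _ (∏ x, MvPolynomial.X x : MvPolynomial (Vars n) (BaseField I)) := by
  rw [map_prod]; rfl

theorem mul (hf : IsLaurent f) (hg : IsLaurent g) : IsLaurent (f * g) := by
  obtain ⟨N, Q, h⟩ := hf
  obtain ⟨N', Q', h'⟩ := hg
  exact ⟨N + N', Q * Q', by rw [map_mul, ← h, ← h']; ring⟩

theorem add (hf : IsLaurent f) (hg : IsLaurent g) : IsLaurent (f + g) := by
  obtain ⟨N, Q, h⟩ := hf
  obtain ⟨N', Q', h'⟩ := hg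
  refine ⟨N + N', Q * (∏ x, MvPolynomial.X x) ^ N' + Q' * (∏ x, MvPolynomial.X x) ^ N, ?_⟩
  rw [map_add, map_mul, map_mul, ← h, ← h', map_pow, map_pow, ← prod_zVar_eq]
  ring

theorem neg (hf : IsLaurent f) : IsLaurent (-f) := by
  obtain ⟨N, Q, h⟩ := hf
  exact ⟨N, -Q, by rw [map_neg, ← h]; ring⟩

theorem sub (hf : IsLaurent f) (hg : IsLaurent g) : IsLaurent (f - g) := by
  rw [sub_eq_add_neg]; exact hf.add hg.neg

theorem sum {ι : Type*} (s : Finset ι) {f : ι → RatFun n} (h : ∀ i ∈ s, IsLaurent (f i)) :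
    IsLaurent (∑ i ∈ s, f i) :=
  Finset.sum_induction f IsLaurent (fun _ _ => add) zero h

theorem prod {ι : Type*} (s : Finset ι) {f : ι → RatFun n} (h : ∀ i ∈ s, IsLaurent (f i)) :
    IsLaurent (∏ i ∈ s, f i) :=
  Finset.prod_induction f IsLaurent (fun _ _ => mul) one h

theorem inv_zVar (x : Vars n) : IsLaurent (zVar x : RatFun n)⁻¹ := by
  classical
  refine ⟨1, ∏ y ∈ Finset.univ.erase x, MvPolynomial.X y, ?_⟩
  rw [pow_one, ← Finset.mul_prod_erase _ _ (Finset.mem_univ x), map_prod, ← mul_assoc,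
    inv_mul_cancel₀ (zVar_ne_zero x), one_mul]
  rfl

theorem zVar_zpow (x : Vars n) (k : ℤ) : IsLaurent ((zVar x : RatFun n) ^ k) := by
  cases k with
  | ofNat k => simpa using prod (Finset.range k) (f := fun _ => zVar x) fun _ _ => zVar_eq x
  | negSucc k =>
    rw [zpow_negSucc, ← inv_pow]
    simpa using prod (Finset.range (k + 1)) (f := fun _ => (zVar x)⁻¹) fun _ _ => inv_zVar x

theorem exists_toRat (hf : IsLaurent f) : ∃ P : Laurent (I := I) n, Laurent.toRat n P = f := by
  classical
  obtain ⟨N, Q, h⟩ := hf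
  refine ⟨∑ m ∈ Q.support, Finsupp.single (fun x => (m x : ℤ) - N) (Q.coeff m), ?_⟩
  have hz : (∏ x, zVar x : RatFun n) ^ N ≠ 0 :=
    pow_ne_zero _ (Finset.prod_ne_zero_iff.2 fun x _ => zVar_ne_zero x)
  apply mul_right_cancel₀ hz
  rw [h]
  conv_rhs => rw [← MvPolynomial.support_sum_monomial_coeff Q]
  rw [map_sum, map_sum, Finset.sum_mul]
  refine Finset.sum_congr rfl fun m _ => ?_
  rw [Laurent.toRat, Laurent.subst, Finsupp.linearCombination_single, Algebra.smul_def,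
    MvPolynomial.monomial_eq, map_mul, ← MvPolynomial.algebraMap_eq,
    ← IsScalarTower.algebraMap_apply, mul_assoc, ← Finset.prod_pow, ← Finset.prod_mul_distrib]
  congr 1
  rw [Finsupp.prod_fintype _ _ (by simp), map_prod]
  refine Finset.prod_congr rfl fun x _ => ?_
  rw [map_pow, ← zpow_natCast (zVar x) N, ← zpow_add₀ (zVar_ne_zero x), sub_add_cancel, zpow_natCast]
  rfl

end IsLaurent

end Laurent

/-! ### Divisibility by differences of variables -/

section diff

variable {σ F : Type*} [Field F]

open Classical in
/-- The homomorphism that replaces the variable `x` by the variable `y`. -/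
def identify (x y : σ) : MvPolynomial σ F →ₐ[F] MvPolynomial σ F :=
  MvPolynomial.aeval (Function.update MvPolynomial.X x (MvPolynomial.X y))

theorem X_sub_X_dvd_sub_identify (x y : σ) (a : MvPolynomial σ F) :
    (MvPolynomial.X x - MvPolynomial.X y) ∣ a - identify x y a := by
  classical
  rw [← Ideal.mem_span_singleton, ← Ideal.Quotient.eq]
  set J := Ideal.span {(MvPolynomial.X x - MvPolynomial.X y : MvPolynomial σ F)}
  have h : (Ideal.Quotient.mk J) = (Ideal.Quotient.mk J).comp
      (identify x y : MvPolynomial σ F →ₐ[F] MvPolynomial σ F).toRingHom := by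
    apply MvPolynomial.ringHom_ext
    · intro c; simp [identify]
    · intro z
      by_cases hz : z = x
      · subst hz
        simp only [identify, AlgHom.toRingHom_eq_coe, RingHom.coe_comp, RingHom.coe_coe,
          Function.comp_apply, MvPolynomial.aeval_X, Function.update_self]
        rw [Ideal.Quotient.eq]
        exact Ideal.mem_span_singleton_self _
      · simp [identify, hz]
  exact RingHom.congr_fun h a

theorem identify_eq_zero_iff {x y : σ} (hxy : x ≠ y) (a : MvPolynomial σ F) :
    identify x y a = 0 ↔ (MvPolynomial.X x - MvPolynomial.X y) ∣ a := by
  classical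
  constructor
  · intro h
    simpa [h] using X_sub_X_dvd_sub_identify x y a
  · rintro ⟨b, rfl⟩
    simp [identify, hxy.symm]

theorem prime_X_sub_X {x y : σ} (hxy : x ≠ y) :
    Prime (MvPolynomial.X x - MvPolynomial.X y : MvPolynomial σ F) := by
  refine ⟨sub_ne_zero.2 fun h => hxy (MvPolynomial.X_injective h), fun h => ?_, fun a b h => ?_⟩
  · have h1 := h.map (identify (F := F) x y)
    rw [(identify_eq_zero_iff hxy _).2 dvd_rfl] at h1
    exact not_isUnit_zero h1
  · rw [← identify_eq_zero_iff hxy, ← identify_eq_zero_iff hxy]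
    rw [← identify_eq_zero_iff hxy, map_mul] at h
    exact mul_eq_zero.1 h

end diff

/-! ### Elements of words are Laurent polynomials -/

section wordLaurent

variable {I : Type*} [Quiver I] {n : I → ℕ}

theorem eval₂Hom_update_eq [DecidableEq (Vars n)] (x y : Vars n)
    (a : MvPolynomial (Vars n) (BaseField I)) :
    MvPolynomial.eval₂Hom (algebraMap (BaseField I) (RatFun n))
      (Function.update zVar x (zVar y)) a = algebraMap _ (RatFun n) (identify x y a) := by
  have h : MvPolynomial.eval₂Hom (algebraMap (BaseField I) (RatFun n))
      (Function.update zVar x (zVar y)) =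
      (algebraMap (MvPolynomial (Vars n) (BaseField I)) (RatFun n)).comp
        (identify x y : MvPolynomial (Vars n) (BaseField I) →ₐ[BaseField I] _).toRingHom := by
    apply MvPolynomial.ringHom_ext
    · intro c
      simp [identify, IsScalarTower.algebraMap_apply (BaseField I)
        (MvPolynomial (Vars n) (BaseField I)) (RatFun n)]
    · intro z
      by_cases hz : z = x
      · subst hz; simp [identify, zVar]
      · simp [identify, zVar, hz]
  exact RingHom.congr_fun h a

theorem evalsTo_renameVars {L : Type*} [Field L] (ι : BaseField I →+* L) (v : Vars n → L)
    (f : Vars n → Vars n) (hf : Function.Injective f) {R : RatFun n} {w : L}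
    (h : EvalsTo (MvPolynomial.eval₂Hom ι (v ∘ f)) R w) :
    EvalsTo (MvPolynomial.eval₂Hom ι v) (renameVars f hf R) w := by
  have key : ∀ a : MvPolynomial (Vars n) (BaseField I),
      MvPolynomial.eval₂Hom ι v (MvPolynomial.rename f a) =
        MvPolynomial.eval₂Hom ι (v ∘ f) a := by
    intro a
    simp [MvPolynomial.eval₂_rename]
  have key2 : ∀ a : MvPolynomial (Vars n) (BaseField I),
      renameVars f hf (algebraMap _ (RatFun n) a) =
        algebraMap _ (RatFun n) (MvPolynomial.rename f a) := by
    intro a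
    rw [renameVars, IsFractionRing.lift_algebraMap]
    rfl
  obtain ⟨a, b, h0, h1, h2⟩ := h
  refine ⟨MvPolynomial.rename f a, MvPolynomial.rename f b, ?_, ?_, ?_⟩
  · rwa [key]
  · rw [← key2, ← key2, ← h1, map_mul]
  · rwa [key, key]

open Classical in
/-- The exchange of two variables of the same colour. -/
def swapVars (i : I) (a b : Fin (n i)) : ∀ i, Equiv.Perm (Fin (n i)) :=
  Function.update 1 i (Equiv.swap a b)

theorem permVars_swapVars [DecidableEq (Vars n)] (i : I) (a b : Fin (n i)) (x : Vars n) :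
    permVars (swapVars i a b) x = Equiv.swap (⟨i, a⟩ : Vars n) ⟨i, b⟩ x := by
  obtain ⟨j, c⟩ := x
  by_cases h : j = i
  · subst h
    rw [permVars_apply, swapVars]
    simp only [Function.update_self]
    rw [Equiv.swap_apply_def, Equiv.swap_apply_def]
    by_cases h1 : c = a
    · simp [h1]
    · by_cases h2 : c = b
      · subst h2; simp [h1]
      · simp [h1, h2]
  · rw [permVars_apply, swapVars, Equiv.swap_apply_of_ne_of_ne]
    · simp [h]
    · intro h1; exact h (congrArg Sigma.fst h1)
    · intro h1; exact h (congrArg Sigma.fst h1)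

/-- A symmetric function with at most a simple pole along `z_x = z_y` has no pole there. -/
theorem exists_not_dvd_of_symmetric {R : RatFun n}
    (hR : ∀ s, renameVars (permVars s) (permVars s).injective R = R)
    [DecidableEq (Vars n)] {i : I} {a b : Fin (n i)} (hab : a ≠ b) {v : RatFun n}
    (h : EvalsTo (MvPolynomial.eval₂Hom (algebraMap (BaseField I) (RatFun n))
      (Function.update zVar (⟨i, a⟩ : Vars n) (zVar ⟨i, b⟩)))
      (R * (zVar (⟨i, a⟩ : Vars n) - zVar ⟨i, b⟩)) v) :
    ∃ p q : MvPolynomial (Vars n) (BaseField I),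
      ¬ (MvPolynomial.X (⟨i, a⟩ : Vars n) - MvPolynomial.X (⟨i, b⟩ : Vars n)) ∣ q ∧
      R * algebraMap _ (RatFun n) q = algebraMap _ (RatFun n) p := by
  set x : Vars n := ⟨i, a⟩ with hx
  set y : Vars n := ⟨i, b⟩ with hy
  have hxy : x ≠ y := by
    intro h; apply hab; simpa [hx, hy] using h
  have h1 : EvalsTo (MvPolynomial.eval₂Hom (algebraMap (BaseField I) (RatFun n))
      (Function.update zVar x (zVar y)))
      (renameVars (permVars (swapVars i a b)) (permVars _).injective
        (R * (zVar x - zVar y))) v := by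
    apply evalsTo_renameVars
    have e : Function.update (zVar : Vars n → RatFun n) x (zVar y) ∘ permVars (swapVars i a b) =
        Function.update zVar x (zVar y) := by
      funext z
      rw [Function.comp_apply, permVars_swapVars, Equiv.swap_apply_def]
      by_cases h1 : z = x
      · subst h1; simp [← hx, ← hy, hxy.symm]
      · by_cases h2 : z = y
        · subst h2; simp [← hx, ← hy, hxy.symm]
        · simp [← hx, ← hy, h1, h2]
    rw [e]
    exact h
  rw [map_mul, hR, map_sub, renameVars_zVar, renameVars_zVar, permVars_swapVars,
    permVars_swapVars, Equiv.swap_apply_left, Equiv.swap_apply_right] at h1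
  have h2 : R * (zVar y - zVar x) = -(R * (zVar x - zVar y)) := by ring
  rw [h2] at h1
  have h3 : v = -v := h1.unique h.neg
  have h4 : v = 0 := by
    have : (2 : RatFun n) * v = 0 := by linear_combination h3
    simpa using this
  subst h4
  obtain ⟨p, q, h5, h6, h7⟩ := h
  rw [eval₂Hom_update_eq, Ne, map_eq_zero_iff _ (IsFractionRing.injective _ _),
    identify_eq_zero_iff hxy] at h5
  rw [zero_mul, eval₂Hom_update_eq, eq_comm, map_eq_zero_iff _ (IsFractionRing.injective _ _),
    identify_eq_zero_iff hxy] at h7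
  obtain ⟨p', rfl⟩ := h7
  refine ⟨p', q, h5, ?_⟩
  have h8 : (zVar x - zVar y : RatFun n) ≠ 0 := sub_ne_zero.2 fun h => hxy (zVar_injective h)
  apply mul_left_cancel₀ h8
  rw [map_mul, map_sub] at h6
  simp only [zVar] at h6 ⊢
  linear_combination h6

end wordLaurent

end QuiverShuffle
end


noncomputable section

namespace QuiverShuffle

theorem Before.trans {α : Type*} {l : List α} (hl : l.Nodup) {x y z : α} (h : Before l x y)
    (h' : Before l y z) : Before l x z := by
  induction l with
  | nil => exact h.elim
  | cons a l ih =>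
    rw [List.nodup_cons] at hl
    rcases h' with ⟨rfl, _⟩ | h'
    · rcases h with ⟨rfl, h1⟩ | h
      · exact absurd h1 hl.1
      · exact absurd h.mem_right hl.1
    · rcases h with ⟨rfl, h1⟩ | h
      · exact Or.inl ⟨rfl, h'.mem_right⟩
      · exact Or.inr (ih hl.2 h h')

section wheelTerms

variable {I : Type*} [Quiver I] [∀ i j : I, Fintype (i ⟶ j)] {n : I → ℕ}
  {L : Type*} [Field L]

theorem evalsTo_zetaAt (ι : BaseField I →+* L) (u : Vars n → L) {i j : I} {f : RatFun n} {r : L}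
    (hf : EvalsTo (MvPolynomial.eval₂Hom ι u) f r) (h : i = j → r ≠ 1) :
    EvalsTo (MvPolynomial.eval₂Hom ι u) (zetaAt (algebraMap (BaseField I) (RatFun n)) i j f)
      (zetaAt ι i j r) := by
  classical
  rw [zetaAt, zetaAt]
  refine EvalsTo.mul ?_ (EvalsTo.prod _ fun c _ => ?_)
  · split_ifs with hij
    · refine EvalsTo.div ?_ (EvalsTo.one.sub hf) (sub_ne_zero.2 (h hij).symm)
      rw [← map_inv₀, ← map_inv₀]
      exact EvalsTo.one.sub (hf.mul (evalsTo_const ι u _))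
    · exact EvalsTo.one
  · exact EvalsTo.one.sub ((evalsTo_const ι u _).mul hf)

theorem evalsTo_zetaList (ι : BaseField I →+* L) {u : Vars n → L} (hu0 : ∀ x, u x ≠ 0)
    (hu : ∀ x y, x ≠ y → x.1 = y.1 → u x ≠ u y) {l : List (Vars n)} (hl : l.Nodup) :
    EvalsTo (MvPolynomial.eval₂Hom ι u)
      (zetaList (algebraMap (BaseField I) (RatFun n)) zVar l) (zetaList ι u l) := by
  induction l with
  | nil => simpa [zetaList] using EvalsTo.one
  | cons x l ih =>
    rw [List.nodup_cons] at hl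
    rw [zetaList, zetaList]
    refine EvalsTo.mul ?_ (ih hl.2)
    classical
    rw [← List.prod_toFinset _ hl.2, ← List.prod_toFinset _ hl.2]
    refine EvalsTo.prod _ fun y hy => evalsTo_zetaAt ι u
      ((evalsTo_zVar ι u x).div (evalsTo_zVar ι u y) (hu0 y)) fun hxy h => ?_
    rw [div_eq_one_iff_eq (hu0 y)] at h
    refine hu x y ?_ hxy h
    rintro rfl
    exact hl.1 (List.mem_toFinset.1 hy)

theorem zetaAt_q (ι : BaseField I →+* L) (i : I) : zetaAt ι i i (ι (qPar I)) = 0 := by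
  have : ι (qPar I) ≠ 0 := (map_ne_zero ι).2 qPar_ne_zero
  simp [zetaAt, this]

theorem zetaAt_inv_weight (ι : BaseField I →+* L) {i j : I} {c : BaseField I}
    (hc : c ∈ weights i j) : zetaAt ι i j (ι c)⁻¹ = 0 := by
  have : ι c ≠ 0 := (map_ne_zero ι).2 (weights_ne_zero hc)
  rw [zetaAt, Finset.prod_eq_zero hc, mul_zero]
  simp [this]

variable [Fintype I]

theorem evalsTo_wordTerm (ι : BaseField I →+* L) {u : Vars n → L} (hu0 : ∀ x, u x ≠ 0)
    (hu : ∀ x y, x ≠ y → x.1 = y.1 → u x ≠ u y) {l : List (Vars n)} (hl : l.Nodup)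
    (d : Vars n → ℤ) :
    EvalsTo (MvPolynomial.eval₂Hom ι u) (wordTerm l d) ((∏ x, u x ^ d x) * zetaList ι u l) := by
  rw [wordTerm]
  exact EvalsTo.mul (EvalsTo.prod _ fun x _ => (evalsTo_zVar ι u x).zpow (hu0 x) _)
    (evalsTo_zetaList ι hu0 hu hl)

theorem zetaList_eq_zero (ι : BaseField I →+* L) (u : Vars n → L) {l : List (Vars n)}
    (hl : l.Nodup) {x y : Vars n} (h : Before l x y) (h0 : zetaAt ι x.1 y.1 (u x / u y) = 0) :
    zetaList ι u l = 0 := by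
  classical
  rw [zetaList_eq_prod ι u hl]
  refine Finset.prod_eq_zero (Finset.mem_univ x) (Finset.prod_eq_zero (Finset.mem_univ y) ?_)
  rw [if_pos h, h0]

/-- The product over the pairs of a list vanishes on the loci of the wheel conditions. -/
theorem zetaList_wheel (ι : BaseField I →+* L) {u : Vars n → L} (hu0 : ∀ x, u x ≠ 0)
    {l : List (Vars n)} (hl : l.Nodup) (hl' : ∀ x, x ∈ l) {a a' x : Vars n} (haa : a' ≠ a)
    (hxa' : x ≠ a') (hcol : a'.1 = a.1) {c : BaseField I}
    (hc : c ∈ weights a.1 x.1) (h1 : u a' = ι (qPar I) * u a) (h2 : u x = ι c * u a) :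
    zetaList ι u l = 0 := by
  have hc0 : ι c ≠ 0 := (map_ne_zero ι).2 (weights_ne_zero hc)
  have hq0 : ι (qPar I) ≠ 0 := (map_ne_zero ι).2 qPar_ne_zero
  have ha0 := hu0 a
  rcases before_total (hl' a') (hl' a) haa with h | h
  · refine zetaList_eq_zero ι u hl h ?_
    rw [hcol, h1, mul_div_assoc, div_self ha0, mul_one, zetaAt_q]
  · rcases before_total (hl' x) (hl' a') hxa' with h' | h'
    · refine zetaList_eq_zero ι u hl h' ?_
      have e : u x / u a' = (ι (qPar I / c))⁻¹ := by
        rw [h1, h2, map_div₀]; field_simp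
      rw [e, hcol]
      exact zetaAt_inv_weight ι (div_mem_weights hc)
    · refine zetaList_eq_zero ι u hl (h.trans hl h') ?_
      have e : u a / u x = (ι c)⁻¹ := by rw [h2]; field_simp
      rw [e]
      exact zetaAt_inv_weight ι hc

end wheelTerms

section simplePoles

variable {I : Type*} [Quiver I] [∀ i j : I, Fintype (i ⟶ j)] [Fintype I] {n : I → ℕ}

open Classical in
/-- The product of the differences of distinct variables of the same colour, as a polynomial. -/
def diffProd (n : I → ℕ) : MvPolynomial (Vars n) (BaseField I) :=
  ∏ x : Vars n, ∏ y : Vars n,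
    if x.1 = y.1 ∧ x ≠ y then MvPolynomial.X x - MvPolynomial.X y else 1

theorem isLaurent_zetaAt_of_ne {x y : Vars n} (h : x.1 ≠ y.1) :
    IsLaurent (zetaAt (algebraMap (BaseField I) (RatFun n)) x.1 y.1 (zVar x / zVar y)) := by
  classical
  rw [zetaAt, if_neg h, one_mul, div_eq_mul_inv]
  exact IsLaurent.prod _ fun c _ => IsLaurent.one.sub
    ((IsLaurent.const c).mul ((IsLaurent.zVar_eq x).mul (IsLaurent.inv_zVar y)))

theorem zetaAt_mul_sub {x y : Vars n} (h : x.1 = y.1) (hxy : x ≠ y) :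
    zetaAt (algebraMap (BaseField I) (RatFun n)) x.1 y.1 (zVar x / zVar y) * (zVar x - zVar y) =
      (1 - zVar x * (zVar y)⁻¹ * const n (qPar I)⁻¹) * (-zVar y) *
        ∏ c ∈ weights x.1 y.1, (1 - const n c * (zVar x * (zVar y)⁻¹)) := by
  classical
  have h1 : (zVar y - zVar x : RatFun n) ≠ 0 :=
    sub_ne_zero.2 fun h => hxy (zVar_injective h).symm
  have h2 := zVar_ne_zero y
  rw [zetaAt, if_pos h, div_eq_mul_inv (zVar x)]
  have h3 : (1 - zVar x * (zVar y)⁻¹ : RatFun n) = (zVar y - zVar x) * (zVar y)⁻¹ := by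
    field_simp
  have h4 : (zVar x - zVar y : RatFun n) = -(zVar y - zVar x) := by ring
  rw [const, map_inv₀, h3, h4]
  simp only [const]
  field_simp

theorem isLaurent_wordTerm_mul {l : List (Vars n)} (hl : l.Nodup) (d : Vars n → ℤ) :
    IsLaurent (wordTerm l d * algebraMap _ (RatFun n) (diffProd n)) := by
  classical
  rw [wordTerm, mul_assoc, zetaList_eq_prod _ _ hl, diffProd, map_prod, ← Finset.prod_mul_distrib]
  refine (IsLaurent.prod _ fun x _ => IsLaurent.zVar_zpow x _).mul (IsLaurent.prod _ fun x _ => ?_)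
  rw [map_prod, ← Finset.prod_mul_distrib]
  refine IsLaurent.prod _ fun y _ => ?_
  by_cases h : x.1 = y.1 ∧ x ≠ y
  · rw [if_pos h, map_sub]
    change IsLaurent (_ * (zVar x - zVar y))
    by_cases hb : Before l x y
    · rw [if_pos hb, zetaAt_mul_sub h.1 h.2]
      exact ((IsLaurent.one.sub (((IsLaurent.zVar_eq x).mul (IsLaurent.inv_zVar y)).mul
        (IsLaurent.const _))).mul (IsLaurent.zVar_eq y).neg).mul
        (IsLaurent.prod _ fun c _ => IsLaurent.one.sub
        ((IsLaurent.const c).mul ((IsLaurent.zVar_eq x).mul (IsLaurent.inv_zVar y))))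
    · rw [if_neg hb, one_mul]
      exact (IsLaurent.zVar_eq x).sub (IsLaurent.zVar_eq y)
  · rw [if_neg h, map_one, mul_one]
    by_cases hb : Before l x y
    · rw [if_pos hb]
      exact isLaurent_zetaAt_of_ne fun h' => h ⟨h', hb.ne hl⟩
    · rw [if_neg hb]; exact IsLaurent.one

theorem exists_evalsTo_wordTerm_mul [DecidableEq (Vars n)] {l : List (Vars n)} (hl : l.Nodup)
    (hl' : ∀ x, x ∈ l) (d : Vars n → ℤ) {x y : Vars n} (hxy : x ≠ y) (hcol : x.1 = y.1) :
    ∃ v, EvalsTo (MvPolynomial.eval₂Hom (algebraMap (BaseField I) (RatFun n))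
      (Function.update zVar x (zVar y))) (wordTerm l d * (zVar x - zVar y)) v := by
  classical
  set u : Vars n → RatFun n := Function.update zVar x (zVar y) with hu
  have hu0 : ∀ z, u z ≠ 0 := by
    intro z
    by_cases h : z = x
    · subst h; simpa [hu] using zVar_ne_zero y
    · simpa [hu, h] using zVar_ne_zero z
  have hinj : ∀ a b, a ≠ b → ¬ ((a = x ∧ b = y) ∨ (a = y ∧ b = x)) → u a ≠ u b := by
    intro a b hab h
    by_cases ha : a = x
    · subst ha
      have hb : b ≠ y := fun hb => h (Or.inl ⟨rfl, hb⟩)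
      simp only [hu, Function.update_self, Function.update_of_ne hab.symm]
      exact fun h => hb (zVar_injective h).symm
    · by_cases hb : b = x
      · subst hb
        have ha' : a ≠ y := fun hb => h (Or.inr ⟨hb, rfl⟩)
        simp only [hu, Function.update_self, Function.update_of_ne hab]
        exact fun h => ha' (zVar_injective h)
      · simp only [hu, Function.update_of_ne ha, Function.update_of_ne hb]
        exact fun h => hab (zVar_injective h)
  set ι := algebraMap (BaseField I) (RatFun n)
  have hz := evalsTo_zVar (n := n) ι u
  have hq : ∏ a, ∏ b, (if Before l a b ∧ ((a = x ∧ b = y) ∨ (a = y ∧ b = x)) then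
      (zVar x - zVar y : RatFun n) else 1) = zVar x - zVar y := by
    have key : ∀ a0 b0, Before l a0 b0 → ((a0 = x ∧ b0 = y) ∨ (a0 = y ∧ b0 = x)) →
        ∏ a, ∏ b, (if Before l a b ∧ ((a = x ∧ b = y) ∨ (a = y ∧ b = x)) then
        (zVar x - zVar y : RatFun n) else 1) = zVar x - zVar y := by
      intro a0 b0 hb h0
      have h1 : ∀ a b, Before l a b ∧ ((a = x ∧ b = y) ∨ (a = y ∧ b = x)) → a = a0 ∧ b = b0 := by
        rintro a b ⟨h2, h3⟩
        rcases h0 with ⟨rfl, rfl⟩ | ⟨rfl, rfl⟩ <;> rcases h3 with ⟨rfl, rfl⟩ | ⟨rfl, rfl⟩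
        · exact ⟨rfl, rfl⟩
        · exact absurd h2 (hb.asymm hl)
        · exact absurd h2 (hb.asymm hl)
        · exact ⟨rfl, rfl⟩
      rw [Fintype.prod_eq_single a0, Fintype.prod_eq_single b0, if_pos ⟨hb, h0⟩]
      · exact fun b hb' => if_neg fun h => hb' (h1 _ _ h).2
      · exact fun a ha => Finset.prod_eq_one fun b _ => if_neg fun h => ha (h1 _ _ h).1
    rcases before_total (hl' x) (hl' y) hxy with h | h
    · exact key x y h (Or.inl ⟨rfl, rfl⟩)
    · exact key y x h (Or.inr ⟨rfl, rfl⟩)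
  rw [wordTerm, mul_assoc, zetaList_eq_prod _ _ hl]
  nth_rw 1 [← hq]
  rw [← Finset.prod_mul_distrib]
  have h1 : ∀ a b, ∃ v, EvalsTo (MvPolynomial.eval₂Hom ι u)
      ((if Before l a b then zetaAt ι a.1 b.1 (zVar a / zVar b) else 1) *
      (if Before l a b ∧ ((a = x ∧ b = y) ∨ (a = y ∧ b = x)) then
      (zVar x - zVar y : RatFun n) else 1)) v := by
    intro a b
    by_cases hb : Before l a b
    · by_cases h : (a = x ∧ b = y) ∨ (a = y ∧ b = x)
      · rw [if_pos hb, if_pos ⟨hb, h⟩]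
        have hc : a.1 = b.1 := by
          rcases h with ⟨rfl, rfl⟩ | ⟨rfl, rfl⟩
          · exact hcol
          · exact hcol.symm
        have e := (((EvalsTo.one.sub (((hz a).mul ((hz b).inv (hu0 b))).mul
          (evalsTo_const ι u (qPar I)⁻¹))).mul (hz b).neg)).mul
          (EvalsTo.prod (weights a.1 b.1) fun c _ => EvalsTo.one.sub
          ((evalsTo_const ι u c).mul ((hz a).mul ((hz b).inv (hu0 b)))))
        rw [← zetaAt_mul_sub hc (hb.ne hl)] at e
        rcases h with ⟨rfl, rfl⟩ | ⟨rfl, rfl⟩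
        · exact ⟨_, e⟩
        · have e2 := e.neg
          rw [← mul_neg, neg_sub] at e2
          exact ⟨_, e2⟩
      · rw [if_pos hb, if_neg fun h' => h h'.2, mul_one]
        refine ⟨_, evalsTo_zetaAt ι u ((hz a).div (hz b) (hu0 b)) fun _ h2 => ?_⟩
        rw [div_eq_one_iff_eq (hu0 b)] at h2
        exact hinj a b (hb.ne hl) h h2
    · rw [if_neg hb, if_neg fun h' => hb h'.1, mul_one]
      exact ⟨1, EvalsTo.one⟩
  choose v hv using h1
  refine ⟨(∏ z, u z ^ d z) * ∏ a, ∏ b, v a b,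
    EvalsTo.mul (EvalsTo.prod _ fun z _ => (hz z).zpow (hu0 z) (d z))
    (EvalsTo.prod _ fun a _ => ?_)⟩
  rw [← Finset.prod_mul_distrib]
  exact EvalsTo.prod _ fun b _ => hv a b

theorem renameVars_perm_wordTerm (s : ∀ i, Equiv.Perm (Fin (n i))) (l : List (Vars n))
    (d : Vars n → ℤ) :
    renameVars (permVars s) (permVars s).injective (wordTerm l d) =
      wordTerm (l.map (permVars s)) (d ∘ (permVars s).symm) := by
  rw [renameVars_wordTerm, wordTerm, zetaList_map _ _ (permVars s) (fun _ => rfl)]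
  congr 1
  exact Fintype.prod_equiv (permVars s) _ _ fun x => by simp

open Classical in
theorem sym_wordTerm (l : List (Vars n)) (d : Vars n → ℤ) :
    sym (wordTerm l d) = ∑ s : ∀ i, Equiv.Perm (Fin (n i)),
      wordTerm (l.map (permVars s)) (d ∘ (permVars s).symm) := by
  rw [sym]
  exact Finset.sum_congr rfl fun s _ => renameVars_perm_wordTerm s l d

theorem isLaurent_sym_wordTerm {l : List (Vars n)} (hl : l.Nodup) (hl' : ∀ x, x ∈ l)
    (d : Vars n → ℤ) : IsLaurent (sym (wordTerm l d)) := by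
  classical
  set E := sym (wordTerm l d) with hE
  have hlm : ∀ s : ∀ i, Equiv.Perm (Fin (n i)), (l.map (permVars s)).Nodup :=
    fun s => hl.map (permVars s).injective
  have hlm' : ∀ s : ∀ i, Equiv.Perm (Fin (n i)), ∀ x, x ∈ l.map (permVars s) := fun s x =>
    List.mem_map.2 ⟨(permVars s).symm x, hl' _, by simp⟩
  have h1 : IsLaurent (E * algebraMap _ (RatFun n) (diffProd n)) := by
    rw [hE, sym_wordTerm, Finset.sum_mul]
    exact IsLaurent.sum _ fun s _ => isLaurent_wordTerm_mul (hlm s) _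
  have h2 : ∀ x y : Vars n, x ≠ y → x.1 = y.1 → ∃ p q : MvPolynomial (Vars n) (BaseField I),
      ¬ (MvPolynomial.X x - MvPolynomial.X y) ∣ q ∧
      E * algebraMap _ (RatFun n) q = algebraMap _ (RatFun n) p := by
    rintro ⟨i, a⟩ ⟨j, b⟩ hxy hcol
    obtain rfl : i = j := hcol
    have h3 : ∀ s : ∀ i, Equiv.Perm (Fin (n i)), ∃ v,
        EvalsTo (MvPolynomial.eval₂Hom (algebraMap (BaseField I) (RatFun n))
        (Function.update zVar (⟨i, a⟩ : Vars n) (zVar ⟨i, b⟩)))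
        (wordTerm (l.map (permVars s)) (d ∘ (permVars s).symm) *
          (zVar (⟨i, a⟩ : Vars n) - zVar ⟨i, b⟩)) v := fun s =>
      exists_evalsTo_wordTerm_mul (hlm s) (hlm' s) _ hxy rfl
    choose v hv using h3
    refine exists_not_dvd_of_symmetric (R := E) (renameVars_sym · _) (i := i) (a := a) (b := b)
      (v := ∑ s, v s) (by rintro rfl; exact hxy rfl) ?_
    rw [hE, sym_wordTerm, Finset.sum_mul]
    exact EvalsTo.sum _ fun s _ => hv s
  obtain ⟨N, A, hA⟩ := h1
  set num := IsFractionRing.num (MvPolynomial (Vars n) (BaseField I)) E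
  set den : MvPolynomial (Vars n) (BaseField I) :=
    (IsFractionRing.den (MvPolynomial (Vars n) (BaseField I)) E).1
  have hnd : E * algebraMap _ (RatFun n) den = algebraMap _ (RatFun n) num := by
    have h := IsFractionRing.mk'_num_den' (MvPolynomial (Vars n) (BaseField I)) E
    have h0 : algebraMap _ (RatFun n) den ≠ 0 := by
      rw [Ne, map_eq_zero_iff _ (IsFractionRing.injective _ _)]
      exact nonZeroDivisors.coe_ne_zero _
    rw [← h]
    exact div_mul_cancel₀ _ h0
  have hcop : IsRelPrime num den := IsFractionRing.num_den_reduced (MvPolynomial (Vars n) (BaseField I)) E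
  have hdvd : ∀ p q : MvPolynomial (Vars n) (BaseField I),
      E * algebraMap _ (RatFun n) q = algebraMap _ (RatFun n) p → den ∣ q := by
    intro p q h
    have h4 : num * q = p * den := by
      apply IsFractionRing.injective (MvPolynomial (Vars n) (BaseField I)) (RatFun n)
      rw [map_mul, map_mul, ← h, ← hnd]; ring
    exact hcop.symm.dvd_of_dvd_mul_left ⟨p, by rw [h4, mul_comm]⟩
  set Z : MvPolynomial (Vars n) (BaseField I) := ∏ x, MvPolynomial.X x
  have hZ : (∏ x, zVar x : RatFun n) = algebraMap _ _ Z := IsLaurent.prod_zVar_eq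
  have h5 : den ∣ diffProd n * Z ^ N := by
    refine hdvd A _ ?_
    rw [map_mul, map_pow, ← hZ, ← mul_assoc, hA]
  have h6 : IsRelPrime den (diffProd n) := by
    rw [diffProd]
    refine IsRelPrime.prod_right fun x _ => IsRelPrime.prod_right fun y _ => ?_
    by_cases h : x.1 = y.1 ∧ x ≠ y
    · rw [if_pos h]
      have hp := (prime_X_sub_X (F := BaseField I) h.2).irreducible
      refine IsRelPrime.symm (hp.isRelPrime_iff_not_dvd.2 fun h7 => ?_)
      obtain ⟨p, q, h8, h9⟩ := h2 x y h.2 h.1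
      exact h8 (h7.trans (hdvd p q h9))
    · rw [if_neg h]; exact isRelPrime_one_right
  obtain ⟨b, hb⟩ := h6.dvd_of_dvd_mul_left h5
  refine ⟨N, num * b, ?_⟩
  rw [hZ, ← map_pow, hb, map_mul, map_mul, ← hnd]
  ring

end simplePoles

end QuiverShuffle
end


noncomputable section

namespace QuiverShuffle

/-! ### Elements of words satisfy the wheel conditions -/

section evalWord

variable {I : Type*} [Quiver I] {n : I → ℕ}

theorem const_mul_zVar_inj {c c' : BaseField I} {x y : Vars n} (hc : c ≠ 0)
    (h : (const n c * zVar x : RatFun n) = const n c' * zVar y) : x = y ∧ c = c' := by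
  classical
  have e : ∀ (c : BaseField I) (x : Vars n), (const n c * zVar x : RatFun n) =
      algebraMap _ _ (MvPolynomial.monomial (Finsupp.single x 1) c) := by
    intro c x
    rw [const, zVar, IsScalarTower.algebraMap_apply (BaseField I)
      (MvPolynomial (Vars n) (BaseField I)), ← map_mul, MvPolynomial.algebraMap_eq,
      MvPolynomial.C_mul_X_eq_monomial]
  rw [e, e] at h
  have h1 := IsFractionRing.injective _ _ h
  have h2 := (MvPolynomial.monomial_eq_monomial_iff _ _ _ _).1 h1
  rcases h2 with ⟨h3, h4⟩ | ⟨h3, _⟩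
  · refine ⟨?_, h4⟩
    by_contra hxy
    have := DFunLike.congr_fun h3 x
    rw [Finsupp.single_eq_same, Finsupp.single_apply, if_neg (Ne.symm hxy)] at this
    exact one_ne_zero this
  · exact absurd h3 hc

theorem qPar_ne_one : qPar I ≠ 1 := by
  intro h
  rw [qPar, ← map_one (algebraMap (MvPolynomial (Option (Quiver.Total I)) ℚ) (BaseField I))] at h
  have := congrArg MvPolynomial.totalDegree (algebraMap_base_injective h)
  simp at this

theorem tPar_ne_one {i j : I} (e : i ⟶ j) : tPar e ≠ 1 := by
  intro h
  rw [tPar, ← map_one (algebraMap (MvPolynomial (Option (Quiver.Total I)) ℚ) (BaseField I))] at h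
  have := congrArg MvPolynomial.totalDegree (algebraMap_base_injective h)
  simp at this

theorem tPar_ne_qPar {i j : I} (e : i ⟶ j) : tPar e ≠ qPar I := by
  intro h
  have := MvPolynomial.X_injective (algebraMap_base_injective h)
  simp at this

variable [∀ i j : I, Fintype (i ⟶ j)]

theorem weights_ne_one {i j : I} {c : BaseField I} (hc : c ∈ weights i j) : c ≠ 1 := by
  rcases mem_weights.1 hc with ⟨e, rfl⟩ | ⟨e, rfl⟩
  · exact tPar_ne_one e
  · rw [Ne, div_eq_one_iff_eq (tPar_ne_zero e)]
    exact (tPar_ne_qPar e).symm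

theorem weights_ne_qPar {i j : I} {c : BaseField I} (hc : c ∈ weights i j) : c ≠ qPar I := by
  rcases mem_weights.1 hc with ⟨e, rfl⟩ | ⟨e, rfl⟩
  · exact tPar_ne_qPar e
  · rw [Ne, div_eq_iff (tPar_ne_zero e)]
    intro h
    exact tPar_ne_one e (mul_left_cancel₀ qPar_ne_zero (by rw [← h, mul_one]))

variable [Fintype I]

theorem subst_eq_ev (g : Vars n → RatFun n) (P : Laurent (I := I) n) :
    Laurent.subst g P = ev (algebraMap (BaseField I) (RatFun n)) g P := by
  rw [Laurent.subst, Finsupp.linearCombination_apply, ev_apply]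
  simp only [Algebra.smul_def]

open Classical in
/-- The value of the Laurent polynomial that represents the element of a word. -/
theorem ev_of_toRat_eq {L : Type*} [Field L] {l : List (Vars n)} (hl : l.Nodup)
    {d : Vars n → ℤ} {P : Laurent (I := I) n} (hP : Laurent.toRat n P = sym (wordTerm l d))
    (ι : BaseField I →+* L) {u : Vars n → L} (hu0 : ∀ x, u x ≠ 0)
    (hu : ∀ x y, x ≠ y → x.1 = y.1 → u x ≠ u y) :
    ev ι u P = ∑ s : ∀ i, Equiv.Perm (Fin (n i)),
      (∏ x, u x ^ (d ∘ (permVars s).symm) x) * zetaList ι u (l.map (permVars s)) := by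
  refine (evalsTo_toRat ι u hu0 P).unique ?_
  rw [hP, sym_wordTerm]
  exact EvalsTo.sum _ fun s _ => evalsTo_wordTerm ι hu0 hu (hl.map (permVars s).injective) _

theorem isSymmetric_of_toRat {P : Laurent (I := I) n}
    (h : ∀ s, renameVars (permVars s) (permVars s).injective (Laurent.toRat n P) =
      Laurent.toRat n P) : P.IsSymmetric := by
  classical
  intro s k
  have h1 : Finsupp.mapDomain (fun k => k ∘ (permVars s).symm) P = P := by
    apply toRat_injective
    rw [← h s, toRat_apply P, map_sum, Laurent.toRat, Laurent.subst,
      Finsupp.linearCombination_mapDomain, Finsupp.linearCombination_apply, Finsupp.sum]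
    refine Finset.sum_congr rfl fun p _ => ?_
    rw [map_mul, renameVars_const, map_prod, Algebra.smul_def, const]
    congr 1
    simp only [map_zpow₀, renameVars_zVar, Function.comp_apply]
    exact Fintype.prod_equiv (permVars s).symm _ _ fun x => by simp
  have h2 : Function.Injective fun k : Vars n → ℤ => k ∘ (permVars s).symm := by
    intro k k' hk
    funext x
    simpa using congrFun hk (permVars s x)
  conv_rhs => rw [← h1]
  have h3 := Finsupp.mapDomain_apply h2 P (k ∘ permVars s)
  rw [← h3]
  congr 1
  funext x
  simp

theorem exists_mem_wheelLaurent {l : List (Vars n)} (hl : l.Nodup) (hl' : ∀ x, x ∈ l)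
    (d : Vars n → ℤ) :
    ∃ P ∈ wheelLaurent n, Laurent.toRat n P = sym (wordTerm l d) := by
  classical
  obtain ⟨P, hP⟩ := (isLaurent_sym_wordTerm hl hl' d).exists_toRat
  refine ⟨P, ⟨isSymmetric_of_toRat fun s => by rw [hP, renameVars_sym], ?_⟩, hP⟩
  have key : ∀ a' x a : Vars n, a' ≠ a → x ≠ a' → x ≠ a → a'.1 = a.1 →
      ∀ c ∈ weights a.1 x.1, P.restrict a' x a (qPar I) c = 0 := by
    intro a' x a h1 h2 h3 hcol c hc
    rw [Laurent.restrict, subst_eq_ev]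
    set g : Vars n → RatFun n := Function.update
      (Function.update zVar a' (const n (qPar I) * zVar a)) x (const n c * zVar a) with hg
    have hgc : ∀ z, ∃ (c' : BaseField I) (y : Vars n), c' ≠ 0 ∧ g z = const n c' * zVar y ∧
        ((z = x ∧ c' = c ∧ y = a) ∨ (z = a' ∧ c' = qPar I ∧ y = a) ∨
          (z ≠ x ∧ z ≠ a' ∧ c' = 1 ∧ y = z)) := by
      intro z
      by_cases hzx : z = x
      · subst hzx
        exact ⟨c, a, weights_ne_zero hc, by simp [hg], Or.inl ⟨rfl, rfl, rfl⟩⟩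
      · by_cases hza : z = a'
        · subst hza
          exact ⟨qPar I, a, qPar_ne_zero, by simp [hg, hzx], Or.inr (Or.inl ⟨rfl, rfl, rfl⟩)⟩
        · exact ⟨1, z, one_ne_zero, by simp [hg, hzx, hza, const],
            Or.inr (Or.inr ⟨hzx, hza, rfl, rfl⟩)⟩
    have hg0 : ∀ z, g z ≠ 0 := by
      intro z
      obtain ⟨c', y, h0, h1, -⟩ := hgc z
      rw [h1]
      exact mul_ne_zero ((map_ne_zero _).2 h0) (zVar_ne_zero y)
    have hginj : ∀ z z', z ≠ z' → z.1 = z'.1 → g z ≠ g z' := by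
      intro z z' hzz _ h
      obtain ⟨c1, y1, h0, e1, h1⟩ := hgc z
      obtain ⟨c2, y2, h0', e2, h2⟩ := hgc z'
      rw [e1, e2] at h
      obtain ⟨rfl, rfl⟩ := const_mul_zVar_inj h0 h
      have w1 := weights_ne_one hc
      have w2 := weights_ne_qPar hc
      have w3 := qPar_ne_one (I := I)
      rcases h1 with ⟨rfl, rfl, rfl⟩ | ⟨rfl, rfl, rfl⟩ | ⟨-, -, rfl, rfl⟩ <;>
        rcases h2 with ⟨rfl, h4, h5⟩ | ⟨rfl, h4, h5⟩ | ⟨-, -, h4, h5⟩ <;>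
        simp_all
    rw [ev_of_toRat_eq hl hP _ hg0 hginj]
    refine Finset.sum_eq_zero fun s _ => ?_
    rw [zetaList_wheel _ hg0 (hl.map (permVars s).injective)
      (fun z => List.mem_map.2 ⟨(permVars s).symm z, hl' _, by simp⟩) h1 h2 hcol hc, mul_zero]
    · simp [hg, Function.update_of_ne h2.symm, Function.update_of_ne h3.symm,
        Function.update_of_ne h1.symm]
      exact Or.inl rfl
    · simp [hg, Function.update_of_ne h3.symm, Function.update_of_ne h1.symm]
      exact Or.inl rfl
  intro i j e
  refine ⟨fun a c b h1 h2 h3 => ?_, fun a c b h1 h2 h3 => ?_⟩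
  · exact key _ _ _ (by simpa using h1) h2 h3 rfl _ (mem_weights.2 (Or.inl ⟨e, rfl⟩))
  · exact key _ _ _ (by simpa using h1) h2 h3 rfl _ (mem_weights.2 (Or.inr ⟨e, rfl⟩))

/-- The wheel conditions at points of arbitrary fields. -/
theorem ev_eq_zero_of_wheel {L : Type*} [Field L] {P : Laurent (I := I) n} (hP : P.Wheel)
    (ι : BaseField I →+* L) {u : Vars n → L} (hu0 : ∀ x, u x ≠ 0) {a' a x : Vars n}
    (haa : a' ≠ a) (hxa : x ≠ a) (hxa' : x ≠ a') (hcol : a'.1 = a.1) {c : BaseField I}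
    (hc : c ∈ weights a.1 x.1) (h1 : u a' = ι (qPar I) * u a) (h2 : u x = ι c * u a) :
    ev ι u P = 0 := by
  classical
  have key : P.restrict a' x a (qPar I) c = 0 → ev ι u P = 0 := by
    intro h
    refine EvalsTo.eq_zero (A := MvPolynomial (Vars n) (BaseField I)) (K := RatFun n)
      (φ := MvPolynomial.eval₂Hom ι u) ?_
    rw [← h, Laurent.restrict]
    refine evalsTo_subst ι u _ u hu0 (fun z => ?_) P
    by_cases hzx : z = x
    · subst hzx
      rw [Function.update_self, h2]
      exact (evalsTo_const ι u c).mul (evalsTo_zVar ι u a)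
    · rw [Function.update_of_ne hzx]
      by_cases hza : z = a'
      · subst hza
        rw [Function.update_self, h1]
        exact (evalsTo_const ι u _).mul (evalsTo_zVar ι u a)
      · rw [Function.update_of_ne hza]
        exact evalsTo_zVar ι u z
  apply key
  obtain ⟨i, a'⟩ := a'
  obtain ⟨i', a⟩ := a
  obtain rfl : i = i' := hcol
  obtain ⟨j, b⟩ := x
  have haa' : a' ≠ a := fun h => haa (by rw [h])
  rcases mem_weights.1 hc with ⟨e, rfl⟩ | ⟨e, rfl⟩
  · exact (hP i j e).1 a' a b haa' hxa' hxa
  · exact (hP j i e).2 a' a b haa' hxa' hxa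

end evalWord

/-! ### Bounds for the exponents in the elements of words -/

section bound

variable {I : Type*} [Quiver I] [∀ i j : I, Fintype (i ⟶ j)] {n : I → ℕ}

open HahnSeries in
theorem le_addVal_one_sub_single {K : Type*} [Field K] (k : ℤ) (c : K) :
    ((min 0 k : ℤ) : WithTop ℤ) ≤ addVal ℤ K (1 - single k c) := by
  refine le_trans ?_ (AddValuation.map_sub _ _ _)
  rw [le_min_iff, addVal_apply, addVal_apply]
  refine ⟨?_, ?_⟩
  · rw [orderTop_one]
    exact_mod_cast min_le_left 0 k
  · exact le_trans (WithTop.coe_le_coe.2 (min_le_right 0 k)) orderTop_single_le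

open HahnSeries in
theorem addVal_one_sub_single_le {K : Type*} [Field K] (k : ℤ) {c : K} (hc : c ≠ 0) (hc1 : c ≠ 1) :
    addVal ℤ K (1 - single k c) ≤ ((min 0 k : ℤ) : WithTop ℤ) := by
  rw [addVal_apply]
  apply orderTop_le_of_coeff_ne_zero
  rw [coeff_sub, coeff_one]
  rcases lt_trichotomy k 0 with h | rfl | h
  · rw [min_eq_right h.le, if_neg h.ne, coeff_single_same]
    simpa using hc
  · simpa [sub_eq_zero] using hc1.symm
  · rw [min_eq_left h.le, if_pos rfl, coeff_single_of_ne h.ne]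
    simp

open HahnSeries in
theorem le_addVal_zetaAt (x y : Vars n) (hxy : x ≠ y) (k : ℤ) :
    (((weights x.1 y.1).card * min 0 k : ℤ) : WithTop ℤ) ≤
      addVal ℤ (RatFun n) (zetaAt (C.comp (algebraMap (BaseField I) (RatFun n))) x.1 y.1
        (single k (zVar x / zVar y))) := by
  classical
  rw [zetaAt, AddValuation.map_mul]
  have h1 : (0 : WithTop ℤ) ≤ addVal ℤ (RatFun n) (if x.1 = y.1 then
      (1 - single k (zVar x / zVar y) *
      ((C.comp (algebraMap (BaseField I) (RatFun n))) (qPar I))⁻¹) /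
      (1 - single k (zVar x / zVar y)) else 1) := by
    split_ifs with h
    · have hne : (zVar x / zVar y : RatFun n) ≠ 1 := by
        rw [Ne, div_eq_one_iff_eq (zVar_ne_zero y)]
        exact fun h => hxy (zVar_injective h)
      have hle := addVal_one_sub_single_le k (div_ne_zero (zVar_ne_zero x) (zVar_ne_zero y)) hne
      have hden : (1 - single k (zVar x / zVar y) : HahnSeries ℤ (RatFun n)) ≠ 0 := by
        intro h0
        rw [h0, AddValuation.map_zero] at hle
        simp at hle
      have e := AddValuation.map_mul (addVal ℤ (RatFun n))
        ((1 - single k (zVar x / zVar y) *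
        ((C.comp (algebraMap (BaseField I) (RatFun n))) (qPar I))⁻¹) /
        (1 - single k (zVar x / zVar y))) (1 - single k (zVar x / zVar y))
      rw [div_mul_cancel₀ _ hden] at e
      have h2 : single k (zVar x / zVar y) *
          ((C.comp (algebraMap (BaseField I) (RatFun n))) (qPar I))⁻¹ =
          (single k (zVar x / zVar y * (algebraMap (BaseField I) (RatFun n) (qPar I))⁻¹) :
            HahnSeries ℤ (RatFun n)) := by
        rw [RingHom.comp_apply, C_apply, inv_single, single_mul_single, neg_zero, add_zero]
      have h3 := le_addVal_one_sub_single k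
        (zVar x / zVar y * (algebraMap (BaseField I) (RatFun n) (qPar I))⁻¹)
      rw [h2] at e ⊢
      rw [e] at h3
      have hfin : addVal ℤ (RatFun n) (1 - single k (zVar x / zVar y)) ≠ ⊤ := by
        intro h0; rw [h0] at hle; simp at hle
      have h4 := hle.trans h3
      rw [← zero_add (addVal ℤ (RatFun n) (1 - single k (zVar x / zVar y)))] at h4
      exact (WithTop.add_le_add_iff_right hfin).1 (by simpa using h4)
    · rw [AddValuation.map_one]
  have h2 : ∀ s : Finset (BaseField I), ((s.card * min 0 k : ℤ) : WithTop ℤ) ≤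
      addVal ℤ (RatFun n) (∏ c ∈ s, (1 - (C.comp (algebraMap (BaseField I) (RatFun n))) c *
        single k (zVar x / zVar y))) := by
    intro s
    induction s using Finset.induction_on with
    | empty => simp
    | insert c s hc ih =>
      rw [Finset.prod_insert hc, AddValuation.map_mul, Finset.card_insert_of_notMem hc]
      have h3 := le_addVal_one_sub_single k
        (algebraMap (BaseField I) (RatFun n) c * (zVar x / zVar y))
      have h4 : (C.comp (algebraMap (BaseField I) (RatFun n))) c * single k (zVar x / zVar y) =
          (single k (algebraMap (BaseField I) (RatFun n) c * (zVar x / zVar y)) :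
            HahnSeries ℤ (RatFun n)) := by
        rw [RingHom.comp_apply, C_apply, single_mul_single, zero_add]
      rw [h4]
      refine le_trans ?_ (add_le_add h3 ih)
      rw [← WithTop.coe_add]
      refine WithTop.coe_le_coe.2 (le_of_eq ?_)
      push_cast; ring_nf
  simpa using add_le_add h1 (h2 _)

variable [Fintype I]

open HahnSeries in
theorem single_prod {α K : Type*} [Field K] (s : Finset α) (k : α → ℤ) (c : α → K) :
    (∏ a ∈ s, single (k a) (c a) : HahnSeries ℤ K) = single (∑ a ∈ s, k a) (∏ a ∈ s, c a) := by
  classical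
  induction s using Finset.induction_on with
  | empty => simp
  | insert a s ha ih =>
    rw [Finset.prod_insert ha, Finset.sum_insert ha, Finset.prod_insert ha, ih, single_mul_single]

open HahnSeries in
theorem single_zpow' {K : Type*} [Field K] (k : ℤ) (c : K) (m : ℤ) :
    (single k c : HahnSeries ℤ K) ^ m = single (m * k) (c ^ m) := by
  cases m with
  | ofNat m => simp [single_pow]
  | negSucc m =>
    rw [zpow_negSucc, zpow_negSucc, single_pow, inv_single]
    congr 1
    rw [nsmul_eq_mul, Int.negSucc_eq]; push_cast; ring

open HahnSeries in
open Classical in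
/-- The loss in the lower bound for the weights of the exponents of an element of a word. -/
def loss (l : List (Vars n)) (lam : Vars n → ℤ) : ℤ :=
  ∑ x, ∑ y, if Before l x y then ((weights x.1 y.1).card : ℤ) * min 0 (lam x - lam y) else 0

open HahnSeries in
open Classical in
theorem le_weight_of_mem_support {l : List (Vars n)} (hl : l.Nodup)
    {d : Vars n → ℤ} {P : Laurent (I := I) n} (hP : Laurent.toRat n P = sym (wordTerm l d))
    (lam : Vars n → ℤ) (B : ℤ)
    (hB : ∀ s : ∀ i, Equiv.Perm (Fin (n i)), B ≤ (∑ x, (d ∘ (permVars s).symm) x * lam x) +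
      loss (l.map (permVars s)) lam) {p : Vars n → ℤ} (hp : P p ≠ 0) :
    B ≤ ∑ x, p x * lam x := by
  by_contra hlt
  rw [not_le] at hlt
  set ι : BaseField I →+* HahnSeries ℤ (RatFun n) := C.comp (algebraMap (BaseField I) (RatFun n))
  set u : Vars n → HahnSeries ℤ (RatFun n) := fun x => single (lam x) (zVar x) with hu
  have hu0 : ∀ x, u x ≠ 0 := fun x => by simpa [hu] using zVar_ne_zero x
  have hui : ∀ x y, x ≠ y → x.1 = y.1 → u x ≠ u y := by
    intro x y hxy _ h
    have h1 := congrArg (fun f => HahnSeries.leadingCoeff f) h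
    simp only [hu, leadingCoeff_of_single] at h1
    exact hxy (zVar_injective h1)
  have hmon : ∀ k : Vars n → ℤ, ∏ x, u x ^ k x = single (∑ x, k x * lam x) (∏ x, zVar x ^ k x) := by
    intro k
    simp only [hu, single_zpow', single_prod]
  have h1 : (B : WithTop ℤ) ≤ addVal ℤ (RatFun n) (ev ι u P) := by
    rw [ev_of_toRat_eq hl hP ι hu0 hui]
    refine AddValuation.map_le_sum _ fun s _ => ?_
    rw [AddValuation.map_mul, hmon]
    refine le_trans (WithTop.coe_le_coe.2 (hB s)) ?_
    rw [WithTop.coe_add]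
    refine add_le_add (by rw [addVal_apply]; exact orderTop_single_le) ?_
    have hls : (l.map (permVars s)).Nodup := hl.map (permVars s).injective
    rw [zetaList_eq_prod ι u hls, loss]
    have hsum : ∀ {α : Type _} (t : Finset α) (a : α → ℤ) (f : α → HahnSeries ℤ (RatFun n)),
        (∀ i ∈ t, ((a i : ℤ) : WithTop ℤ) ≤ addVal ℤ (RatFun n) (f i)) →
        ((∑ i ∈ t, a i : ℤ) : WithTop ℤ) ≤ addVal ℤ (RatFun n) (∏ i ∈ t, f i) := by
      intro α t a f h
      induction t using Finset.induction_on with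
      | empty => simp
      | insert i t hi ih =>
        rw [Finset.sum_insert hi, Finset.prod_insert hi, AddValuation.map_mul, WithTop.coe_add]
        exact add_le_add (h i (by simp)) (ih fun j hj => h j (by simp [hj]))
    refine hsum _ _ _ fun x _ => hsum _ _ _ fun y _ => ?_
    split_ifs with hb
    · have e : u x / u y = single (lam x - lam y) (zVar x / zVar y) := by
        simp only [hu, single_div_single]
      rw [e]
      exact le_addVal_zetaAt x y (hb.ne hls) _
    · simp
  have h2 : (ev ι u P).coeff (∑ x, p x * lam x) = 0 := by
    apply coeff_eq_zero_of_lt_orderTop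
    rw [← addVal_apply]
    exact lt_of_lt_of_le (WithTop.coe_lt_coe.2 hlt) h1
  have h3 : (ev ι u P).coeff (∑ x, p x * lam x) =
      Laurent.toRat n (P.filter fun k => ∑ x, k x * lam x = ∑ x, p x * lam x) := by
    rw [ev_apply, Finsupp.sum, toRat_apply, coeff_sum, Finsupp.support_filter,
      Finset.sum_filter]
    refine Finset.sum_congr rfl fun k _ => ?_
    rw [hmon, RingHom.comp_apply, C_apply, single_mul_single, zero_add]
    split_ifs with hk
    · rw [Finsupp.filter_apply, if_pos hk, ← hk, coeff_single_same]
      rfl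
    · rw [coeff_single_of_ne (Ne.symm hk)]
  rw [h3, map_eq_zero_iff _ toRat_injective] at h2
  have h4 := DFunLike.congr_fun h2 p
  rw [Finsupp.filter_apply, if_pos rfl] at h4
  exact hp h4

end bound

end QuiverShuffle
end

noncomputable section
namespace QuiverShuffle

/-! ### Homomorphisms from the ground field -/

section homs

variable (I : Type*) [Quiver I]

/-- The parameters `q` and `t_e`. -/
def par {I : Type*} [Quiver I] : Option (Quiver.Total I) → BaseField I :=
  fun o => algebraMap (MvPolynomial (Option (Quiver.Total I)) ℚ) _ (MvPolynomial.X o)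

theorem par_ne_zero {I : Type*} [Quiver I] (o : Option (Quiver.Total I)) : par (I := I) o ≠ 0 :=
  (map_ne_zero_iff _ (IsFractionRing.injective _ (BaseField I))).2 (MvPolynomial.X_ne_zero o)

/-- The images of the parameters under the involution `q ↦ q`, `t_e ↦ q / t_e`. -/
def parInv {I : Type*} [Quiver I] : Option (Quiver.Total I) → BaseField I
  | none => qPar I
  | some e => qPar I / par (some e)

/-- The endomorphism `q ↦ q`, `t_e ↦ q / t_e` of the ground field, on polynomials. -/
def involPoly : MvPolynomial (Option (Quiver.Total I)) ℚ →+* BaseField I :=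
  MvPolynomial.eval₂Hom (algebraMap ℚ (BaseField I)) parInv

theorem evalsTo_involPoly (p : MvPolynomial (Option (Quiver.Total I)) ℚ) :
    EvalsTo (involPoly I) (involPoly I p) (algebraMap _ (BaseField I) p) := by
  have hX : ∀ o, EvalsTo (involPoly I) (par (I := I) o) (parInv o) := fun o => by
    have := EvalsTo.of_algebraMap (K := BaseField I) (involPoly I) (MvPolynomial.X o)
    rwa [involPoly, MvPolynomial.eval₂Hom_X'] at this
  induction p using MvPolynomial.induction_on with
  | C r =>
    have := EvalsTo.of_algebraMap (K := BaseField I) (involPoly I) (MvPolynomial.C r)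
    have e : algebraMap _ (BaseField I) (MvPolynomial.C (σ := Option (Quiver.Total I)) r) =
        algebraMap ℚ (BaseField I) r :=
      RingHom.congr_fun (Subsingleton.elim
        ((algebraMap (MvPolynomial (Option (Quiver.Total I)) ℚ) (BaseField I)).comp
          MvPolynomial.C) (algebraMap ℚ (BaseField I))) r
    rw [involPoly, MvPolynomial.coe_eval₂Hom, MvPolynomial.eval₂_C] at this ⊢
    rwa [e] at this ⊢
  | add p q hp hq => rw [map_add, map_add]; exact hp.add hq
  | mul_X p o hp =>
    rw [map_mul, map_mul]
    refine hp.mul ?_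
    have e : involPoly I (MvPolynomial.X o) = parInv o := by
      rw [involPoly, MvPolynomial.eval₂Hom_X']
    rw [e]
    rcases o with - | o
    · exact hX none
    · have hne : parInv (I := I) (some o) ≠ 0 := div_ne_zero qPar_ne_zero (par_ne_zero _)
      have h := (hX none).div (hX (some o)) hne
      have e2 : parInv (I := I) none / parInv (some o) = par (some o) := by
        simp only [parInv]
        rw [div_div_cancel₀ qPar_ne_zero]
      rw [e2] at h
      exact h

theorem involPoly_injective : Function.Injective (involPoly I) := by
  rw [injective_iff_map_eq_zero]
  intro p hp
  have h := evalsTo_involPoly I p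
  rw [hp] at h
  have := h.unique EvalsTo.zero
  exact (map_eq_zero_iff _ (IsFractionRing.injective _ (BaseField I))).1 this

/-- The endomorphism `q ↦ q`, `t_e ↦ q / t_e` of the ground field. -/
def invol : BaseField I →+* BaseField I := IsFractionRing.lift (involPoly_injective I)

theorem invol_qPar : invol I (qPar I) = qPar I := by
  rw [qPar, invol, IsFractionRing.lift_algebraMap, involPoly, MvPolynomial.eval₂Hom_X']
  rfl

theorem invol_tPar {i j : I} (e : i ⟶ j) : invol I (tPar e) = qPar I / tPar e := by
  rw [tPar, invol, IsFractionRing.lift_algebraMap, involPoly, MvPolynomial.eval₂Hom_X']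
  rfl

theorem invol_weight [∀ i j : I, Fintype (i ⟶ j)] {i j : I} {c : BaseField I}
    (hc : c ∈ weights i j) : invol I c = qPar I / c := by
  rcases mem_weights.1 hc with ⟨e, rfl⟩ | ⟨e, rfl⟩
  · exact invol_tPar I e
  · rw [map_div₀, invol_qPar, invol_tPar]

/-- The weights of the parameters: `2` for `q` and `1` for `t_e`. -/
def parWeight {I : Type*} [Quiver I] : Option (Quiver.Total I) → ℕ
  | none => 2
  | some _ => 1

/-- The homomorphism `q ↦ q s ^ 2`, `t_e ↦ t_e s` to the polynomials in `s`. -/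
def gradPoly : MvPolynomial (Option (Quiver.Total I)) ℚ →+* Polynomial (BaseField I) :=
  MvPolynomial.eval₂Hom (algebraMap ℚ _)
    (fun o => Polynomial.C (par o) * Polynomial.X ^ parWeight o)

theorem gradPoly_injective : Function.Injective (gradPoly I) := by
  have h : (Polynomial.evalRingHom 1).comp (gradPoly I) =
      algebraMap (MvPolynomial (Option (Quiver.Total I)) ℚ) (BaseField I) := by
    refine MvPolynomial.ringHom_ext (fun r => ?_) (fun o => ?_)
    · exact RingHom.congr_fun (Subsingleton.elim
        (((Polynomial.evalRingHom 1).comp (gradPoly I)).comp MvPolynomial.C)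
        ((algebraMap (MvPolynomial (Option (Quiver.Total I)) ℚ) (BaseField I)).comp
          MvPolynomial.C)) r
    · rw [RingHom.comp_apply, gradPoly, MvPolynomial.eval₂Hom_X']
      simp [par]
  have h2 : Function.Injective ((Polynomial.evalRingHom 1).comp (gradPoly I)) := by
    rw [h]; exact IsFractionRing.injective _ _
  exact Function.Injective.of_comp (f := Polynomial.evalRingHom 1) (by simpa using h2)

/-- The homomorphism `q ↦ q s ^ 2`, `t_e ↦ t_e s` to the Laurent series in `s`, on polynomials. -/
def gradSeriesPoly : MvPolynomial (Option (Quiver.Total I)) ℚ →+* HahnSeries ℤ (BaseField I) :=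
  (HahnSeries.ofPowerSeries ℤ (BaseField I)).comp
    (Polynomial.coeToPowerSeries.ringHom.comp (gradPoly I))

theorem gradSeriesPoly_injective : Function.Injective (gradSeriesPoly I) := by
  refine (HahnSeries.ofPowerSeries_injective).comp ?_
  exact (Polynomial.coe_injective (BaseField I)).comp (gradPoly_injective I)

/-- The homomorphism `q ↦ q s ^ 2`, `t_e ↦ t_e s` to the Laurent series in `s`. -/
def gradSeries : BaseField I →+* HahnSeries ℤ (BaseField I) :=
  IsFractionRing.lift (gradSeriesPoly_injective I)

theorem gradSeries_par (o : Option (Quiver.Total I)) :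
    gradSeries I (par o) = HahnSeries.single (parWeight o : ℤ) (par o) := by
  conv_lhs => rw [par]
  rw [gradSeries, IsFractionRing.lift_algebraMap, gradSeriesPoly, RingHom.comp_apply,
    RingHom.comp_apply, gradPoly, MvPolynomial.eval₂Hom_X', map_mul, map_pow, map_mul, map_pow]
  simp only [Polynomial.coeToPowerSeries.ringHom_apply, Polynomial.coe_C, Polynomial.coe_X,
    HahnSeries.ofPowerSeries_C, HahnSeries.ofPowerSeries_X, HahnSeries.C_apply,
    HahnSeries.single_pow, HahnSeries.single_mul_single]
  simp

theorem gradSeries_qPar : gradSeries I (qPar I) = HahnSeries.single (2 : ℤ) (qPar I) :=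
  gradSeries_par I none

theorem gradSeries_weight [∀ i j : I, Fintype (i ⟶ j)] {i j : I} {c : BaseField I}
    (hc : c ∈ weights i j) : gradSeries I c = HahnSeries.single (1 : ℤ) c := by
  rcases mem_weights.1 hc with ⟨e, rfl⟩ | ⟨e, rfl⟩
  · exact gradSeries_par I (some ⟨i, j, e⟩)
  · have h := gradSeries_par I (some ⟨j, i, e⟩)
    change gradSeries I (tPar e) = HahnSeries.single (1 : ℤ) (tPar e) at h
    rw [map_div₀, gradSeries_qPar, h, HahnSeries.single_div_single]
    norm_num

end homs

/-! ### The field of iterated series -/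

section hahn

open HahnSeries

variable (X : Type*) [Fintype X]

/-- The group of exponents: one coordinate for the parameter `s`, which dominates the order, and
one for each variable. -/
abbrev Expo : Type := Lex (Fin (Fintype.card X + 1) → ℤ)

variable {X}

/-- The exponent with a given `s`-coordinate and given coordinates for the variables. -/
def expo (k : ℤ) (p : X → ℤ) : Expo X :=
  toLex (Fin.cons k (p ∘ (Fintype.equivFin X).symm))

/-- The coordinate of an exponent at a variable. -/
def expoAt (x : X) : Expo X →+ ℤ where
  toFun g := ofLex g (Fintype.equivFin X x).succ
  map_zero' := rfl
  map_add' _ _ := rfl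

theorem expo_add (k k' : ℤ) (p p' : X → ℤ) : expo k p + expo k' p' = expo (k + k') (p + p') := by
  refine ofLex.injective (funext fun i => ?_)
  refine Fin.cases ?_ (fun i => ?_) i <;> simp only [expo, ofLex_add, Pi.add_apply] <;> rfl

theorem expo_zero : expo 0 (0 : X → ℤ) = 0 := by
  refine ofLex.injective (funext fun i => ?_)
  refine Fin.cases ?_ (fun i => ?_) i <;> rfl

theorem expo_neg (k : ℤ) (p : X → ℤ) : -expo k p = expo (-k) (-p) := by
  rw [neg_eq_iff_add_eq_zero, expo_add, add_neg_cancel, add_neg_cancel, expo_zero]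

theorem expo_sub (k k' : ℤ) (p p' : X → ℤ) : expo k p - expo k' p' = expo (k - k') (p - p') := by
  rw [sub_eq_add_neg, expo_neg, expo_add, sub_eq_add_neg, sub_eq_add_neg]

theorem expo_inj {k k' : ℤ} {p p' : X → ℤ} : expo k p = expo k' p' ↔ k = k' ∧ p = p' := by
  refine ⟨fun h => ?_, fun h => by rw [h.1, h.2]⟩
  have h' := congrArg ofLex h
  refine ⟨by simpa [expo] using congrFun h' 0, funext fun x => ?_⟩
  simpa [expo] using congrFun h' (Fintype.equivFin X x).succ

theorem expoAt_expo (x : X) (k : ℤ) (p : X → ℤ) : expoAt x (expo k p) = p x := by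
  simp [expoAt, expo]

theorem expo_pos {k : ℤ} (hk : 0 < k) (p : X → ℤ) : 0 < expo k p :=
  ⟨0, fun j hj => absurd hj (by simp), hk⟩

theorem expo_neg_of_neg {k : ℤ} (hk : k < 0) (p : X → ℤ) : expo k p < 0 := by
  rw [← neg_pos, expo_neg]
  exact expo_pos (by omega) _

variable (F : Type*) [Field F]

variable (X) in
/-- The field of iterated series over `F`. -/
abbrev Series : Type _ := HahnSeries (Expo X) F

variable {F}

/-- The part of a series which does not involve the variables. -/
def constTerm : Series X F →+ (ℤ → F) where
  toFun f k := f.coeff (expo k 0)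
  map_zero' := rfl
  map_add' _ _ := rfl

/-- The series which do not involve a given variable. -/
def freeOf (x : X) : Subring (Series X F) where
  carrier := {f | ∀ g, f.coeff g ≠ 0 → expoAt x g = 0}
  zero_mem' := fun g h => absurd (coeff_zero) h
  one_mem' := fun g h => by
    rw [coeff_one] at h
    have : g = 0 := by by_contra h0; exact h (if_neg h0)
    rw [this, map_zero]
  add_mem' := fun {f f'} hf hf' g h => by
    by_cases h0 : f.coeff g = 0
    · refine hf' g fun h1 => h ?_
      rw [coeff_add, h0, h1, add_zero]
    · exact hf g h0
  neg_mem' := fun {f} hf g h => hf g (by simpa using h)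
  mul_mem' := fun {f f'} hf hf' g h => by
    obtain ⟨a, ha, b, hb, rfl⟩ := Set.mem_add.1 (support_mul_subset h)
    rw [map_add, hf a ha, hf' b hb, add_zero]

theorem coeff_eq_zero_of_mem_freeOf {x : X} {f : Series X F} (hf : f ∈ freeOf x) {g : Expo X}
    (hg : expoAt x g ≠ 0) : f.coeff g = 0 := by
  by_contra h
  exact hg (hf g h)

theorem single_mem_freeOf {x : X} {g : Expo X} (hg : expoAt x g = 0) (r : F) :
    (single g r : Series X F) ∈ freeOf x := by
  intro g' h
  have : g' = g := by by_contra h0; exact h (coeff_single_of_ne h0)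
  rwa [this]

/-- A series is zero on a set of exponents along which its coefficients satisfy a geometric
recursion. -/
theorem coeff_eq_zero_of_recursion {Γ : Type*} [AddCommGroup Γ] [LinearOrder Γ]
    [IsOrderedAddMonoid Γ] {f : HahnSeries Γ F} {d : Γ} (hd : 0 < d) (r : F) (P : Γ → Prop)
    (hP : ∀ g, P g → P (g - d)) (hf : ∀ g, P g → f.coeff g = r * f.coeff (g - d)) {g : Γ}
    (hg : P g) : f.coeff g = 0 := by
  by_contra h
  have hwf : (f.support ∩ {g | P g}).IsWF := f.isWF_support.mono Set.inter_subset_left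
  have hne : (f.support ∩ {g | P g}).Nonempty := ⟨g, h, hg⟩
  obtain ⟨h1, h2⟩ := hwf.min_mem hne
  refine hwf.not_lt_min hne (a := hwf.min hne - d) ⟨?_, hP _ h2⟩ (sub_lt_self _ hd)
  intro h3
  exact h1 (by rw [hf _ h2, h3, mul_zero])

theorem coeff_recursion {Γ : Type*} [AddCommGroup Γ] [LinearOrder Γ]
    [IsOrderedAddMonoid Γ] {f a : HahnSeries Γ F} {d : Γ} {r : F}
    (h : f * (1 - single d r) = a) (g : Γ) : f.coeff g = a.coeff g + r * f.coeff (g - d) := by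
  rw [← h, mul_sub, mul_one, coeff_sub, coeff_mul_single]
  ring

theorem coeff_recursion' {Γ : Type*} [AddCommGroup Γ] [LinearOrder Γ]
    [IsOrderedAddMonoid Γ] {f a : HahnSeries Γ F} {d : Γ} {r : F} (hr : r ≠ 0)
    (h : f * (1 - single d r) = a) (g : Γ) :
    f.coeff g = r⁻¹ * (f.coeff (g - -d) - a.coeff (g - -d)) := by
  have := coeff_recursion h (g - -d)
  rw [show g - -d - d = g by abel] at this
  rw [this]
  field_simp
  ring

theorem inv_one_sub_single_mem_freeOf {x : X} {g : Expo X} (hg : expoAt x g = 0) (r : F) :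
    (1 - single g r : Series X F)⁻¹ ∈ freeOf x := by
  by_cases hr : r = 0
  · rw [hr, map_zero, sub_zero, inv_one]; exact one_mem _
  by_cases h0 : (1 - single g r : Series X F) = 0
  · rw [h0, inv_zero]; exact zero_mem _
  have h1 : (1 - single g r : Series X F)⁻¹ * (1 - single g r) = 1 := inv_mul_cancel₀ h0
  have h2 : ∀ g', expoAt x g' ≠ 0 → (1 : Series X F).coeff g' = 0 := by
    intro g' h
    rw [coeff_one, if_neg]
    rintro rfl
    exact h (map_zero _)
  rcases lt_trichotomy g 0 with hlt | rfl | hlt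
  · intro g' h'
    by_contra h''
    refine h' (coeff_eq_zero_of_recursion (neg_pos.2 hlt) r⁻¹ (fun g => expoAt x g ≠ 0)
      (fun g₁ h => ?_) (fun g₁ h => ?_) h'')
    · simpa [map_sub, map_neg, hg] using h
    · rw [coeff_recursion' hr h1, h2 _ (by simpa [map_sub, map_neg, hg] using h), sub_zero]
  · have : (1 - single 0 r : Series X F) = single 0 (1 - r) := by
      rw [single_sub]; rfl
    rw [this, inv_single]
    exact single_mem_freeOf (by simp) _
  · intro g' h'
    by_contra h''
    refine h' (coeff_eq_zero_of_recursion hlt r (fun g => expoAt x g ≠ 0)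
      (fun g₁ h => ?_) (fun g₁ h => ?_) h'')
    · simpa [map_sub, hg] using h
    · rw [coeff_recursion h1, h2 _ h, zero_add]

theorem constTerm_mul_single_eq_zero {x : X} {f : Series X F} (hf : f ∈ freeOf x) {g : Expo X}
    (hg : expoAt x g ≠ 0) (r : F) : constTerm (f * single g r) = 0 := by
  funext k
  change (f * single g r).coeff (expo k 0) = 0
  rw [coeff_mul_single, coeff_eq_zero_of_mem_freeOf hf, zero_mul]
  rw [map_sub, expoAt_expo]
  simpa using hg

/-- The geometric series in the domain where `single g r` is small. -/
theorem constTerm_geom_small {x : X} {f : Series X F} (hf : f ∈ freeOf x) {g : Expo X}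
    (hg : expoAt x g = -1) (hpos : 0 < g) (r : F) :
    constTerm (f * (1 - single g r)⁻¹) = constTerm f := by
  have h0 : (1 - single g r : Series X F) ≠ 0 := by
    intro h
    have h1 := congrArg (fun f : Series X F => f.coeff 0) h
    simp only [coeff_sub, coeff_zero, coeff_one, if_true] at h1
    rw [coeff_single_of_ne hpos.ne, sub_zero] at h1
    exact one_ne_zero h1
  have h1 : f * (1 - single g r)⁻¹ * (1 - single g r) = f := by
    rw [mul_assoc, inv_mul_cancel₀ h0, mul_one]
  have h2 : ∀ g', 0 < expoAt x g' → (f * (1 - single g r)⁻¹).coeff g' = 0 := by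
    intro g' h'
    refine coeff_eq_zero_of_recursion hpos r (fun g => 0 < expoAt x g)
      (fun g₁ h => ?_) (fun g₁ h => ?_) h'
    · simp only [map_sub, hg]; omega
    · rw [coeff_recursion h1, coeff_eq_zero_of_mem_freeOf hf h.ne', zero_add]
  funext k
  change (f * (1 - single g r)⁻¹).coeff (expo k 0) = f.coeff (expo k 0)
  rw [coeff_recursion h1, h2, mul_zero, add_zero]
  rw [map_sub, hg, expoAt_expo]
  simp

/-- The geometric series in the domain where `single g r` is large. -/
theorem constTerm_geom_large {x : X} {f : Series X F} (hf : f ∈ freeOf x) {g : Expo X}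
    (hg : expoAt x g = -1) (hneg : g < 0) {r : F} (hr : r ≠ 0) :
    constTerm (f * (1 - single g r)⁻¹) = 0 := by
  have h0 : (1 - single g r : Series X F) ≠ 0 := by
    intro h
    have h1 := congrArg (fun f : Series X F => f.coeff 0) h
    simp only [coeff_sub, coeff_zero, coeff_one, if_true] at h1
    rw [coeff_single_of_ne hneg.ne', sub_zero] at h1
    exact one_ne_zero h1
  have h1 : f * (1 - single g r)⁻¹ * (1 - single g r) = f := by
    rw [mul_assoc, inv_mul_cancel₀ h0, mul_one]
  funext k
  change (f * (1 - single g r)⁻¹).coeff (expo k 0) = 0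
  refine coeff_eq_zero_of_recursion (neg_pos.2 hneg) r⁻¹ (fun g => expoAt x g ≤ 0)
    (fun g₁ h => ?_) (fun g₁ h => ?_) (g := expo k 0) (by rw [expoAt_expo]; rfl)
  · simp only [map_sub, map_neg, hg]; omega
  · rw [coeff_recursion' hr h1, coeff_eq_zero_of_mem_freeOf hf, sub_zero]
    simp only [map_sub, map_neg, hg]; omega

variable (X) in
/-- The inclusion of the Laurent series in `s` into the iterated series. -/
def inclSeries : HahnSeries ℤ F →+* Series X F :=
  embDomainRingHom
    { toFun := fun k => expo k 0
      map_zero' := expo_zero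
      map_add' := fun a b => by rw [expo_add, add_zero] }
    (fun a b h => (expo_inj.1 h).1)
    (fun a b => by
      change expo a 0 ≤ expo b 0 ↔ a ≤ b
      rcases lt_trichotomy a b with h | rfl | h
      · have := expo_pos (sub_pos.2 h) (0 : X → ℤ)
        rw [← sub_zero (0 : X → ℤ), ← expo_sub, sub_pos] at this
        exact ⟨fun _ => h.le, fun _ => this.le⟩
      · simp
      · have := expo_pos (sub_pos.2 h) (0 : X → ℤ)
        rw [← sub_zero (0 : X → ℤ), ← expo_sub, sub_pos] at this
        exact ⟨fun h' => absurd h' (not_le.2 this), fun h' => absurd h' (not_le.2 h)⟩)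

theorem inclSeries_single (k : ℤ) (r : F) :
    inclSeries X (single k r) = single (expo k 0) r :=
  embDomain_single

theorem constTerm_inclSeries (f : HahnSeries ℤ F) (k : ℤ) :
    constTerm (inclSeries X f) k = f.coeff k :=
  embDomain_coeff

theorem inclSeries_mem_freeOf (x : X) (f : HahnSeries ℤ F) : inclSeries X f ∈ freeOf x := by
  intro g hg
  by_contra h
  refine hg (embDomain_of_notMem_range ?_)
  rintro ⟨k, rfl⟩
  exact h (expoAt_expo x k 0)

end hahn

end QuiverShuffle
end

noncomputable section
namespace QuiverShuffle

/-! ### Partial fractions and constant terms in one variable -/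

section partialFractions

theorem prod_inv_one_sub_eq_sum {M ι' : Type*} [Field M] [DecidableEq ι'] {s : Finset ι'}
    (hs : s.Nonempty) {α : ι' → M} (hinj : Set.InjOn α s) (h0 : ∀ i ∈ s, α i ≠ 0) {w : M}
    (hw : ∀ i ∈ s, 1 - α i * w ≠ 0) :
    ∏ i ∈ s, (1 - α i * w)⁻¹ =
      ∑ i ∈ s, (∏ j ∈ s.erase i, (1 - α j / α i)⁻¹) * (1 - α i * w)⁻¹ := by
  have hinj' : Set.InjOn (fun i => (α i)⁻¹) s := fun i hi j hj h => hinj hi hj (inv_injective h)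
  have h := congrArg (Polynomial.eval w) (Lagrange.sum_basis hinj' hs)
  rw [Polynomial.eval_finsetSum, Polynomial.eval_one] at h
  have hP : ∏ i ∈ s, (1 - α i * w) ≠ 0 := Finset.prod_ne_zero_iff.2 hw
  have h1 : ∀ i ∈ s, (∏ j ∈ s.erase i, (1 - α j / α i)⁻¹) * (1 - α i * w)⁻¹ =
      (Lagrange.basis s (fun i => (α i)⁻¹) i).eval w * (∏ i ∈ s, (1 - α i * w))⁻¹ := by
    intro i hi
    rw [← Finset.mul_prod_erase s _ hi, mul_inv, mul_left_comm, mul_comm, Lagrange.basis,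
      Polynomial.eval_prod, ← Finset.prod_inv_distrib, ← Finset.prod_mul_distrib]
    congr 1
    refine Finset.prod_congr rfl fun j hj => ?_
    have hj' := Finset.mem_of_mem_erase hj
    have hij : α i - α j ≠ 0 := by
      rw [sub_ne_zero]
      exact fun h => Finset.ne_of_mem_erase hj (hinj hj' hi h.symm)
    have hi0 := h0 i hi
    have hj0 := h0 j hj'
    have hjw := hw j hj'
    have e1 : 1 - α j / α i = (α i - α j) / α i := by field_simp
    have e2 : (α i)⁻¹ - (α j)⁻¹ = -((α i - α j) / (α i * α j)) := by field_simp; ring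
    have e3 : w - (α j)⁻¹ = -((1 - α j * w) / α j) := by field_simp; ring
    simp only [Lagrange.basisDivisor, Polynomial.eval_mul, Polynomial.eval_C, Polynomial.eval_sub,
      Polynomial.eval_X]
    rw [e1, e2, e3]
    field_simp
  rw [Finset.sum_congr rfl h1, ← Finset.sum_mul, h, one_mul, Finset.prod_inv_distrib]

/-- A functional which takes constant terms with respect to `y`, evaluated on the product of a
power of `y` and a geometric series. -/
theorem functional_zpow_geom {L M V : Type*} [Field L] [Field M] [AddCommGroup V] (K : Subring L)
    (j : L →+* M) (θ : M →+ V) {y : M} (hy : y ≠ 0)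
    (h0 : ∀ A ∈ K, ∀ k : ℤ, k ≠ 0 → θ (j A * y ^ k) = 0) {α : L} (hα : α ∈ K) (hα' : α⁻¹ ∈ K)
    (hα0 : α ≠ 0) (hne : 1 - j α / y ≠ 0) {ρ : ℤ}
    (hρ : ∀ A ∈ K, θ (j A * (1 - j α / y)⁻¹) = ρ • θ (j A)) (k : ℤ) :
    ∀ A ∈ K, θ (j A * (y ^ k * (1 - j α / y)⁻¹)) =
      ((if 0 ≤ k then 1 else 0) - 1 + ρ : ℤ) • θ (j (A * α ^ k)) := by
  have hj : j α ≠ 0 := (map_ne_zero j).2 hα0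
  have step : ∀ k : ℤ, y ^ (k + 1) * (1 - j α / y)⁻¹ =
      j α * (y ^ k * (1 - j α / y)⁻¹) + y ^ (k + 1) := by
    intro k
    have : y - j α ≠ 0 := by
      intro h
      apply hne
      rw [← sub_eq_zero.1 h, div_self hy, sub_self]
    rw [zpow_add₀ hy, zpow_one]
    field_simp
    ring
  have hk0 : ∀ A ∈ K, ∀ k : ℤ, θ (j A * y ^ k) = (if k = 0 then 1 else 0 : ℤ) • θ (j A) := by
    intro A hA k
    split_ifs with h
    · rw [h, zpow_zero, mul_one, one_smul]
    · rw [h0 A hA k h, zero_smul]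
  induction k using Int.induction_on with
  | zero =>
    intro A hA
    simp [hρ A hA]
  | succ k ih =>
    intro A hA
    rw [step, mul_add, map_add, ← mul_assoc, ← map_mul, ih _ (K.mul_mem hA hα), hk0 A hA,
      if_pos (by omega), if_neg (by omega), if_pos (by omega), zero_smul, add_zero, mul_assoc A,
      zpow_add_one₀ hα0, mul_comm α]
  | pred k ih =>
    intro A hA
    have h2 := step (-(k : ℤ) - 1)
    rw [sub_add_cancel] at h2
    have e : j A * (y ^ (-(k : ℤ) - 1) * (1 - j α / y)⁻¹) =
        j (A * α⁻¹) * (y ^ (-(k : ℤ)) * (1 - j α / y)⁻¹) - j (A * α⁻¹) * y ^ (-(k : ℤ)) := by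
      rw [h2, map_mul, map_inv₀, mul_add, add_sub_cancel_right, mul_assoc,
        inv_mul_cancel_left₀ hj]
    rw [e, map_sub, ih _ (K.mul_mem hA hα'), hk0 _ (K.mul_mem hA hα'), mul_assoc A,
      ← zpow_neg_one α, ← zpow_add₀ hα0, neg_add_eq_sub]
    rcases k.eq_zero_or_pos with rfl | hk
    · simp only [Nat.cast_zero, neg_zero, zero_sub, le_refl, if_true]
      rw [if_neg (by norm_num), ← sub_smul]
      congr 1
      ring
    · rw [if_neg (by omega), if_neg (by omega), if_neg (by omega), zero_smul, sub_zero]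

theorem functional_prod_geom {L M V ι' : Type*} [Field L] [Field M] [AddCommGroup V]
    [DecidableEq ι'] (K : Subring L)
    (j : L →+* M) (θ : M →+ V) {y : M} (hy : y ≠ 0)
    (h0 : ∀ A ∈ K, ∀ k : ℤ, k ≠ 0 → θ (j A * y ^ k) = 0) {s : Finset ι'} (hs : s.Nonempty)
    {α : ι' → L} (hinj : Set.InjOn α s) (hα : ∀ i ∈ s, α i ∈ K) (hα' : ∀ i ∈ s, (α i)⁻¹ ∈ K)
    (hα0 : ∀ i ∈ s, α i ≠ 0) (hK : ∀ i ∈ s, ∀ i' ∈ s, (1 - α i' / α i)⁻¹ ∈ K)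
    (hne : ∀ i ∈ s, 1 - j (α i) / y ≠ 0) {ρ : ι' → ℤ}
    (hρ : ∀ i ∈ s, ∀ A ∈ K, θ (j A * (1 - j (α i) / y)⁻¹) = ρ i • θ (j A)) (k : ℤ) {A : L}
    (hA : A ∈ K) :
    θ (j A * (y ^ k * ∏ i ∈ s, (1 - j (α i) / y)⁻¹)) =
      ∑ i ∈ s, ((if 0 ≤ k then 1 else 0) - 1 + ρ i : ℤ) •
        θ (j (A * (α i ^ k * ∏ i' ∈ s.erase i, (1 - α i' / α i)⁻¹))) := by
  have h := prod_inv_one_sub_eq_sum hs (α := fun i => j (α i)) (w := y⁻¹)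
    (fun i hi i' hi' h => hinj hi hi' (j.injective h)) (fun i hi => (map_ne_zero j).2 (hα0 i hi))
    (fun i hi => by simpa [div_eq_mul_inv] using hne i hi)
  simp only [← div_eq_mul_inv] at h
  rw [h, Finset.mul_sum, Finset.mul_sum, map_sum]
  refine Finset.sum_congr rfl fun i hi => ?_
  have hKi : ∏ i' ∈ s.erase i, (1 - α i' / α i)⁻¹ ∈ K :=
    K.prod_mem fun i' hi' => hK i hi i' (Finset.mem_of_mem_erase hi')
  have h1 := functional_zpow_geom K j θ hy h0 (hα i hi) (hα' i hi) (hα0 i hi) (hne i hi) (hρ i hi)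
    k (A * ∏ i' ∈ s.erase i, (1 - α i' / α i)⁻¹) (K.mul_mem hA hKi)
  rw [show A * (α i ^ k * ∏ i' ∈ s.erase i, (1 - α i' / α i)⁻¹) =
    A * (∏ i' ∈ s.erase i, (1 - α i' / α i)⁻¹) * α i ^ k by ring, ← h1]
  congr 1
  rw [map_mul, map_prod]
  simp only [map_inv₀, map_sub, map_one, map_div₀]
  ring

end partialFractions

section oneVariable

open HahnSeries

variable {X : Type*} [Fintype X] {F : Type*} [Field F]

theorem one_sub_single_ne_zero {Γ : Type*} [AddCommGroup Γ] [LinearOrder Γ]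
    [IsOrderedAddMonoid Γ] {g : Γ} (hg : g ≠ 0) (r : F) : (1 - single g r : HahnSeries Γ F) ≠ 0 := by
  intro h
  have h1 := congrArg (fun f : HahnSeries Γ F => f.coeff 0) h
  simp only [coeff_sub, coeff_zero, coeff_one, if_true] at h1
  rw [coeff_single_of_ne hg.symm, sub_zero] at h1
  exact one_ne_zero h1

variable [DecidableEq X]

/-- The variable `z_x` as a series. -/
def yVar (x : X) : Series X F := single (expo 0 (Pi.single x 1)) 1

theorem yVar_ne_zero (x : X) : (yVar x : Series X F) ≠ 0 := by
  simp [yVar]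

theorem yVar_zpow (x : X) (k : ℤ) :
    (yVar x : Series X F) ^ k = single (expo 0 (Pi.single x k)) 1 := by
  have h : ∀ k : ℕ, (yVar x : Series X F) ^ k = single (expo 0 (Pi.single x (k : ℤ))) 1 := by
    intro k
    induction k with
    | zero =>
      rw [pow_zero, Nat.cast_zero, Pi.single_zero, expo_zero]
      rfl
    | succ k ih =>
      rw [pow_succ, ih, yVar, single_mul_single, expo_add, ← Pi.single_add, add_zero, mul_one]
      norm_num
  cases k with
  | ofNat k => simpa using h k
  | negSucc k =>
    rw [zpow_negSucc, h, inv_single, expo_neg, neg_zero, inv_one, ← Pi.single_neg]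
    rfl

theorem constTerm_mul_yVar_zpow {x : X} {A : Series X F} (hA : A ∈ freeOf x) {k : ℤ}
    (hk : k ≠ 0) : constTerm (A * yVar x ^ k) = 0 := by
  rw [yVar_zpow]
  refine constTerm_mul_single_eq_zero hA ?_ _
  rw [expoAt_expo]
  simpa using hk

/-- The constant coefficient of a Laurent series, followed by the constant term. -/
def constTermLaurent : HahnSeries ℤ (Series X F) →+ (ℤ → F) :=
  constTerm.comp
    { toFun := fun f => f.coeff 0
      map_zero' := rfl
      map_add' := fun _ _ => rfl }

theorem constTermLaurent_C (A : Series X F) : constTermLaurent (C A) = constTerm A := by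
  simp [constTermLaurent]

theorem constTermLaurent_C_mul (A : Series X F) (f : HahnSeries ℤ (Series X F)) :
    constTermLaurent (C A * f) = constTerm (A * f.coeff 0) := by
  simp [constTermLaurent, C_apply]

theorem constTermLaurent_mul_zpow (A : Series X F) {k : ℤ} (hk : k ≠ 0) :
    constTermLaurent (C A * (single (-1) 1 : HahnSeries ℤ (Series X F)) ^ k) = 0 := by
  rw [constTermLaurent_C_mul, single_zpow', coeff_single_of_ne, mul_zero, map_zero]
  simpa using hk

theorem constTermLaurent_geom (A α : Series X F) :
    constTermLaurent (C A * (1 - C α / (single (-1) 1 : HahnSeries ℤ (Series X F)))⁻¹) =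
      constTermLaurent (C A) := by
  have e : C α / (single (-1) 1 : HahnSeries ℤ (Series X F)) = single 1 α := by
    rw [C_apply, single_div_single]
    norm_num
  rw [constTermLaurent_C_mul, constTermLaurent_C, e]
  have h1 : (1 - single 1 α : HahnSeries ℤ (Series X F))⁻¹ * (1 - single 1 α) = 1 :=
    inv_mul_cancel₀ (a := (1 - single 1 α : HahnSeries ℤ (Series X F)))
      (one_sub_single_ne_zero one_ne_zero _)
  rw [coeff_recursion h1, coeff_eq_zero_of_recursion (g := 0 - 1) one_pos α (fun g => g < 0)
    (fun g h => by omega) (fun g h => ?_) (by omega)]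
  · simp
  · rw [coeff_recursion h1, coeff_one, if_neg h.ne, zero_add]

/-- The triples of a Laurent polynomial in `z_x`, expanded at infinity, its value at `z_x`, and its
values at given points. -/
def evalMonomials {ι' : Type*} (x : X) {s : Finset ι'} {α : ι' → Series X F}
    (hα : ∀ i ∈ s, α i ≠ 0) :
    Submonoid (HahnSeries ℤ (Series X F) × Series X F × (ι' → Series X F)) where
  carrier := {f | ∃ b ∈ freeOf x, ∃ k : ℤ, f.1 = C b * (single (-1) 1) ^ k ∧
    f.2.1 = b * yVar x ^ k ∧ ∀ i ∈ s, f.2.2 i = b * α i ^ k}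
  one_mem' := ⟨1, one_mem _, 0, by simp, by simp, by simp⟩
  mul_mem' := by
    rintro f f' ⟨b, hb, k, h1, h2, h3⟩ ⟨b', hb', k', h1', h2', h3'⟩
    refine ⟨b * b', mul_mem hb hb', k + k', ?_, ?_, fun i hi => ?_⟩
    · have h0 : (single (-1) 1 : HahnSeries ℤ (Series X F)) ≠ 0 := by simp
      rw [Prod.fst_mul, h1, h1', zpow_add₀ (G₀ := HahnSeries ℤ (Series X F)) h0, map_mul]
      ring
    · rw [Prod.snd_mul, Prod.fst_mul, h2, h2', zpow_add₀ (yVar_ne_zero x)]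
      ring
    · rw [Prod.snd_mul, Prod.snd_mul, Pi.mul_apply, h3 i hi, h3' i hi, zpow_add₀ (hα i hi)]
      ring

/-- The comparison of the expansion at infinity with the expansion in the iterated series. -/
theorem constTerm_residues {ι' : Type*} [DecidableEq ι'] (x : X) {s : Finset ι'}
    {α : ι' → Series X F} (hα0 : ∀ i ∈ s, α i ≠ 0) {a : ι' → Expo X} {r : ι' → F}
    (hα : ∀ i ∈ s, α i = single (a i) (r i)) (hfree : ∀ i ∈ s, expoAt x (a i) = 0)
    (hinj : Set.InjOn α s) (small : ι' → Prop) [DecidablePred small]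
    (hsmall : ∀ i ∈ s, small i → ∀ p, 0 < a i - expo 0 p)
    (hlarge : ∀ i ∈ s, ¬ small i → ∀ p, a i - expo 0 p < 0)
    {f : HahnSeries ℤ (Series X F) × Series X F × (ι' → Series X F)}
    (hf : f ∈ (evalMonomials x hα0).subsemiringClosure) {A : Series X F} (hA : A ∈ freeOf x) :
    constTerm (A * (f.1 * ∏ i ∈ s, (1 - C (α i) * single 1 1)⁻¹).coeff 0) =
      constTerm (A * (f.2.1 * ∏ i ∈ s, (1 - α i / yVar x)⁻¹)) +
      ∑ i ∈ s with ¬ small i,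
        constTerm (A * (f.2.2 i * ∏ i' ∈ s.erase i, (1 - α i' / α i)⁻¹)) := by
  rw [← constTermLaurent_C_mul]
  rw [← SetLike.mem_coe, Submonoid.subsemiringClosure_coe] at hf
  induction hf using AddSubmonoid.closure_induction with
  | zero => simp
  | add f f' _ _ hf hf' =>
    simp only [Prod.fst_add, Prod.snd_add, add_mul, mul_add, map_add, hf, hf', Pi.add_apply,
      Finset.sum_add_distrib]
    abel
  | mem f hf =>
    obtain ⟨b, hb, k, h1, h2, h3⟩ := hf
    rw [h1, h2]
    have hAb := mul_mem hA hb
    rw [mul_assoc (C b), ← mul_assoc (C A), ← map_mul, mul_assoc b, ← mul_assoc A]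
    rcases s.eq_empty_or_nonempty with rfl | hs
    · simp only [Finset.prod_empty, mul_one, Finset.filter_empty, Finset.sum_empty, add_zero]
      by_cases hk : k = 0
      · subst hk
        rw [zpow_zero, zpow_zero, mul_one, mul_one, constTermLaurent_C]
      · rw [constTermLaurent_mul_zpow _ hk, constTerm_mul_yVar_zpow hAb hk]
    have hK : ∀ i ∈ s, ∀ i' ∈ s, (1 - α i' / α i)⁻¹ ∈ freeOf (F := F) x := by
      intro i hi i' hi'
      rw [hα i hi, hα i' hi', single_div_single]
      exact inv_one_sub_single_mem_freeOf (by rw [map_sub, hfree i hi, hfree i' hi', sub_zero]) _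
    have hm : ∀ i ∈ s, α i ∈ freeOf (F := F) x := fun i hi => by
      rw [hα i hi]; exact single_mem_freeOf (hfree i hi) _
    have hm' : ∀ i ∈ s, (α i)⁻¹ ∈ freeOf (F := F) x := fun i hi => by
      rw [hα i hi, inv_single]
      exact single_mem_freeOf (by rw [map_neg, hfree i hi, neg_zero]) _
    have hdiv : ∀ i ∈ s, α i / yVar x = single (a i - expo 0 (Pi.single x 1)) (r i) := by
      intro i hi
      rw [hα i hi, yVar, single_div_single, div_one]
    have hr : ∀ i ∈ s, r i ≠ 0 := by
      intro i hi h
      apply hα0 i hi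
      rw [hα i hi, h, map_zero]
    have hco : ∀ i ∈ s, expoAt x (a i - expo 0 (Pi.single x 1)) = -1 := by
      intro i hi
      rw [map_sub, hfree i hi, expoAt_expo, Pi.single_eq_same, zero_sub]
    have hne : ∀ i ∈ s, a i - expo 0 (Pi.single x 1) ≠ 0 := by
      intro i hi h
      have := hco i hi
      rw [h, map_zero] at this
      omega
    have hinf := functional_prod_geom (freeOf x) C (constTermLaurent (X := X) (F := F))
      (y := single (-1) 1) (by simp) (fun A _ k hk => constTermLaurent_mul_zpow A hk) hs hinj hm
      hm' hα0 hK (fun i hi => by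
        rw [C_apply, single_div_single]
        exact one_sub_single_ne_zero (by norm_num) _) (ρ := fun _ => 1)
      (fun i hi A hA => by rw [constTermLaurent_geom, one_smul]) k hAb
    have hval := functional_prod_geom (freeOf x) (RingHom.id (Series X F)) constTerm
      (yVar_ne_zero x) (fun A hA k hk => constTerm_mul_yVar_zpow hA hk) hs hinj hm
      hm' hα0 hK (fun i hi => by
        rw [RingHom.id_apply, hdiv i hi]
        exact one_sub_single_ne_zero (hne i hi) _) (ρ := fun i => if small i then 1 else 0)
      (fun i hi A hA => by
        rw [RingHom.id_apply, RingHom.id_apply, hdiv i hi]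
        split_ifs with h
        · rw [one_smul, constTerm_geom_small hA (hco i hi) (hsmall i hi h _)]
        · rw [zero_smul, constTerm_geom_large hA (hco i hi) (hlarge i hi h _) (hr i hi)]) k hAb
    simp only [RingHom.id_apply] at hval
    have e : ∀ i, C (α i) * (single 1 1 : HahnSeries ℤ (Series X F)) =
        C (α i) / single (-1) 1 := by
      intro i
      rw [C_apply, single_mul_single, single_div_single]
      norm_num
    simp only [e]
    rw [hinf, hval, Finset.sum_filter, ← Finset.sum_add_distrib]
    refine Finset.sum_congr rfl fun i hi => ?_
    rw [constTermLaurent_C, h3 i hi]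
    by_cases h : small i
    · simp [h]
    · rw [if_neg h, if_pos h]
      rw [show A * (b * α i ^ k * ∏ i' ∈ s.erase i, (1 - α i' / α i)⁻¹) =
        A * b * (α i ^ k * ∏ i' ∈ s.erase i, (1 - α i' / α i)⁻¹) by ring, add_zero,
        sub_add_cancel, sub_smul, one_smul, sub_add_cancel]

end oneVariable

end QuiverShuffle
end

noncomputable section
namespace QuiverShuffle

/-! ### Constant terms of Laurent polynomials divided by the kernel, one variable at a time -/

section evHom

variable {X F L : Type*} [Fintype X] [Field F] [Field L]

/-- The evaluation of Laurent polynomials as a ring homomorphism. -/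
def evHom (ι : F →+* L) (u : X → L) (hu : ∀ x, u x ≠ 0) : AddMonoidAlgebra F (X → ℤ) →+* L :=
  AddMonoidAlgebra.liftNCRingHom ι
    { toFun := fun p => ∏ x, u x ^ (Multiplicative.toAdd p) x
      map_one' := by simp
      map_mul' := fun p q => by
        simp only [toAdd_mul, Pi.add_apply, zpow_add₀ (hu _), Finset.prod_mul_distrib] }
    (fun _ _ => Commute.all _ _)

theorem evHom_single (ι : F →+* L) (u : X → L) (hu : ∀ x, u x ≠ 0) (p : X → ℤ) (c : F) :
    evHom ι u hu (AddMonoidAlgebra.single p c) = ι c * ∏ x, u x ^ p x :=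
  AddMonoidAlgebra.liftNCRingHom_single _ _ _ _ _

theorem ev_coeff (ι : F →+* L) (u : X → L) (hu : ∀ x, u x ≠ 0) (f : AddMonoidAlgebra F (X → ℤ)) :
    ev ι u f.coeff = evHom ι u hu f := by
  refine DFunLike.congr_fun (f := (ev ι u).comp
    (AddMonoidAlgebra.coeffAddEquiv (R := F) (M := X → ℤ)).toAddMonoidHom)
    (g := (evHom ι u hu).toAddMonoidHom) (AddMonoidAlgebra.addMonoidHom_ext fun p c => ?_) f
  change ev ι u (Finsupp.single p c) = evHom ι u hu (AddMonoidAlgebra.single p c)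
  rw [ev_single, evHom_single]

theorem evHom_single_single [DecidableEq X] (ι : F →+* L) (u : X → L) (hu : ∀ x, u x ≠ 0) (a : X) (c : F) :
    evHom ι u hu (AddMonoidAlgebra.single (Pi.single a 1) c) = ι c * u a := by
  rw [evHom_single, Finset.prod_eq_single a]
  · simp
  · intro b _ hb
    simp [hb]
  · simp

/-- The geometric series. -/
def geomSeries {A : Type*} [CommRing A] (b : A) : PowerSeries A := PowerSeries.mk fun m => b ^ m

theorem geomSeries_mul {A : Type*} [CommRing A] (b : A) :
    geomSeries b * (1 - PowerSeries.C b * PowerSeries.X) = 1 := by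
  ext m
  rw [mul_sub, mul_one, ← mul_assoc, map_sub]
  cases m with
  | zero => simp [geomSeries]
  | succ m =>
    rw [PowerSeries.coeff_succ_mul_X, PowerSeries.coeff_mul_C, geomSeries, PowerSeries.coeff_mk,
      PowerSeries.coeff_mk, ← pow_succ, sub_self, PowerSeries.coeff_one, if_neg (by omega)]

theorem constantCoeff_geomSeries {A : Type*} [CommRing A] (b : A) :
    PowerSeries.constantCoeff (geomSeries b) = 1 := by
  rw [← PowerSeries.coeff_zero_eq_constantCoeff_apply, geomSeries, PowerSeries.coeff_mk, pow_zero]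

/-- The evaluation of the coefficients of a power series. -/
def evSeries (ι : F →+* L) (u : X → L) (hu : ∀ x, u x ≠ 0) :
    PowerSeries (AddMonoidAlgebra F (X → ℤ)) →+* HahnSeries ℤ L :=
  (HahnSeries.ofPowerSeries ℤ L).comp (PowerSeries.map (evHom ι u hu))

theorem evSeries_C_mul_X (ι : F →+* L) (u : X → L) (hu : ∀ x, u x ≠ 0)
    (b : AddMonoidAlgebra F (X → ℤ)) :
    evSeries ι u hu (PowerSeries.C b * PowerSeries.X) = HahnSeries.single 1 (evHom ι u hu b) := by
  rw [evSeries, RingHom.comp_apply, map_mul, map_mul, PowerSeries.map_C, PowerSeries.map_X,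
    HahnSeries.ofPowerSeries_C, HahnSeries.ofPowerSeries_X, HahnSeries.C_apply,
    HahnSeries.single_mul_single, zero_add, mul_one]

theorem evSeries_geomSeries (ι : F →+* L) (u : X → L) (hu : ∀ x, u x ≠ 0)
    (b : AddMonoidAlgebra F (X → ℤ)) :
    evSeries ι u hu (geomSeries b) = (1 - HahnSeries.single 1 (evHom ι u hu b))⁻¹ := by
  refine eq_inv_of_mul_eq_one_left ?_
  rw [← evSeries_C_mul_X, ← map_one (evSeries ι u hu), ← map_sub, ← map_mul, geomSeries_mul]

theorem evSeries_coeff (ι : F →+* L) (u : X → L) (hu : ∀ x, u x ≠ 0)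
    (f : PowerSeries (AddMonoidAlgebra F (X → ℤ))) (k : ℤ) :
    (evSeries ι u hu f).coeff k = if k < 0 then 0 else evHom ι u hu (f.coeff k.toNat) := by
  split_ifs with hk
  · rw [evSeries, RingHom.comp_apply, HahnSeries.ofPowerSeries_apply]
    refine HahnSeries.embDomain_of_notMem_range ?_
    rintro ⟨m, hm⟩
    have : (m : ℤ) = k := hm
    omega
  · lift k to ℕ using (by omega)
    rw [evSeries, RingHom.comp_apply, HahnSeries.ofPowerSeries_apply_coeff]
    simp

end evHom

section resMap

variable {I : Type*} [Quiver I] [Fintype I] [∀ i j : I, Fintype (i ⟶ j)] {n : I → ℕ}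

open Classical in
/-- The expansion at `z_x = ∞` of the inverse of the kernel. -/
def kernelSeries (x a : Vars n) : PowerSeries (AddMonoidAlgebra (BaseField I) (Vars n → ℤ)) :=
  (if a.1 = x.1 then (1 - PowerSeries.C (AddMonoidAlgebra.single (Pi.single a 1) 1) *
      PowerSeries.X) * geomSeries (AddMonoidAlgebra.single (Pi.single a 1) (qPar I)⁻¹) else 1) *
    ∏ c ∈ weights a.1 x.1, geomSeries (AddMonoidAlgebra.single (Pi.single a 1) c)

theorem evSeries_kernelSeries {L : Type*} [Field L] (ι : BaseField I →+* L) (u : Vars n → L)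
    (hu : ∀ x, u x ≠ 0) (x a : Vars n) :
    evSeries ι u hu (kernelSeries x a) =
      (zetaAt (HahnSeries.C.comp ι) a.1 x.1 (HahnSeries.single 1 (u a)))⁻¹ := by
  classical
  have e : ∀ c : BaseField I, (HahnSeries.C.comp ι) c * HahnSeries.single (1 : ℤ) (u a) =
      HahnSeries.single 1 (ι c * u a) := by
    intro c
    rw [RingHom.comp_apply, HahnSeries.C_apply, HahnSeries.single_mul_single, zero_add]
  have hg : ∀ c, evSeries ι u hu (geomSeries (AddMonoidAlgebra.single (Pi.single a 1) c)) =
      (1 - HahnSeries.single 1 (ι c * u a))⁻¹ := by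
    intro c
    rw [evSeries_geomSeries, evHom_single_single]
  rw [kernelSeries, zetaAt, map_mul, map_prod, mul_inv, ← Finset.prod_inv_distrib]
  congr 1
  · split_ifs with h
    · rw [map_mul, hg, map_sub, map_one, evSeries_C_mul_X, evHom_single_single, map_one, one_mul,
        inv_div, div_eq_mul_inv, ← map_inv₀, mul_comm (HahnSeries.single 1 (u a)), e]
    · simp
  · exact Finset.prod_congr rfl fun c _ => by rw [hg, e]

theorem constantCoeff_kernelSeries (x a : Vars n) :
    PowerSeries.constantCoeff (kernelSeries x a) = 1 := by
  classical
  rw [kernelSeries, map_mul, map_prod]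
  simp only [constantCoeff_geomSeries, Finset.prod_const_one, mul_one]
  split_ifs
  · simp [constantCoeff_geomSeries]
  · simp

open Classical in
/-- The constant term in `z_x`, in the expansion at infinity, of the product of a Laurent polynomial
and the inverse of the kernel. -/
def resMap (x : Vars n) (l : List (Vars n)) : Laurent (I := I) n →+ Laurent (I := I) n :=
  Finsupp.liftAddHom fun p =>
    ((AddMonoidAlgebra.coeffAddEquiv (R := BaseField I) (M := Vars n → ℤ)).toAddMonoidHom.comp
      (AddMonoidHom.mulRight (if p x < 0 then 0 else
        PowerSeries.coeff (p x).toNat (l.map (kernelSeries x)).prod))).comp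
      (AddMonoidAlgebra.singleAddHom (Function.update p x 0))

open Classical in
theorem resMap_single (x : Vars n) (l : List (Vars n)) (p : Vars n → ℤ) (c : BaseField I) :
    resMap x l (Finsupp.single p c) =
      (AddMonoidAlgebra.single (Function.update p x 0) c * (if p x < 0 then 0 else
        PowerSeries.coeff (p x).toNat (l.map (kernelSeries x)).prod)).coeff := by
  rw [resMap, Finsupp.liftAddHom_apply_single]
  rfl

theorem resMap_apply_of_nonpos {x : Vars n} {l : List (Vars n)} {R : Laurent (I := I) n}
    (hR : ∀ p, 0 < p x → R p = 0) (e : Vars n → ℤ) :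
    resMap x l R e = if e x = 0 then R e else 0 := by
  classical
  have h1 : ∀ p ∈ R.support, resMap x l (Finsupp.single p (R p)) =
      if p x = 0 then Finsupp.single p (R p) else 0 := by
    intro p hp
    rw [resMap_single]
    have hp' : ¬ 0 < p x := fun h => (Finsupp.mem_support_iff.1 hp) (hR p h)
    by_cases h0 : p x = 0
    · rw [if_pos h0, h0, if_neg (lt_irrefl _), Int.toNat_zero,
        PowerSeries.coeff_zero_eq_constantCoeff_apply, map_list_prod, List.map_map]
      have : (l.map (PowerSeries.constantCoeff ∘ kernelSeries x)).prod =
          (1 : AddMonoidAlgebra (BaseField I) (Vars n → ℤ)) :=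
        List.prod_eq_one fun y hy => by
          obtain ⟨a, -, rfl⟩ := List.mem_map.1 hy
          exact constantCoeff_kernelSeries x a
      rw [this, mul_one, ← h0, Function.update_eq_self]
      rfl
    · rw [if_neg h0, if_pos (by omega), mul_zero]
      rfl
  conv_lhs => rw [← Finsupp.sum_single R, Finsupp.sum, map_sum, Finset.sum_congr rfl h1,
    Finsupp.finsetSum_apply]
  by_cases he : R e = 0
  · rw [Finset.sum_eq_zero, he, ite_self]
    intro p hp
    split_ifs
    · rw [Finsupp.single_apply, if_neg]
      rintro rfl
      exact (Finsupp.mem_support_iff.1 hp) he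
    · rfl
  · rw [Finset.sum_eq_single e]
    · split_ifs <;> simp
    · intro p _ hpe
      split_ifs
      · rw [Finsupp.single_apply, if_neg hpe]
      · rfl
    · intro h
      exact absurd (Finsupp.notMem_support_iff.1 h) he

open Classical in
theorem ev_resMap {L : Type*} [Field L] (ι : BaseField I →+* L) (u : Vars n → L)
    (hu : ∀ x, u x ≠ 0) (x : Vars n) (l : List (Vars n)) (R : Laurent (I := I) n) :
    ev ι u (resMap x l R) =
      (ev (HahnSeries.C.comp ι) (Function.update (fun y => HahnSeries.C (u y)) x
        (HahnSeries.single (-1) 1)) R *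
      (l.map fun a : Vars n => (zetaAt (HahnSeries.C.comp ι) a.1 x.1
        (HahnSeries.single (1 : ℤ) (u a)))⁻¹).prod).coeff 0 := by
  have hH : (l.map fun a : Vars n => (zetaAt (HahnSeries.C.comp ι) a.1 x.1
      (HahnSeries.single (1 : ℤ) (u a)))⁻¹).prod =
      evSeries ι u hu (l.map (kernelSeries x)).prod := by
    rw [map_list_prod, List.map_map]
    congr 1
    exact List.map_congr_left fun a _ => (evSeries_kernelSeries ι u hu x a).symm
  rw [hH]
  set H := (l.map (kernelSeries x)).prod with hHdef
  refine DFunLike.congr_fun (f := (ev ι u).comp (resMap x l)) (g :=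
    (⟨⟨fun f : HahnSeries ℤ L => f.coeff 0, rfl⟩, fun _ _ => rfl⟩ : HahnSeries ℤ L →+ L).comp
    ((AddMonoidHom.mulRight (evSeries ι u hu H)).comp (ev (HahnSeries.C.comp ι)
      (Function.update (fun y => HahnSeries.C (u y)) x (HahnSeries.single (-1) 1)))))
    (Finsupp.addHom_ext fun p c => ?_) R
  change ev ι u (resMap x l (Finsupp.single p c)) =
    (ev (HahnSeries.C.comp ι) (Function.update (fun y => HahnSeries.C (u y)) x
        (HahnSeries.single (-1) 1)) (Finsupp.single p c) * evSeries ι u hu H).coeff 0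
  have hprod : ∏ y, (Function.update (fun y => HahnSeries.C (u y)) x
      (HahnSeries.single (-1) 1) y : HahnSeries ℤ L) ^ p y =
      HahnSeries.single (-(p x)) (∏ y, u y ^ (Function.update p x 0) y) := by
    rw [← Finset.mul_prod_erase _ _ (Finset.mem_univ x),
      ← Finset.mul_prod_erase _ (fun y => u y ^ (Function.update p x 0) y) (Finset.mem_univ x),
      Function.update_self, Function.update_self, zpow_zero, one_mul, single_zpow', one_zpow]
    have : ∏ y ∈ Finset.univ.erase x, (Function.update (fun y => HahnSeries.C (u y)) x
        (HahnSeries.single (-1) 1) y : HahnSeries ℤ L) ^ p y =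
        HahnSeries.C (∏ y ∈ Finset.univ.erase x, u y ^ (Function.update p x 0) y) := by
      rw [map_prod]
      refine Finset.prod_congr rfl fun y hy => ?_
      rw [Function.update_of_ne (Finset.ne_of_mem_erase hy),
        Function.update_of_ne (Finset.ne_of_mem_erase hy), map_zpow₀]
    rw [this, HahnSeries.C_apply, HahnSeries.single_mul_single]
    simp
  rw [resMap_single, ev_coeff ι u hu, map_mul, evHom_single, ev_single, hprod, RingHom.comp_apply,
    HahnSeries.C_apply, HahnSeries.single_mul_single, zero_add, HahnSeries.coeff_single_mul,
    zero_sub, neg_neg, evSeries_coeff, apply_ite (evHom ι u hu), map_zero]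

end resMap

end QuiverShuffle
end

noncomputable section
namespace QuiverShuffle

section pairing

variable {I : Type*} [Quiver I] [Fintype I] [∀ i j : I, Fintype (i ⟶ j)] {n : I → ℕ}

/-- The iterated constant term of a Laurent polynomial divided by the kernel. -/
def pairing : List (Vars n) → Laurent (I := I) n →+ BaseField I
  | [] => Finsupp.applyAddHom 0
  | x :: l => (pairing l).comp (resMap x l)

/-- The first non-zero exponent along a list is positive. -/
def LexPos {X : Type*} : List X → (X → ℤ) → Prop
  | [], _ => False
  | x :: l, e => 0 < e x ∨ (e x = 0 ∧ LexPos l e)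

theorem pairing_eq_of_lexPos (l : List (Vars n)) : ∀ {R : Laurent (I := I) n},
    (∀ e, LexPos l e → R e = 0) → pairing l R = R 0 := by
  induction l with
  | nil => intro R _; rfl
  | cons x l ih =>
    intro R hR
    have h := resMap_apply_of_nonpos (l := l) (fun p hp => hR p (Or.inl hp))
    change pairing l (resMap x l R) = R 0
    rw [ih, h]
    · exact if_pos rfl
    · intro e he
      rw [h]
      split_ifs with h0
      · exact hR e (Or.inr ⟨h0, he⟩)
      · rfl

universe w

/-- The wheel conditions for the variables in a list, at points of arbitrary fields. -/
def WheelOn (l : List (Vars n)) (R : Laurent (I := I) n) : Prop :=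
  ∀ (L : Type w) [Field L] (ι : BaseField I →+* L) (u : Vars n → L), (∀ x, u x ≠ 0) →
    ∀ a' ∈ l, ∀ a ∈ l, ∀ x ∈ l, a' ≠ a → x ≠ a → x ≠ a' → a'.1 = a.1 → ∀ c ∈ weights a.1 x.1,
      u a' = ι (qPar I) * u a → u x = ι c * u a → ev ι u R = 0

theorem WheelOn.resMap {x : Vars n} {l : List (Vars n)} (hx : x ∉ l) {R : Laurent (I := I) n}
    (hR : WheelOn.{w} (x :: l) R) : WheelOn.{w} l (resMap x l R) := by
  classical
  intro L _ ι u hu a' ha' a ha y hy h1 h2 h3 hcol c hc e1 e2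
  rw [ev_resMap ι u hu]
  have hne : ∀ z ∈ l, z ≠ x := fun z hz h => hx (h ▸ hz)
  rw [hR (HahnSeries ℤ L) (HahnSeries.C.comp ι) _ (fun z => ?_) a' (by simp [ha']) a (by simp [ha])
    y (by simp [hy]) h1 h2 h3 hcol c hc, zero_mul, HahnSeries.coeff_zero]
  · rw [Function.update_of_ne (hne _ ha'), Function.update_of_ne (hne _ ha), e1, map_mul]
    rfl
  · rw [Function.update_of_ne (hne _ hy), Function.update_of_ne (hne _ ha), e2, map_mul]
    rfl
  · by_cases hz : z = x
    · subst hz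
      rw [Function.update_self]
      simp
    · rw [Function.update_of_ne hz]
      exact HahnSeries.C_ne_zero (hu z)

end pairing

/-! ### The configurations of poles -/

section confs

variable {I : Type*} {n : I → ℕ}

/-- A configuration assigns to each variable `x` the point `q ^ (-j) z_b`, where `b` is the base and
`j` is the depth of `x`. -/
abbrev Config (n : I → ℕ) : Type _ := Vars n → Vars n × ℕ

/-- The configurations that can occur for a list of variables. -/
structure IsConf (l : List (Vars n)) (c : Config n) : Prop where
  injective : Function.Injective c
  colour : ∀ x, (c x).1.1 = x.1
  of_notMem : ∀ x ∉ l, c x = (x, 0)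
  of_depth_eq_zero : ∀ x, (c x).2 = 0 → (c x).1 = x
  exists_parent : ∀ x k, (c x).2 = k + 1 → ∃ a, c a = ((c x).1, k) ∧ Before l x a

open Classical in
/-- The possible positions of a new variable, directly below a free variable of its colour. -/
def freeParents (x : Vars n) (l : List (Vars n)) (c : Config n) : Finset (Vars n) :=
  l.toFinset.filter fun a => a.1 = x.1 ∧ ∀ a' ∈ l, c a' ≠ ((c a).1, (c a).2 + 1)

theorem mem_freeParents {x a : Vars n} {l : List (Vars n)} {c : Config n} :
    a ∈ freeParents x l c ↔ a ∈ l ∧ a.1 = x.1 ∧ ∀ a' ∈ l, c a' ≠ ((c a).1, (c a).2 + 1) := by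
  classical
  rw [freeParents, Finset.mem_filter, List.mem_toFinset]

open Classical in
/-- Moving the variable `x` directly below the variable `a`. -/
def attach (c : Config n) (x a : Vars n) : Config n :=
  Function.update c x ((c a).1, (c a).2 + 1)

open Classical in
/-- The set of configurations for a list of variables. -/
def confs : List (Vars n) → Finset (Config n)
  | [] => {fun x => (x, 0)}
  | x :: l => confs l ∪ (confs l).biUnion fun c => (freeParents x l c).image fun a => attach c x a

theorem mem_confs {l : List (Vars n)} (hl : l.Nodup) {c : Config n} :
    c ∈ confs l ↔ IsConf l c := by
  classical
  induction l generalizing c with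
  | nil =>
    rw [confs, Finset.mem_singleton]
    constructor
    · rintro rfl
      exact ⟨fun x y h => (Prod.ext_iff.1 h).1, fun _ => rfl, fun _ _ => rfl, fun _ _ => rfl,
        fun _ _ h => by simp at h⟩
    · intro h
      exact funext fun x => h.of_notMem x (by simp)
  | cons x l ih =>
    obtain ⟨hx, hl⟩ := List.nodup_cons.1 hl
    simp only [confs, Finset.mem_union, Finset.mem_biUnion, Finset.mem_image, freeParents,
      Finset.mem_filter, List.mem_toFinset, ih hl]
    constructor
    · rintro (h | ⟨c, h, a, ⟨hal, hcol, hfree⟩, rfl⟩)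
      · exact ⟨h.injective, h.colour, fun y hy => h.of_notMem y fun h => hy (by simp [h]),
          h.of_depth_eq_zero, fun y k hk => by
            obtain ⟨a, h1, h2⟩ := h.exists_parent y k hk
            exact ⟨a, h1, Or.inr h2⟩⟩
      · have hax : a ≠ x := fun h => hx (h ▸ hal)
        have hfree' : ∀ a', c a' ≠ ((c a).1, (c a).2 + 1) := by
          intro a'
          by_cases ha' : a' ∈ l
          · exact hfree a' ha'
          · rw [h.of_notMem a' ha']
            intro h
            simp at h
        refine ⟨?_, fun y => ?_, fun y hy => ?_, fun y => ?_, fun y k => ?_⟩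
        · intro y z hyz
          simp only [attach, Function.update_apply] at hyz
          split_ifs at hyz with h1 h2 h2
          · rw [h1, h2]
          · exact absurd hyz.symm (hfree' z)
          · exact absurd hyz (hfree' y)
          · exact h.injective hyz
        · simp only [attach, Function.update_apply]
          split_ifs with h1
          · rw [h.colour, hcol, h1]
          · exact h.colour y
        · rw [List.mem_cons, not_or] at hy
          simp only [attach, Function.update_apply]
          rw [if_neg hy.1, h.of_notMem y hy.2]
        · simp only [attach, Function.update_apply]
          split_ifs with h1
          · intro h; simp at h
          · exact h.of_depth_eq_zero y
        · simp only [attach, Function.update_apply]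
          split_ifs with h1
          · intro hk
            refine ⟨a, ?_, Or.inl ⟨h1, hal⟩⟩
            rw [if_neg hax]
            have : (c a).2 = k := by simpa using hk
            rw [← this]
          · intro hk
            obtain ⟨b, h2, h3⟩ := h.exists_parent y k hk
            refine ⟨b, ?_, Or.inr h3⟩
            rw [if_neg, h2]
            rintro rfl
            exact hx h3.mem_right
    · intro h
      rcases hd : (c x).2 with - | k
      · left
        refine ⟨h.injective, h.colour, fun y hy => ?_, h.of_depth_eq_zero, fun y k hk => ?_⟩
        · by_cases hyx : y = x
          · subst hyx
            exact Prod.ext (h.of_depth_eq_zero y hd) hd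
          · exact h.of_notMem y (by simp [hyx, hy])
        · obtain ⟨a, h1, h2 | h2⟩ := h.exists_parent y k hk
          · rw [h2.1] at hk
            omega
          · exact ⟨a, h1, h2⟩
      · right
        obtain ⟨a, h1, h2⟩ := h.exists_parent x k hd
        have hal : a ∈ l := by
          rcases h2 with h2 | h2
          · exact h2.2
          · exact absurd h2.mem_left hx
        have hax : a ≠ x := fun h => hx (h ▸ hal)
        refine ⟨Function.update c x (x, 0), ⟨?_, fun y => ?_, fun y hy => ?_, fun y => ?_,
          fun y k => ?_⟩, a, ⟨hal, ?_, fun a' ha' => ?_⟩, ?_⟩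
        · have hno : ∀ y, y ≠ x → c y ≠ (x, 0) := by
            intro y hy h3
            have := h.of_depth_eq_zero y (by rw [h3])
            rw [h3] at this
            exact hy this.symm
          intro y z hyz
          simp only [Function.update_apply] at hyz
          split_ifs at hyz with h1 h2 h2
          · rw [h1, h2]
          · exact absurd hyz.symm (hno z h2)
          · exact absurd hyz (hno y h1)
          · exact h.injective hyz
        · simp only [Function.update_apply]
          split_ifs with h1
          · rw [h1]
          · exact h.colour y
        · simp only [Function.update_apply]
          split_ifs with h1
          · rw [h1]
          · exact h.of_notMem y (by simp [h1, hy])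
        · simp only [Function.update_apply]
          split_ifs with h1
          · intro _; exact h1.symm
          · exact h.of_depth_eq_zero y
        · simp only [Function.update_apply]
          split_ifs with h1
          · intro h; simp at h
          · intro hk
            obtain ⟨b, h3, h4⟩ := h.exists_parent y k hk
            have h4' : Before l y b := h4.resolve_left fun h => h1 h.1
            refine ⟨b, ?_, h4'⟩
            rw [if_neg, h3]
            rintro rfl
            exact hx h4'.mem_right
        · have e1 := h.colour a
          rw [h1, h.colour x] at e1
          exact e1.symm
        · have ha'x : a' ≠ x := fun h => hx (h ▸ ha')
          rw [Function.update_of_ne ha'x, Function.update_of_ne hax, h1]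
          intro h3
          refine ha'x (h.injective (h3.trans ?_))
          rw [← hd]
        · rw [attach, Function.update_of_ne hax, Function.update_idem, h1]
          have : ((c x).1, k + 1) = c x := by rw [← hd]
          simp only [this, Function.update_eq_self]

theorem sum_confs_cons {V : Type*} [AddCommMonoid V] {x : Vars n} {l : List (Vars n)}
    (hl : (x :: l).Nodup) (f : Config n → V) :
    ∑ c ∈ confs (x :: l), f c =
      ∑ c ∈ confs l, (f c + ∑ a ∈ freeParents x l c, f (attach c x a)) := by
  classical
  obtain ⟨hx, hl⟩ := List.nodup_cons.1 hl
  have hx0 : ∀ c ∈ confs l, c x = (x, 0) := fun c hc => ((mem_confs hl).1 hc).of_notMem x hx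
  have hmem : ∀ {c a}, a ∈ freeParents x l c → a ≠ x := by
    intro c a ha h
    rw [freeParents, Finset.mem_filter, List.mem_toFinset] at ha
    exact hx (h ▸ ha.1)
  rw [confs, Finset.sum_union, Finset.sum_biUnion, Finset.sum_add_distrib]
  · congr 1
    refine Finset.sum_congr rfl fun c hc => Finset.sum_image fun a ha a' ha' h => ?_
    have h1 := congrFun h x
    rw [attach, attach, Function.update_self, Function.update_self] at h1
    refine ((mem_confs hl).1 hc).injective (Prod.ext ?_ ?_)
    · exact (Prod.ext_iff.1 h1).1
    · simpa using (Prod.ext_iff.1 h1).2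
  · intro c hc c' hc' hne
    rw [Function.onFun, Finset.disjoint_left]
    rintro d hd hd'
    obtain ⟨a, ha, rfl⟩ := Finset.mem_image.1 hd
    obtain ⟨a', ha', h⟩ := Finset.mem_image.1 hd'
    refine hne (funext fun y => ?_)
    by_cases hy : y = x
    · rw [hy, hx0 c hc, hx0 c' hc']
    · have := congrFun h y
      rw [attach, attach, Function.update_of_ne hy, Function.update_of_ne hy] at this
      exact this.symm
  · rw [Finset.disjoint_left]
    intro d hd hd'
    obtain ⟨c, hc, hd'⟩ := Finset.mem_biUnion.1 hd'
    obtain ⟨a, ha, rfl⟩ := Finset.mem_image.1 hd'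
    have := hx0 _ hd
    rw [attach, Function.update_self] at this
    simp at this

end confs

end QuiverShuffle
end

noncomputable section
namespace QuiverShuffle

/-! ### The kernels at the points of configurations -/

section kernel

variable {I : Type*} [Quiver I] [∀ i j : I, Fintype (i ⟶ j)] {n : I → ℕ}
variable {L : Type*} [Field L]

open Classical in
/-- The coefficients `c` of the poles `z_x = c z_a` of the inverse of `ζ`. -/
def poleWeights (i j : I) : Finset (BaseField I) :=
  if i = j then insert (qPar I)⁻¹ (weights i j) else weights i j

theorem inv_qPar_notMem_weights (i j : I) : (qPar I)⁻¹ ∉ weights i j := by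
  intro h
  have h1 := gradSeries_weight I h
  rw [map_inv₀, gradSeries_qPar, HahnSeries.inv_single] at h1
  have h2 := congrArg (fun f => f.coeff (1 : ℤ)) h1
  simp only [HahnSeries.coeff_single_same] at h2
  rw [HahnSeries.coeff_single_of_ne (by norm_num)] at h2
  exact inv_ne_zero qPar_ne_zero h2.symm

theorem mem_poleWeights {i j : I} {e : BaseField I} :
    e ∈ poleWeights i j ↔ e ∈ weights i j ∨ (i = j ∧ e = (qPar I)⁻¹) := by
  classical
  rw [poleWeights]
  split_ifs with h
  · rw [Finset.mem_insert]
    tauto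
  · tauto

open Classical in
theorem prod_poleWeights {M : Type*} [CommMonoid M] (i j : I) (f : BaseField I → M) :
    ∏ e ∈ poleWeights i j, f e =
      (if i = j then f (qPar I)⁻¹ else 1) * ∏ e ∈ weights i j, f e := by
  rw [poleWeights]
  split_ifs with h
  · rw [Finset.prod_insert (inv_qPar_notMem_weights i j)]
  · rw [one_mul]

open Classical in
/-- The inverse of a non-zero element, and `1` for zero. -/
def invOrOne (w : L) : L := if w = 0 then 1 else w⁻¹

theorem invOrOne_zero : invOrOne (0 : L) = 1 := if_pos rfl

theorem invOrOne_of_ne {w : L} (h : w ≠ 0) : invOrOne w = w⁻¹ := if_neg h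

open Classical in
/-- The inverse of `ζ`, without the factors which have a pole. -/
def kernelAt (ι : BaseField I →+* L) (u : Vars n → L) (a x : Vars n) : L :=
  (if a.1 = x.1 then 1 - u a / u x else 1) *
    ∏ e ∈ poleWeights a.1 x.1, invOrOne (1 - ι e * u a / u x)

open Classical in
/-- The product of the kernels for a list of variables. -/
def kernelList (ι : BaseField I →+* L) (u : Vars n → L) : List (Vars n) → L
  | [] => 1
  | x :: l => (∏ a ∈ l.toFinset, kernelAt ι u a x) * kernelList ι u l

open Classical in
/-- The indices of the poles in the variable `z_x`. -/
def poleSet (x : Vars n) (l : List (Vars n)) : Finset (Σ _ : Vars n, BaseField I) :=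
  l.toFinset.sigma fun a => poleWeights a.1 x.1

open Classical in
theorem mem_poleSet {x : Vars n} {l : List (Vars n)} {i : Σ _ : Vars n, BaseField I} :
    i ∈ poleSet x l ↔ i.1 ∈ l ∧ i.2 ∈ poleWeights i.1.1 x.1 := by
  rw [poleSet, Finset.mem_sigma, List.mem_toFinset]

open Classical in
theorem prod_kernelAt (ι : BaseField I →+* L) (u : Vars n → L) (x : Vars n) (l : List (Vars n)) :
    ∏ a ∈ l.toFinset, kernelAt ι u a x =
      (∏ a ∈ l.toFinset with a.1 = x.1, (1 - u a / u x)) *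
        ∏ i ∈ poleSet x l, invOrOne (1 - ι i.2 * u i.1 / u x) := by
  simp only [kernelAt]
  rw [Finset.prod_mul_distrib, Finset.prod_filter, poleSet, Finset.prod_sigma]

theorem kernelList_congr (ι : BaseField I →+* L) {u v : Vars n → L} {l : List (Vars n)}
    (h : ∀ x ∈ l, u x = v x) : kernelList ι u l = kernelList ι v l := by
  classical
  induction l with
  | nil => rfl
  | cons x l ih =>
    rw [kernelList, kernelList, ih fun y hy => h y (by simp [hy])]
    congr 1
    refine Finset.prod_congr rfl fun a ha => ?_
    rw [kernelAt, kernelAt, h x (by simp), h a (by simpa using Or.inr (List.mem_toFinset.1 ha))]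

open Classical in
theorem prod_inv_zetaAt (ι : BaseField I →+* L) (u : Vars n → L) (x : Vars n) {l : List (Vars n)}
    (hl : l.Nodup) :
    (l.map fun a : Vars n => (zetaAt (HahnSeries.C.comp ι) a.1 x.1
      (HahnSeries.single (1 : ℤ) (u a)))⁻¹).prod =
      (∏ a ∈ l.toFinset with a.1 = x.1, (1 - HahnSeries.single (1 : ℤ) (u a))) *
        ∏ i ∈ poleSet x l, (1 - HahnSeries.C (ι i.2 * u i.1) * HahnSeries.single (1 : ℤ) 1)⁻¹ := by
  rw [← List.prod_toFinset _ hl, Finset.prod_filter, poleSet, Finset.prod_sigma,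
    ← Finset.prod_mul_distrib]
  refine Finset.prod_congr rfl fun a _ => ?_
  have e : ∀ c : BaseField I, HahnSeries.C (ι c * u a) * HahnSeries.single (1 : ℤ) 1 =
      (HahnSeries.C.comp ι) c * HahnSeries.single (1 : ℤ) (u a) := by
    intro c
    rw [RingHom.comp_apply, HahnSeries.C_apply, HahnSeries.C_apply, HahnSeries.single_mul_single,
      HahnSeries.single_mul_single, mul_one]
  simp only [e]
  rw [prod_poleWeights, zetaAt, mul_inv, ← Finset.prod_inv_distrib, ← mul_assoc]
  congr 1
  split_ifs with h
  · rw [inv_div, map_inv₀, mul_comm (HahnSeries.single (1 : ℤ) (u a)), div_eq_mul_inv]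
  · simp

end kernel

section point

open HahnSeries

variable {I : Type*} [Quiver I] [Fintype I] {n : I → ℕ}

variable (n) in
/-- The embedding of the ground field into the iterated series. -/
def toSeries : BaseField I →+* Series (Vars n) (BaseField I) :=
  (inclSeries (Vars n)).comp (gradSeries I)

theorem toSeries_qPar : toSeries n (qPar I) = single (expo 2 0) (qPar I) := by
  rw [toSeries, RingHom.comp_apply, gradSeries_qPar, inclSeries_single]

theorem toSeries_mem_freeOf (x : Vars n) (c : BaseField I) : toSeries n c ∈ freeOf x :=
  inclSeries_mem_freeOf x _

open Classical in
/-- The `s`-exponent of the coefficient of a pole. -/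
def poleExp (e : BaseField I) : ℤ := if e = (qPar I)⁻¹ then -2 else 1

theorem toSeries_pole [∀ i j : I, Fintype (i ⟶ j)] {i j : I} {e : BaseField I}
    (he : e ∈ poleWeights i j) : toSeries n e = single (expo (poleExp e) 0) e := by
  rcases mem_poleWeights.1 he with h | ⟨-, h⟩
  · have hne : e ≠ (qPar I)⁻¹ := by
      rintro rfl
      exact inv_qPar_notMem_weights i j h
    rw [poleExp, if_neg hne, toSeries,
      RingHom.comp_apply, gradSeries_weight I h, inclSeries_single]
  · rw [poleExp, if_pos h, h, map_inv₀, toSeries_qPar, inv_single, expo_neg, neg_zero]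

theorem pole_ne_zero [∀ i j : I, Fintype (i ⟶ j)] {i j : I} {e : BaseField I}
    (he : e ∈ poleWeights i j) : e ≠ 0 := by
  rcases mem_poleWeights.1 he with h | ⟨-, h⟩
  · exact weights_ne_zero h
  · rw [h]; exact inv_ne_zero qPar_ne_zero

open Classical in
/-- The point `q ^ (-j) z_b` of a configuration. -/
def point (c : Config n) (x : Vars n) : Series (Vars n) (BaseField I) :=
  single (expo (-2 * ((c x).2 : ℤ)) (Pi.single (c x).1 1)) ((qPar I)⁻¹ ^ (c x).2)

theorem point_ne_zero (c : Config n) (x : Vars n) : point c x ≠ (0 : Series _ (BaseField I)) := by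
  rw [point, Ne, single_eq_zero_iff]
  exact pow_ne_zero _ (inv_ne_zero qPar_ne_zero)

open Classical in
theorem point_of_eq {c : Config n} {x : Vars n} (h : c x = (x, 0)) :
    point c x = (yVar x : Series _ (BaseField I)) := by
  rw [point, h, yVar]
  simp

theorem point_succ {c c' : Config n} {x a : Vars n} (h : c x = ((c' a).1, (c' a).2 + 1)) :
    point c x = toSeries n (qPar I)⁻¹ * point c' a := by
  rw [point, point, h, map_inv₀, toSeries_qPar, inv_single, single_mul_single, expo_neg, expo_add,
    neg_zero, zero_add, pow_succ', Nat.cast_succ]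
  congr 2
  ring_nf

open Classical in
theorem point_attach (c : Config n) (x a : Vars n) :
    point (attach c x a) =
      Function.update (point c) x (toSeries n (qPar I)⁻¹ * point c a) := by
  funext y
  by_cases hy : y = x
  · subst hy
    rw [Function.update_self]
    exact point_succ (by rw [attach, Function.update_self])
  · rw [Function.update_of_ne hy, point, point, attach, Function.update_of_ne hy]

theorem single_inj {Γ R : Type*} [PartialOrder Γ] [Zero R] {g g' : Γ} {r r' : R} (hr : r ≠ 0)
    (h : (single g r : HahnSeries Γ R) = single g' r') : g = g' ∧ r = r' := by
  have h1 := congrArg (fun f => f.coeff g) h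
  simp only [coeff_single_same] at h1
  by_cases hg : g = g'
  · subst hg
    rw [coeff_single_same] at h1
    exact ⟨rfl, h1⟩
  · rw [coeff_single_of_ne hg] at h1
    exact absurd h1 hr

theorem expo_base_inj {X : Type*} [Fintype X] [DecidableEq X] {k k' : ℤ} {b b' : X}
    (h : expo k (Pi.single b 1 : X → ℤ) = expo k' (Pi.single b' 1)) : k = k' ∧ b = b' := by
  obtain ⟨h1, h2⟩ := expo_inj.1 h
  refine ⟨h1, ?_⟩
  by_contra hb
  have := congrFun h2 b
  rw [Pi.single_eq_same, Pi.single_eq_of_ne hb] at this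
  exact one_ne_zero this

variable [∀ i j : I, Fintype (i ⟶ j)]

/-- A pole in the variable `z_x`. -/
def pole (c : Config n) (i : Σ _ : Vars n, BaseField I) : Series (Vars n) (BaseField I) :=
  toSeries n i.2 * point c i.1

open Classical in
theorem pole_eq (c : Config n) {x : Vars n} {l : List (Vars n)} {i : Σ _ : Vars n, BaseField I}
    (hi : i ∈ poleSet x l) :
    pole c i = single (expo (poleExp i.2 - 2 * ((c i.1).2 : ℤ)) (Pi.single (c i.1).1 1))
      (i.2 * (qPar I)⁻¹ ^ (c i.1).2) := by
  rw [pole, toSeries_pole (mem_poleSet.1 hi).2, point, single_mul_single, expo_add, zero_add]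
  congr 2

theorem pole_injOn {c : Config n} (hc : Function.Injective c) (x : Vars n) (l : List (Vars n)) :
    Set.InjOn (pole c) (poleSet (I := I) x l : Set (Σ _ : Vars n, BaseField I)) := by
  classical
  intro i hi i' hi' h
  rw [pole_eq c hi, pole_eq c hi'] at h
  have hq : (qPar I)⁻¹ ≠ 0 := inv_ne_zero qPar_ne_zero
  obtain ⟨h1, h2⟩ := single_inj (mul_ne_zero (pole_ne_zero (mem_poleSet.1 hi).2)
    (pow_ne_zero _ hq)) h
  obtain ⟨h3, h4⟩ := expo_base_inj h1
  have h5 : (c i.1).2 = (c i'.1).2 := by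
    simp only [poleExp] at h3
    split_ifs at h3 <;> omega
  have h6 : i.1 = i'.1 := hc (Prod.ext h4 h5)
  rw [h5] at h2
  exact Sigma.ext h6 (heq_of_eq (mul_right_cancel₀ (pow_ne_zero _ hq) h2))

theorem IsConf.base_ne {l : List (Vars n)} {c : Config n} (hc : IsConf l c) {x : Vars n}
    (hx : x ∉ l) {y : Vars n} (hy : y ∈ l) : (c y).1 ≠ x := by
  have key : ∀ k y, c y = (x, k) → y = x := by
    intro k
    induction k with
    | zero =>
      intro y h
      have := hc.of_depth_eq_zero y (by rw [h])
      rw [h] at this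
      exact this.symm
    | succ k ih =>
      intro y h
      obtain ⟨a, h1, h2⟩ := hc.exists_parent y k (by rw [h])
      rw [h] at h1
      have := ih a h1
      subst this
      exact absurd h2.mem_right hx
  intro h
  exact hx (key _ y (Prod.ext h rfl) ▸ hy)

theorem invOrOne_one_sub_single_mem {X F : Type*} [Fintype X] [Field F] {x : X} {g : Expo X}
    (hg : expoAt x g = 0) (r : F) :
    invOrOne (1 - single g r : Series X F) ∈ freeOf x := by
  rw [invOrOne]
  split_ifs
  · exact one_mem _
  · exact inv_one_sub_single_mem_freeOf hg r

theorem kernelAt_mem_freeOf {c : Config n} {x a b : Vars n} (ha : (c a).1 ≠ x) (hb : (c b).1 ≠ x) :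
    kernelAt (toSeries n) (point c) a b ∈ freeOf (F := BaseField I) x := by
  classical
  have hd : ∃ g, expoAt x g = 0 ∧ ∃ r : BaseField I, point c a / point c b = single g r := by
    rw [point, point, single_div_single]
    refine ⟨_, ?_, _, rfl⟩
    rw [map_sub, expoAt_expo, expoAt_expo, Pi.single_eq_of_ne ha.symm, Pi.single_eq_of_ne hb.symm,
      sub_zero]
  obtain ⟨g, hg, r, hr⟩ := hd
  refine mul_mem ?_ (Subring.prod_mem _ fun e he => ?_)
  · split_ifs
    · rw [hr]
      exact sub_mem (one_mem _) (single_mem_freeOf hg r)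
    · exact one_mem _
  · rw [mul_div_assoc, hr, toSeries_pole he, single_mul_single]
    exact invOrOne_one_sub_single_mem (by rw [map_add, expoAt_expo, hg]; rfl) _

theorem kernelList_mem_freeOf {c : Config n} {x : Vars n} {l : List (Vars n)}
    (h : ∀ a ∈ l, (c a).1 ≠ x) :
    kernelList (toSeries n) (point c) l ∈ freeOf (F := BaseField I) x := by
  classical
  induction l with
  | nil => exact one_mem _
  | cons y l ih =>
    refine mul_mem (Subring.prod_mem _ fun a ha => ?_) (ih fun a ha => h a (by simp [ha]))
    exact kernelAt_mem_freeOf (h a (by simpa using Or.inr (List.mem_toFinset.1 ha)))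
      (h y (by simp))

theorem point_zpow_mem_freeOf {c : Config n} {x y : Vars n} (h : (c y).1 ≠ x) (k : ℤ) :
    point c y ^ k ∈ freeOf (F := BaseField I) x := by
  classical
  have h1 : point c y ∈ freeOf (F := BaseField I) x :=
    single_mem_freeOf (by rw [expoAt_expo, Pi.single_eq_of_ne h.symm]) _
  have h2 : (point c y)⁻¹ ∈ freeOf (F := BaseField I) x := by
    rw [point, inv_single]
    exact single_mem_freeOf (by rw [map_neg, expoAt_expo, Pi.single_eq_of_ne h.symm, neg_zero]) _
  cases k with
  | ofNat k => simpa using pow_mem h1 k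
  | negSucc k =>
    rw [zpow_negSucc, ← inv_pow]
    exact pow_mem h2 _

open Classical in
/-- The values of a Laurent polynomial as a Laurent polynomial in one variable. -/
theorem ev_mem_closure {c : Config n} {x : Vars n} (hx : ∀ y, y ≠ x → (c y).1 ≠ x)
    (hcx : c x = (x, 0)) {ι' : Type*} {s : Finset ι'}
    {α : ι' → Series (Vars n) (BaseField I)}
    (hα : ∀ i ∈ s, α i ≠ 0) (R : Laurent (I := I) n) :
    ((ev (C.comp (toSeries n)) (Function.update (fun y => C (point c y)) x (single (-1) 1)) R,
      ev (toSeries n) (point c) R,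
      fun i => ev (toSeries n) (Function.update (point c) x (α i)) R) :
      HahnSeries ℤ (Series (Vars n) (BaseField I)) × Series (Vars n) (BaseField I) ×
        (ι' → Series (Vars n) (BaseField I))) ∈ (evalMonomials x hα).subsemiringClosure := by
  induction R using Finsupp.induction_linear with
  | zero =>
    simp only [map_zero]
    exact zero_mem _
  | add f g hf hg =>
    simp only [map_add]
    exact add_mem hf hg
  | single p r =>
    have hprod : ∀ {M : Type _} [Field M] (v : Vars n → M) (t : M),
        ∏ y, Function.update v x t y ^ p y = (∏ y ∈ Finset.univ.erase x, v y ^ p y) * t ^ p x := by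
      intro M _ v t
      rw [← Finset.mul_prod_erase _ _ (Finset.mem_univ x), Function.update_self, mul_comm]
      congr 1
      exact Finset.prod_congr rfl fun y hy => by
        rw [Function.update_of_ne (Finset.ne_of_mem_erase hy)]
    have hself : point c = Function.update (point c) x (yVar x : Series _ (BaseField I)) := by
      rw [← point_of_eq hcx, Function.update_eq_self]
    refine (Submonoid.subsemiringClosure_mem _).2 ?_
    refine AddSubmonoid.subset_closure ⟨toSeries n r * ∏ y ∈ Finset.univ.erase x, point c y ^ p y,
      mul_mem (toSeries_mem_freeOf x r) (Subring.prod_mem _ fun y hy => ?_), p x, ?_, ?_,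
      fun i _ => ?_⟩
    · exact point_zpow_mem_freeOf (hx y (Finset.ne_of_mem_erase hy)) _
    · simp only [ev_single]
      rw [hprod, map_mul, map_prod, mul_assoc]
      simp only [map_zpow₀]
      rfl
    · simp only [ev_single]
      conv_lhs => rw [hself]
      rw [hprod, mul_assoc]
    · simp only [ev_single]
      rw [hprod, mul_assoc]

end point

end QuiverShuffle
end

noncomputable section
namespace QuiverShuffle

/-! ### The pairing as a sum over configurations -/

section step

open HahnSeries

universe u v

variable {I : Type u} [Quiver.{v} I] [Fintype I] [∀ i j : I, Fintype (i ⟶ j)] {n : I → ℕ}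

/-- The poles in `z_x` which are small in the iterated series. -/
def IsSmallPole (c : Config n) (i : Σ _ : Vars n, BaseField I) : Prop :=
  i.2 ≠ (qPar I)⁻¹ ∧ (c i.1).2 = 0

open Classical in
/-- The numerators at a pole. -/
def numerators (x : Vars n) (l : List (Vars n)) (c : Config n)
    (z : Series (Vars n) (BaseField I)) : Series (Vars n) (BaseField I) :=
  ∏ a ∈ l.toFinset with a.1 = x.1, (1 - point c a / z)

open Classical in
theorem constTerm_resMap {x : Vars n} {l : List (Vars n)} (hl : (x :: l).Nodup) {c : Config n}
    (hc : IsConf l c) (R : Laurent (I := I) n) :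
    constTerm (ev (toSeries n) (point c) (resMap x l R) *
        kernelList (toSeries n) (point c) l) =
      constTerm (ev (toSeries n) (point c) R * kernelList (toSeries n) (point c) (x :: l)) +
      ∑ i ∈ poleSet x l with ¬ IsSmallPole c i,
        constTerm (kernelList (toSeries n) (point c) l *
          (ev (toSeries n) (Function.update (point c) x (pole c i)) R * numerators x l c (pole c i) *
          ∏ i' ∈ (poleSet x l).erase i, (1 - pole c i' / pole c i)⁻¹)) := by
  obtain ⟨hx, hl⟩ := List.nodup_cons.1 hl
  have hcx : c x = (x, 0) := hc.of_notMem x hx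
  have hbase : ∀ y, y ≠ x → (c y).1 ≠ x := by
    intro y hy
    by_cases hyl : y ∈ l
    · exact hc.base_ne hx hyl
    · rw [hc.of_notMem y hyl]
      exact hy
  have hpole0 : ∀ i ∈ poleSet x l, pole c i ≠ 0 := fun i hi =>
    mul_ne_zero ((map_ne_zero _).2 (pole_ne_zero (mem_poleSet.1 hi).2)) (point_ne_zero c _)
  have hexp : ∀ (k : ℤ) (p p' : Vars n → ℤ), (0 < k → 0 < expo k p - expo 0 p') ∧
      (k < 0 → expo k p - expo 0 p' < 0) := by
    intro k p p'
    rw [expo_sub, sub_zero]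
    exact ⟨fun h => expo_pos h _, fun h => expo_neg_of_neg h _⟩
  have hmem : ((ev (C.comp (toSeries n)) (Function.update (fun y => C (point c y)) x
      (single (-1) 1)) R * ∏ a ∈ l.toFinset with a.1 = x.1, (1 - single (1 : ℤ) (point c a)),
      ev (toSeries n) (point c) R * numerators x l c (yVar x),
      fun i => ev (toSeries n) (Function.update (point c) x (pole c i)) R *
        numerators x l c (pole c i)) :
      HahnSeries ℤ (Series (Vars n) (BaseField I)) × Series (Vars n) (BaseField I) ×
        ((Σ _ : Vars n, BaseField I) → Series (Vars n) (BaseField I))) ∈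
      (evalMonomials x hpole0).subsemiringClosure := by
    have h := mul_mem (ev_mem_closure hbase hcx hpole0 R) (Subsemiring.prod_mem _
      (t := l.toFinset.filter fun a => a.1 = x.1)
      (f := fun a => ((1 - single (1 : ℤ) (point c a), 1 - point c a / yVar x,
        fun i => 1 - point c a / pole c i) :
        HahnSeries ℤ (Series (Vars n) (BaseField I)) × Series (Vars n) (BaseField I) ×
        ((Σ _ : Vars n, BaseField I) → Series (Vars n) (BaseField I)))) fun a ha => ?_)
    · convert h using 1
      refine Prod.ext ?_ (Prod.ext ?_ (funext fun i => ?_))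
      · rw [Prod.fst_mul, Prod.fst_prod]
      · rw [Prod.snd_mul, Prod.fst_mul, Prod.snd_prod, Prod.fst_prod]
        rfl
      · rw [Prod.snd_mul, Prod.snd_mul, Prod.snd_prod, Prod.snd_prod, Pi.mul_apply,
          Finset.prod_apply]
        rfl
    · have hal : a ∈ l := List.mem_toFinset.1 (Finset.mem_filter.1 ha).1
      have h1 : ((-single (1 : ℤ) (point c a), -(point c a / yVar x),
          fun i => -(point c a / pole c i)) :
          HahnSeries ℤ (Series (Vars n) (BaseField I)) × Series (Vars n) (BaseField I) ×
          ((Σ _ : Vars n, BaseField I) → Series (Vars n) (BaseField I))) ∈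
          (evalMonomials x hpole0).subsemiringClosure := by
        refine (Submonoid.subsemiringClosure_mem _).2 (AddSubmonoid.subset_closure
          ⟨-point c a, neg_mem ?_, -1, ?_, ?_, fun i _ => ?_⟩)
        · have := point_zpow_mem_freeOf (hc.base_ne hx hal) 1
          rwa [zpow_one] at this
        · change -single (1 : ℤ) (point c a) = _
          rw [zpow_neg_one, inv_single, neg_neg, inv_one, C_apply, single_mul_single,
            zero_add, mul_one, single_neg]
        · rw [zpow_neg_one, neg_mul, div_eq_mul_inv]
        · change -(point c a / pole c i) = _
          rw [zpow_neg_one, neg_mul, div_eq_mul_inv]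
      have h2 := add_mem (one_mem (evalMonomials x hpole0).subsemiringClosure) h1
      convert h2 using 1
      refine Prod.ext ?_ (Prod.ext ?_ (funext fun i => ?_))
      · exact sub_eq_add_neg _ _
      · exact sub_eq_add_neg _ _
      · exact sub_eq_add_neg _ _
  have key := constTerm_residues x hpole0 (fun i hi => pole_eq c hi)
    (fun i hi => by
      rw [expoAt_expo, Pi.single_eq_of_ne]
      exact (hc.base_ne hx (mem_poleSet.1 hi).1).symm)
    (pole_injOn hc.injective x l) (IsSmallPole c)
    (fun i hi h p => (hexp _ _ p).1 (by rw [poleExp, if_neg h.1, h.2]; norm_num))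
    (fun i hi h p => (hexp _ _ p).2 (by
      rw [poleExp]
      split_ifs with h1
      · omega
      · have : (c i.1).2 ≠ 0 := fun h2 => h ⟨h1, h2⟩
        omega)) hmem (A := kernelList (toSeries n) (point c) l)
    (kernelList_mem_freeOf fun a ha => hc.base_ne hx ha)
  simp only at key
  rw [ev_resMap _ _ (point_ne_zero c), prod_inv_zetaAt _ _ _ hl, mul_comm, ← mul_assoc (ev _ _ R)]
  refine key.trans ?_
  congr 2
  rw [kernelList, prod_kernelAt, point_of_eq hcx, numerators]
  have : ∏ i ∈ poleSet x l, invOrOne (1 - toSeries n i.2 * point c i.1 / yVar x) =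
      ∏ i ∈ poleSet x l, (1 - pole c i / yVar x)⁻¹ := by
    refine Finset.prod_congr rfl fun i hi => ?_
    rw [invOrOne_of_ne]
    · rfl
    · change 1 - pole c i / yVar x ≠ 0
      rw [pole_eq c hi, yVar, single_div_single]
      refine one_sub_single_ne_zero ?_ _
      intro h
      have h1 := congrArg (expoAt x) h
      rw [map_sub, expoAt_expo, expoAt_expo, Pi.single_eq_same, Pi.single_eq_of_ne, map_zero] at h1
      · norm_num at h1
      · exact (hc.base_ne hx (mem_poleSet.1 hi).1).symm
  rw [this]
  ring

open Classical in
theorem constTerm_step {x : Vars n} {l : List (Vars n)} (hl : (x :: l).Nodup) {c : Config n}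
    (hc : IsConf l c) {R : Laurent (I := I) n} (hR : WheelOn.{max u v} (x :: l) R)
    :
    constTerm (ev (toSeries n) (point c) (resMap x l R) *
        kernelList (toSeries n) (point c) l) =
      constTerm (ev (toSeries n) (point c) R * kernelList (toSeries n) (point c) (x :: l)) +
      ∑ a ∈ freeParents x l c, constTerm (ev (toSeries n) (point (attach c x a)) R *
        kernelList (toSeries n) (point (attach c x a)) (x :: l)) := by
  rw [constTerm_resMap hl hc]
  congr 1
  obtain ⟨hx, hl⟩ := List.nodup_cons.1 hl
  have hcx : c x = (x, 0) := hc.of_notMem x hx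
  have hne : ∀ a ∈ l, a ≠ x := fun a ha h => hx (h ▸ ha)
  have hpole0 : ∀ i ∈ poleSet x l, pole c i ≠ 0 := fun i hi =>
    mul_ne_zero ((map_ne_zero _).2 (pole_ne_zero (mem_poleSet.1 hi).2)) (point_ne_zero c _)
  have hsub : (freeParents x l c).image (fun a => (⟨a, (qPar I)⁻¹⟩ : Σ _ : Vars n, BaseField I)) ⊆
      (poleSet x l).filter fun i => ¬ IsSmallPole c i := by
    intro i hi
    obtain ⟨a, ha, rfl⟩ := Finset.mem_image.1 hi
    rw [mem_freeParents] at ha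
    exact Finset.mem_filter.2 ⟨mem_poleSet.2 ⟨ha.1, mem_poleWeights.2 (Or.inr ⟨ha.2.1, rfl⟩)⟩,
      fun h => h.1 rfl⟩
  rw [← Finset.sum_subset hsub, Finset.sum_image fun a _ a' _ h => congrArg Sigma.fst h]
  · refine Finset.sum_congr rfl fun a ha => ?_
    rw [mem_freeParents] at ha
    obtain ⟨hal, hcol, hfree⟩ := ha
    have hi : (⟨a, (qPar I)⁻¹⟩ : Σ _ : Vars n, BaseField I) ∈ poleSet x l :=
      mem_poleSet.2 ⟨hal, mem_poleWeights.2 (Or.inr ⟨hcol, rfl⟩)⟩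
    have hpt : point (attach c x a) =
        Function.update (point c) x (pole c ⟨a, (qPar I)⁻¹⟩) := point_attach c x a
    set α := pole c ⟨a, (qPar I)⁻¹⟩ with hα
    have e0 : kernelList (toSeries n) (Function.update (point c) x α) l =
        kernelList (toSeries n) (point c) l :=
      kernelList_congr _ fun y hy => Function.update_of_ne (hne y hy) _ _
    rw [hpt, kernelList, prod_kernelAt, Function.update_self, e0]
    have e1 : ∏ b ∈ l.toFinset with b.1 = x.1, (1 - Function.update (point c) x α b / α) =
        numerators x l c α := by
      refine Finset.prod_congr rfl fun b hb => ?_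
      rw [Function.update_of_ne (hne b (List.mem_toFinset.1 (Finset.mem_filter.1 hb).1))]
    have e2 : ∏ i ∈ poleSet x l,
        invOrOne (1 - toSeries n i.2 * Function.update (point c) x α i.1 / α) =
        ∏ i ∈ (poleSet x l).erase ⟨a, (qPar I)⁻¹⟩, (1 - pole c i / α)⁻¹ := by
      have e3 : ∀ i ∈ poleSet x l, toSeries n i.2 * Function.update (point c) x α i.1 =
          pole c i := by
        intro i hi
        rw [Function.update_of_ne (hne _ (mem_poleSet.1 hi).1)]
        rfl
      rw [← Finset.mul_prod_erase _ _ hi, e3 _ hi, ← hα, div_self (hpole0 _ hi), sub_self,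
        invOrOne_zero, one_mul]
      refine Finset.prod_congr rfl fun i' hi' => ?_
      rw [e3 _ (Finset.mem_of_mem_erase hi'), invOrOne_of_ne]
      rw [sub_ne_zero]
      intro h
      rw [eq_comm, div_eq_one_iff_eq (hpole0 _ hi)] at h
      exact Finset.ne_of_mem_erase hi' (pole_injOn hc.injective x l
        (Finset.mem_of_mem_erase hi') hi h)
    rw [e1, e2, mul_comm (kernelList _ _ _), mul_assoc (ev _ _ R), mul_assoc (ev _ _ R)]
  · intro i hi hi'
    obtain ⟨hi, hsmall⟩ := Finset.mem_filter.1 hi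
    obtain ⟨hal, hw⟩ := mem_poleSet.1 hi
    obtain ⟨a, e⟩ := i
    simp only at hal hw
    rcases mem_poleWeights.1 hw with hw | ⟨hcol, rfl⟩
    · have hdepth : (c a).2 ≠ 0 := fun h => hsmall ⟨fun h' => by
        change e = _ at h'
        subst h'
        exact inv_qPar_notMem_weights _ _ hw, h⟩
      obtain ⟨k, hk⟩ := Nat.exists_eq_succ_of_ne_zero hdepth
      obtain ⟨a', h1, h2⟩ := hc.exists_parent a k hk
      have ha'l := h2.mem_right
      have hcol : a'.1 = a.1 := by
        have e1 := hc.colour a'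
        rw [h1, hc.colour a] at e1
        exact e1.symm
      rw [hR _ (toSeries n) (Function.update (point c) x (pole c ⟨a, e⟩)) (fun y => ?_) a'
        (by simp [ha'l]) a (by simp [hal]) x (by simp) (h2.ne hl).symm (hne a hal).symm
        (hne a' ha'l).symm hcol e hw, zero_mul, zero_mul, mul_zero, map_zero]
      · rw [Function.update_of_ne (hne a' ha'l), Function.update_of_ne (hne a hal)]
        rw [point_succ (c := c) (c' := c) (x := a) (a := a') (by rw [h1, ← Nat.succ_eq_add_one, ← hk]),
          ← mul_assoc, ← map_mul, mul_inv_cancel₀ qPar_ne_zero, map_one, one_mul]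
      · rw [Function.update_self, Function.update_of_ne (hne a hal)]
        rfl
      · by_cases hy : y = x
        · rw [hy, Function.update_self]
          exact hpole0 _ hi
        · rw [Function.update_of_ne hy]
          exact point_ne_zero c y
    · have hocc : ∃ a' ∈ l, c a' = ((c a).1, (c a).2 + 1) := by
        by_contra hno
        push Not at hno
        refine hi' (Finset.mem_image.2 ⟨a, ?_, rfl⟩)
        rw [mem_freeParents]
        exact ⟨hal, hcol, hno⟩
      obtain ⟨a', ha'l, h1⟩ := hocc
      have hcol' : a'.1 = x.1 := by
        have e1 := hc.colour a'
        rw [h1, hc.colour a] at e1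
        exact e1.symm.trans hcol
      have hnum : numerators x l c (pole c ⟨a, (qPar I)⁻¹⟩) = 0 := by
        refine Finset.prod_eq_zero (i := a')
          (Finset.mem_filter.2 ⟨List.mem_toFinset.2 ha'l, hcol'⟩) ?_
        rw [point_succ h1]
        exact sub_eq_zero.2 (div_self (hpole0 _ hi)).symm
      rw [hnum, mul_zero, zero_mul, mul_zero, map_zero]

/-- The pairing as a sum over the configurations. -/
theorem constTerm_pairing {l : List (Vars n)} (hl : l.Nodup) : ∀ {R : Laurent (I := I) n},
    WheelOn.{max u v} l R → constTerm (toSeries n (pairing l R)) =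
      ∑ c ∈ confs l, constTerm (ev (toSeries n) (point c) R *
        kernelList (toSeries n) (point c) l) := by
  classical
  induction l with
  | nil =>
    intro R _
    rw [confs, Finset.sum_singleton, kernelList, mul_one]
    refine DFunLike.congr_fun (f := constTerm.comp ((toSeries n).toAddMonoidHom.comp (pairing [])))
      (g := constTerm.comp (ev (toSeries n) (point fun x => (x, 0))))
      (Finsupp.addHom_ext fun p r => ?_) R
    change constTerm (toSeries n (Finsupp.single p r 0)) =
      constTerm (ev (toSeries n) (point fun x => (x, 0)) (Finsupp.single p r))
    rw [ev_single]
    by_cases hp : p = 0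
    · subst hp
      simp
    · obtain ⟨x, hx⟩ := Function.ne_iff.1 hp
      rw [Finsupp.single_eq_of_ne (Ne.symm hp), map_zero, map_zero,
        ← Finset.prod_erase_mul _ _ (Finset.mem_univ x), ← mul_assoc]
      rw [point_of_eq rfl, constTerm_mul_yVar_zpow _ hx]
      exact mul_mem (toSeries_mem_freeOf x r) (Subring.prod_mem _ fun y hy =>
        point_zpow_mem_freeOf (Finset.ne_of_mem_erase hy) _)
  | cons x l ih =>
    intro R hR
    obtain ⟨hx, hl'⟩ := List.nodup_cons.1 hl
    change constTerm (toSeries n (pairing l (resMap x l R))) = _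
    rw [ih hl' (hR.resMap hx), sum_confs_cons hl]
    exact Finset.sum_congr rfl fun c hc => constTerm_step hl ((mem_confs hl').1 hc) hR

end step

end QuiverShuffle
end

noncomputable section
namespace QuiverShuffle

/-! ### The pairing respects the relations between the terms of shuffle products -/

section relation

open HahnSeries

universe u v

variable {I : Type u} [Quiver.{v} I] [Fintype I] [∀ i j : I, Fintype (i ⟶ j)] {n : I → ℕ}

theorem kernelAt_mul_zetaAt {L : Type*} [Field L] (ι : BaseField I →+* L) (w : Vars n → L)
    {x a : Vars n} (h1 : x.1 = a.1 → w x / w a ≠ 1)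
    (h2 : ∀ e ∈ poleWeights x.1 a.1, 1 - ι e * w x / w a ≠ 0) :
    kernelAt ι w x a * zetaAt ι x.1 a.1 (w x / w a) = 1 := by
  classical
  have h3 : ∏ e ∈ poleWeights x.1 a.1, invOrOne (1 - ι e * w x / w a) =
      ∏ e ∈ poleWeights x.1 a.1, (1 - ι e * w x / w a)⁻¹ :=
    Finset.prod_congr rfl fun e he => invOrOne_of_ne (h2 e he)
  have h4 : ∏ e ∈ poleWeights x.1 a.1, (1 - ι e * w x / w a) ≠ 0 := Finset.prod_ne_zero_iff.2 h2
  have h5 : zetaAt ι x.1 a.1 (w x / w a) = (if x.1 = a.1 then 1 - w x / w a else 1)⁻¹ *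
      ∏ e ∈ poleWeights x.1 a.1, (1 - ι e * w x / w a) := by
    rw [zetaAt, prod_poleWeights, ← mul_assoc]
    simp only [mul_div_assoc]
    congr 1
    split_ifs with h
    · rw [map_inv₀, mul_comm (w x / w a), div_eq_mul_inv _ (1 - w x / w a), mul_comm]
    · simp
  have h6 : (if x.1 = a.1 then 1 - w x / w a else 1) ≠ 0 := by
    split_ifs with h
    · exact sub_ne_zero.2 (h1 h).symm
    · exact one_ne_zero
  rw [kernelAt, h3, h5, Finset.prod_inv_distrib, mul_mul_mul_comm, mul_inv_cancel₀ h6,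
    inv_mul_cancel₀ h4, one_mul]

theorem point_injective {c : Config n} (hc : Function.Injective c) :
    Function.Injective (point c : Vars n → Series (Vars n) (BaseField I)) := by
  classical
  intro x y h
  obtain ⟨h1, -⟩ := single_inj (pow_ne_zero _ (inv_ne_zero qPar_ne_zero)) h
  obtain ⟨h2, h3⟩ := expo_base_inj h1
  exact hc (Prod.ext h3 (by omega))

open Classical in
/-- The product of the kernels for all ordered pairs of variables. -/
def kernelAll {L : Type*} [Field L] (ι : BaseField I →+* L) (w : Vars n → L) : L :=
  ∏ x, ∏ a, if x ≠ a then kernelAt ι w a x else 1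

open Classical in
theorem kernelList_eq_prod {L : Type*} [Field L] (ι : BaseField I →+* L) (w : Vars n → L)
    {l : List (Vars n)} (hl : l.Nodup) :
    kernelList ι w l = ∏ x, ∏ a, if Before l x a then kernelAt ι w a x else 1 := by
  induction l with
  | nil => simp [kernelList, Before]
  | cons x l ih =>
    obtain ⟨-, hl'⟩ := List.nodup_cons.1 hl
    rw [prod_before_cons hl fun x a => kernelAt ι w a x, kernelList, ih hl',
      List.prod_toFinset _ hl']

theorem kernelList_eq_of_isConf {l : List (Vars n)} (hl : l.Nodup) (hl' : ∀ x, x ∈ l)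
    {c : Config n} (hc : IsConf l c) :
    kernelList (toSeries n) (point c) l =
      kernelAll (toSeries n) (point c) * zetaList (toSeries n) (point c) l := by
  classical
  have h1 : ∀ x a, Before l x a →
      kernelAt (toSeries n) (point c) x a *
        zetaAt (toSeries n) x.1 a.1 (point c x / point c a) = 1 := by
    intro x a hxa
    refine kernelAt_mul_zetaAt _ _ (fun _ h => ?_) fun e he h => ?_
    · rw [div_eq_one_iff_eq (point_ne_zero c a)] at h
      exact hxa.ne hl (point_injective hc.injective h)
    · rw [sub_eq_zero, eq_comm, div_eq_one_iff_eq (point_ne_zero c a), toSeries_pole he, point,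
        point, single_mul_single, expo_add, zero_add] at h
      obtain ⟨h2, -⟩ := single_inj (mul_ne_zero (pole_ne_zero he)
        (pow_ne_zero _ (inv_ne_zero qPar_ne_zero))) h
      obtain ⟨h3, h4⟩ := expo_base_inj h2
      rw [poleExp] at h3
      split_ifs at h3
      · obtain ⟨b, h5, h6⟩ := hc.exists_parent a (c x).2 (by omega)
        have : b = x := hc.injective (h5.trans (Prod.ext h4.symm rfl))
        subst this
        exact hxa.asymm hl h6
      · omega
  have h2 : kernelAll (toSeries n) (point c) =
      (∏ x, ∏ a, if Before l x a then kernelAt (toSeries n) (point c) a x else 1) *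
      ∏ x, ∏ a, if Before l x a then kernelAt (toSeries n) (point c) x a else 1 := by
    rw [Finset.prod_comm (f := fun x a => if Before l x a then
      kernelAt (toSeries n) (point c) x a else 1), ← Finset.prod_mul_distrib, kernelAll]
    refine Finset.prod_congr rfl fun x _ => ?_
    rw [← Finset.prod_mul_distrib]
    refine Finset.prod_congr rfl fun a _ => ?_
    by_cases hxa : x = a
    · subst hxa
      have : ¬ Before l x x := fun h => h.ne hl rfl
      simp [this]
    · rcases before_total (hl' x) (hl' a) hxa with h | h
      · simp [hxa, h, fun h' => h.asymm hl h']
      · simp [hxa, h, fun h' => h.asymm hl h']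
  rw [h2, kernelList_eq_prod _ _ hl, zetaList_eq_prod _ _ hl, mul_assoc]
  conv_lhs => rw [← mul_one (∏ x, _)]
  congr 1
  rw [← Finset.prod_mul_distrib, Finset.prod_eq_one]
  intro x _
  rw [← Finset.prod_mul_distrib, Finset.prod_eq_one]
  intro a _
  split_ifs with h
  · exact h1 x a h
  · exact one_mul _

theorem zetaList_eq_zero_of_not_isConf {l l' : List (Vars n)} (hl : l.Nodup) (hl' : ∀ x, x ∈ l)
    (hn' : l'.Nodup) {c : Config n} (hc : IsConf l' c) (hc' : ¬ IsConf l c) :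
    zetaList (toSeries n) (point c) l = 0 := by
  have : ∃ a k, (c a).2 = k + 1 ∧ ∀ b, c b = ((c a).1, k) → ¬ Before l a b := by
    by_contra! hno
    exact hc' ⟨hc.injective, hc.colour, fun x hx => absurd (hl' x) hx, hc.of_depth_eq_zero,
      fun x k hk => hno x k hk⟩
  obtain ⟨a, k, hk, h⟩ := this
  obtain ⟨b, h1, h2⟩ := hc.exists_parent a k hk
  have h3 : Before l b a := (before_total (hl' b) (hl' a) (h2.ne hn').symm).resolve_right (h b h1)
  refine zetaList_eq_zero _ _ hl h3 ?_
  have hcol : b.1 = a.1 := by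
    have e1 := hc.colour b
    rw [h1, hc.colour a] at e1
    exact e1.symm
  have hpt : point c a = toSeries n (qPar I)⁻¹ * point c b :=
    point_succ (by rw [h1, ← hk])
  rw [hcol, hpt, map_inv₀, div_mul_cancel_right₀ (point_ne_zero c b), inv_inv, zetaAt_q]

/-- A relation between the terms of shuffle products gives a relation between pairings. -/
theorem sum_pairing_eq_zero {ι' : Type*} (s : Finset ι') (l : ι' → List (Vars n))
    (hl : ∀ i ∈ s, (l i).Nodup) (hl' : ∀ i ∈ s, ∀ x, x ∈ l i) (d : ι' → Vars n → ℤ)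
    (r : ι' → BaseField I) (S : ι' → Laurent (I := I) n)
    (ρ : (Vars n → Series (Vars n) (BaseField I)) → Series (Vars n) (BaseField I))
    (hS : ∀ i ∈ s, ∀ w : Vars n → Series (Vars n) (BaseField I), (∀ x, w x ≠ 0) →
      ev (toSeries n) w (S i) = toSeries n (r i) * (∏ x, w x ^ d i x) * ρ w)
    (hwheel : ∀ i ∈ s, WheelOn.{max u v} (l i) (S i))
    (hrel : ∑ i ∈ s, const n (r i) * wordTerm (l i) (d i) = 0) :
    ∑ i ∈ s, pairing (l i) (S i) = 0 := by
  classical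
  have hinj : ∀ z : BaseField I, constTerm (toSeries n z) = 0 → z = 0 := by
    intro z hz
    have h1 : gradSeries I z = 0 := by
      ext k
      have := congrFun hz k
      rwa [toSeries, RingHom.comp_apply, constTerm_inclSeries] at this
    exact (map_eq_zero _).1 h1
  apply hinj
  set T := s.biUnion fun i => confs (l i) with hT
  have hTmem : ∀ c ∈ T, ∃ l' : List (Vars n), l'.Nodup ∧ IsConf l' c := by
    intro c hc
    obtain ⟨i, hi, hc⟩ := Finset.mem_biUnion.1 hc
    exact ⟨l i, hl i hi, (mem_confs (hl i hi)).1 hc⟩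
  have h1 : ∀ i ∈ s, constTerm (toSeries n (pairing (l i) (S i))) =
      ∑ c ∈ T, constTerm (ρ (point c) * kernelAll (toSeries n) (point c) *
        (toSeries n (r i) * ((∏ x, point c x ^ d i x) * zetaList (toSeries n) (point c) (l i)))) := by
    intro i hi
    rw [constTerm_pairing (hl i hi) (hwheel i hi)]
    refine (Finset.sum_congr rfl fun c hc => ?_).trans
      (Finset.sum_subset (Finset.subset_biUnion_of_mem (fun i => confs (l i)) hi) fun c hc hc' => ?_)
    · rw [hS i hi _ (point_ne_zero c), kernelList_eq_of_isConf (hl i hi) (hl' i hi)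
        ((mem_confs (hl i hi)).1 hc)]
      congr 1
      ring
    · obtain ⟨l', hn', hc⟩ := hTmem c hc
      rw [zetaList_eq_zero_of_not_isConf (hl i hi) (hl' i hi) hn' hc
        fun h => hc' ((mem_confs (hl i hi)).2 h), mul_zero, mul_zero, mul_zero, map_zero]
  rw [map_sum, map_sum, Finset.sum_congr rfl h1, Finset.sum_comm]
  refine Finset.sum_eq_zero fun c hc => ?_
  obtain ⟨l', -, hc⟩ := hTmem c hc
  rw [← map_sum, ← Finset.mul_sum]
  have h2 : EvalsTo (MvPolynomial.eval₂Hom (toSeries n) (point c))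
      (∑ i ∈ s, const n (r i) * wordTerm (l i) (d i))
      (∑ i ∈ s, toSeries n (r i) *
        ((∏ x, point c x ^ d i x) * zetaList (toSeries n) (point c) (l i))) :=
    EvalsTo.sum _ fun i hi => (evalsTo_const _ _ _).mul (evalsTo_wordTerm _ (point_ne_zero c)
      (fun x y hxy _ h => hxy (point_injective hc.injective h)) (hl i hi) _)
  rw [hrel] at h2
  rw [h2.eq_zero, mul_zero, map_zero]

end relation

end QuiverShuffle
end

noncomputable section
namespace QuiverShuffle

/-! ### Words and lists of variables -/

section labelling

variable {I : Type*} {n : I → ℕ}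

/-- The word obtained by reading the exponents `d` along the list `l` of all variables is `w`. -/
structure IsLabelling (w : Word I) (l : List (Vars n)) (d : Vars n → ℤ) : Prop where
  nodup : l.Nodup
  mem : ∀ x, x ∈ l
  map_eq : l.map (fun x => (x.1, d x)) = w

theorem exists_permVars (τ : Equiv.Perm (Vars n)) (hτ : ∀ x, (τ x).1 = x.1) :
    ∃ s : ∀ i, Equiv.Perm (Fin (n i)), ∀ x, permVars s x = τ x := by
  have h : ∀ i (a : Fin (n i)), ∃ b, τ ⟨i, a⟩ = ⟨i, b⟩ := by
    intro i a
    have h1 := hτ ⟨i, a⟩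
    rcases h2 : τ ⟨i, a⟩ with ⟨j, b⟩
    rw [h2] at h1
    obtain rfl : j = i := h1
    exact ⟨b, rfl⟩
  choose f hf using h
  have hinj : ∀ i, Function.Injective (f i) := by
    intro i a b hab
    have h1 : τ ⟨i, a⟩ = τ ⟨i, b⟩ := by rw [hf, hf, hab]
    simpa using τ.injective h1
  refine ⟨fun i => Equiv.ofBijective (f i) (Finite.injective_iff_bijective.1 (hinj i)), ?_⟩
  rintro ⟨i, a⟩
  rw [permVars_apply, hf]
  rfl

theorem IsLabelling.exists_perm {w : Word I} {l l' : List (Vars n)} {d d' : Vars n → ℤ}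
    (h : IsLabelling w l d) (h' : IsLabelling w l' d') :
    ∃ s : ∀ i, Equiv.Perm (Fin (n i)), d' = d ∘ permVars s ∧ l = l'.map (permVars s) := by
  classical
  have hlen : l'.length = l.length := by
    have := congrArg List.length (h'.map_eq.trans h.map_eq.symm)
    simpa using this
  set e := h.nodup.getEquivOfForallMemList l h.mem with he
  set e' := h'.nodup.getEquivOfForallMemList l' h'.mem with he'
  have hget : ∀ k : Fin l'.length, ((e' k).1, d' (e' k)) =
      ((e (Fin.cast hlen k)).1, d (e (Fin.cast hlen k))) := by
    intro k
    have h1 : (l'.map fun x => (x.1, d' x))[k.1]? = (l.map fun x => (x.1, d x))[k.1]? := by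
      rw [h'.map_eq, h.map_eq]
    have hk : k.1 < l.length := hlen ▸ k.2
    rw [List.getElem?_map, List.getElem?_map, List.getElem?_eq_getElem k.2,
      List.getElem?_eq_getElem hk] at h1
    exact Option.some.inj h1
  obtain ⟨s, hs⟩ := exists_permVars ((e'.symm.trans (finCongr hlen)).trans e) (by
    intro x
    have := congrArg Prod.fst (hget (e'.symm x))
    simp only [Equiv.apply_symm_apply] at this
    simpa using this.symm)
  refine ⟨s, ?_, ?_⟩
  · funext x
    have := congrArg Prod.snd (hget (e'.symm x))
    simp only [Equiv.apply_symm_apply] at this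
    rw [Function.comp_apply, hs]
    simpa using this
  · refine List.ext_getElem (by simp [hlen]) fun k hk hk' => ?_
    rw [List.getElem_map, hs]
    have hk2 : k < l'.length := by omega
    have : l'[k] = e' ⟨k, hk2⟩ := rfl
    rw [this]
    simp only [Equiv.trans_apply, Equiv.symm_apply_apply]
    rfl

theorem wordDim_apply [DecidableEq I] (w : Word I) (i : I) :
    wordDim w i = (w.map Prod.fst).count i := by
  induction w with
  | nil => rfl
  | cons a w ih =>
    rw [wordDim, Pi.add_apply, ih, List.map_cons, List.count_cons, add_comm]
    congr 1
    by_cases h : a.1 = i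
    · subst h; simp
    · simp [h, Ne.symm h]

theorem IsLabelling.wordDim_eq {w : Word I} {l : List (Vars n)} {d : Vars n → ℤ}
    (h : IsLabelling w l d) : wordDim w = n := by
  classical
  funext i
  rw [wordDim_apply, ← h.map_eq, List.map_map, List.count_eq_countP, List.countP_map,
    List.countP_eq_length_filter]
  rw [← List.toFinset_card_of_nodup (h.nodup.filter _)]
  have e : (List.filter ((fun x => x == i) ∘ Prod.fst ∘ fun x : Vars n => (x.1, d x)) l).toFinset =
      (Finset.univ : Finset (Fin (n i))).map ⟨fun a => (⟨i, a⟩ : Vars n), fun a b hab => by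
        simpa using hab⟩ := by
    ext ⟨j, b⟩
    simp only [List.mem_toFinset, List.mem_filter, h.mem, true_and, Finset.mem_map,
      Finset.mem_univ, Function.comp_apply, beq_iff_eq]
    constructor
    · rintro rfl
      exact ⟨b, rfl⟩
    · rintro ⟨a, ha⟩
      exact (congrArg Sigma.fst ha).symm
  rw [e, Finset.card_map, Finset.card_univ, Fintype.card_fin]

theorem isLabelling_wordVars (w : Word I) : IsLabelling w (wordVars w) (wordExp w) :=
  ⟨wordVars_nodup w, mem_wordVars w, map_wordVars w⟩

theorem IsLabelling.map {w : Word I} {l : List (Vars n)} {d : Vars n → ℤ}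
    (h : IsLabelling w l d) (s : ∀ i, Equiv.Perm (Fin (n i))) :
    IsLabelling w (l.map (permVars s)) (d ∘ (permVars s).symm) := by
  refine ⟨h.nodup.map (permVars s).injective,
    fun x => List.mem_map.2 ⟨(permVars s).symm x, h.mem _, by simp⟩, ?_⟩
  rw [List.map_map, ← h.map_eq]
  refine List.map_congr_left fun x _ => Prod.ext rfl ?_
  change d ((permVars s).symm (permVars s x)) = d x
  rw [Equiv.symm_apply_apply]

variable [Quiver I] [Fintype I]

theorem exists_isLabelling [∀ i j : I, Fintype (i ⟶ j)] {w : Word I} (hw : wordDim w = n) :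
    ∃ (l : List (Vars n)) (d : Vars n → ℤ), IsLabelling w l d ∧
      wordElt w n = sym (wordTerm l d) ∧
      ∀ P : ∀ m : I → ℕ, Laurent (I := I) m, P (wordDim w) (wordExp w) = P n d := by
  subst hw
  refine ⟨wordVars w, wordExp w, isLabelling_wordVars w, ?_, fun P => rfl⟩
  rw [wordElt, DirectSum.of_eq_same, wordRat_eq_sym]

theorem wordElt_apply_of_ne [∀ i j : I, Fintype (i ⟶ j)] {w : Word I} (hw : wordDim w ≠ n) :
    wordElt w n = 0 := by
  rw [wordElt, DirectSum.of_eq_of_ne _ _ _ hw.symm]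

theorem IsLabelling.coeff_eq {w : Word I} {l l' : List (Vars n)} {d d' : Vars n → ℤ}
    (h : IsLabelling w l d) (h' : IsLabelling w l' d') {P : Laurent (I := I) n}
    (hP : P.IsSymmetric) : P d' = P d := by
  obtain ⟨s, rfl, -⟩ := h.exists_perm h'
  exact hP s d

end labelling

section order

variable {I : Type*} [LinearOrder I]

theorem letterLT_trans {x y z : I × ℤ} (h : letterLT x y) (h' : letterLT y z) : letterLT x z := by
  unfold letterLT at *
  rcases h with h | ⟨h, h1⟩ <;> rcases h' with h' | ⟨h', h1'⟩
  · exact Or.inl (h'.trans h)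
  · exact Or.inl (h' ▸ h)
  · exact Or.inl (h ▸ h')
  · exact Or.inr ⟨h.trans h', h1.trans h1'⟩

theorem wordLT_trans {v w z : Word I} (h : wordLT v w) (h' : wordLT w z) : wordLT v z :=
  List.lex_trans (fun h h' => letterLT_trans h h') h h'

theorem wordLT_of_lexPos {n : I → ℕ} {l : List (Vars n)} (d : Vars n → ℤ) {e : Vars n → ℤ}
    (he : LexPos l e) :
    wordLT (l.map fun x => (x.1, d x)) (l.map fun x => (x.1, (d - e) x)) := by
  induction l with
  | nil => exact he.elim
  | cons x l ih =>
    rw [List.map_cons, List.map_cons]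
    rcases he with he | ⟨h0, he⟩
    · exact List.Lex.rel (Or.inl (by simpa using he))
    · rw [Pi.sub_apply, h0, sub_zero]
      exact List.Lex.cons (ih he)

end order

/-! ### Leading words are standard -/

section leading

universe u v

variable {I : Type u} [Quiver.{v} I] [Fintype I] {n : I → ℕ}

/-- The Laurent polynomial `r z^d P(z⁻¹)`, with the involution applied to the coefficients. -/
def reflect (r : BaseField I) (d : Vars n → ℤ) : Laurent (I := I) n →+ Laurent (I := I) n :=
  Finsupp.liftAddHom fun p => (Finsupp.singleAddHom (d - p)).comp
    ((AddMonoidHom.mulLeft r).comp (invol I).toAddMonoidHom)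

theorem reflect_single (r : BaseField I) (d p : Vars n → ℤ) (c : BaseField I) :
    reflect r d (Finsupp.single p c) = Finsupp.single (d - p) (r * invol I c) := by
  rw [reflect, Finsupp.liftAddHom_apply_single]
  rfl

theorem reflect_apply (r : BaseField I) (d : Vars n → ℤ) (P : Laurent (I := I) n)
    (e : Vars n → ℤ) : reflect r d P e = r * invol I (P (d - e)) := by
  classical
  refine DFunLike.congr_fun (f := (Finsupp.applyAddHom e).comp (reflect r d))
    (g := (AddMonoidHom.mulLeft r).comp ((invol I).toAddMonoidHom.comp
      (Finsupp.applyAddHom (d - e)))) (Finsupp.addHom_ext fun p c => ?_) P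
  change reflect r d (Finsupp.single p c) e = r * invol I (Finsupp.single p c (d - e))
  rw [reflect_single, Finsupp.single_apply, Finsupp.single_apply]
  by_cases h : p = d - e
  · rw [if_pos h, if_pos (by rw [h, sub_sub_cancel])]
  · rw [if_neg h, if_neg (fun h' => h (by rw [← h', sub_sub_cancel])), map_zero, mul_zero]

theorem ev_reflect {L : Type*} [Field L] (ι : BaseField I →+* L) {w : Vars n → L}
    (hw : ∀ x, w x ≠ 0) (r : BaseField I) (d : Vars n → ℤ) (P : Laurent (I := I) n) :
    ev ι w (reflect r d P) =
      ι r * (∏ x, w x ^ d x) * ev (ι.comp (invol I)) (fun x => (w x)⁻¹) P := by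
  refine DFunLike.congr_fun (f := (ev ι w).comp (reflect r d))
    (g := (AddMonoidHom.mulLeft (ι r * ∏ x, w x ^ d x)).comp
      (ev (ι.comp (invol I)) fun x => (w x)⁻¹)) (Finsupp.addHom_ext fun p c => ?_) P
  change ev ι w (reflect r d (Finsupp.single p c)) =
    ι r * (∏ x, w x ^ d x) * ev (ι.comp (invol I)) (fun x => (w x)⁻¹) (Finsupp.single p c)
  rw [reflect_single, ev_single, ev_single, map_mul]
  have : ∏ x, w x ^ (d - p) x = (∏ x, w x ^ d x) * ∏ x, (w x)⁻¹ ^ p x := by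
    rw [← Finset.prod_mul_distrib]
    exact Finset.prod_congr rfl fun x _ => by
      rw [Pi.sub_apply, zpow_sub₀ (hw x), inv_zpow, div_eq_mul_inv]
  rw [this, RingHom.comp_apply]
  ring

variable [∀ i j : I, Fintype (i ⟶ j)]

theorem wheelOn_reflect {P : Laurent (I := I) n} (hP : P.Wheel) (l : List (Vars n))
    (r : BaseField I) (d : Vars n → ℤ) : WheelOn.{max u v} l (reflect r d P) := by
  intro L _ ι w hw a' _ a _ x _ h1 h2 h3 hcol c hc e1 e2
  rw [ev_reflect ι hw]
  have hq : ι (qPar I) ≠ 0 := (map_ne_zero ι).2 qPar_ne_zero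
  have hc0 : ι c ≠ 0 := (map_ne_zero ι).2 (weights_ne_zero hc)
  rw [ev_eq_zero_of_wheel hP (ι.comp (invol I)) (u := fun x => (w x)⁻¹) (a' := a) (a := a')
    (x := x) (fun x => inv_ne_zero (hw x)) h1.symm h3 h2 hcol.symm (c := c) (by rwa [hcol]),
    mul_zero]
  · rw [RingHom.comp_apply, invol_qPar, e1, mul_inv, mul_inv_cancel_left₀ hq]
  · rw [RingHom.comp_apply, invol_weight I hc, e1, e2, map_div₀, mul_inv, mul_inv]
    field_simp

/-- A linear relation between elements of words gives a relation between pairings. -/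
theorem sum_pairing_reflect_eq_zero {P : Laurent (I := I) n} (hP : P.Wheel) {ι' : Type*}
    (T : Finset ι') (w : ι' → Word I) (l : ι' → List (Vars n)) (d : ι' → Vars n → ℤ)
    (h : ∀ t ∈ T, IsLabelling (w t) (l t) (d t)) (r : ι' → BaseField I)
    (hrel : ∑ t ∈ T, const n (r t) * sym (wordTerm (l t) (d t)) = 0)
    [Fintype (∀ i, Equiv.Perm (Fin (n i)))] :
    ∑ t ∈ T, ∑ s : ∀ i, Equiv.Perm (Fin (n i)), pairing ((l t).map (permVars s))
      (reflect (r t) (d t ∘ (permVars s).symm) P) = 0 := by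
  rw [← Finset.sum_product']
  refine sum_pairing_eq_zero _ (fun i => (l i.1).map (permVars i.2))
    (fun i hi => ((h i.1 (Finset.mem_product.1 hi).1).map i.2).nodup)
    (fun i hi => ((h i.1 (Finset.mem_product.1 hi).1).map i.2).mem)
    (fun i => d i.1 ∘ (permVars i.2).symm) (fun i => r i.1) _
    (fun w => ev ((toSeries n).comp (invol I)) (fun x => (w x)⁻¹) P)
    (fun i _ w hw => ev_reflect _ hw _ _ _) (fun i _ => wheelOn_reflect hP _ _ _) ?_
  rw [Finset.sum_product, ← hrel]
  refine Finset.sum_congr rfl fun t _ => ?_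
  rw [sym_wordTerm, Finset.mul_sum]
  exact Finset.sum_congr (by congr!) fun _ _ => rfl

theorem pairing_reflect [LinearOrder I] {P : Laurent (I := I) n} {v w : Word I}
    (hlead : ∀ (w : Word I) (l : List (Vars n)) (d : Vars n → ℤ), IsLabelling w l d →
      wordLT v w → P d = 0) {l : List (Vars n)} {d : Vars n → ℤ} (h : IsLabelling w l d)
    (hvw : v = w ∨ wordLT v w) (r : BaseField I) :
    pairing l (reflect r d P) = r * invol I (P d) := by
  rw [pairing_eq_of_lexPos, reflect_apply, sub_zero]
  intro e he
  rw [reflect_apply, hlead _ l (d - e) ⟨h.nodup, h.mem, rfl⟩, map_zero, mul_zero]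
  have h1 := wordLT_of_lexPos d he
  rw [h.map_eq] at h1
  rcases hvw with rfl | hvw
  · exact h1
  · exact wordLT_trans hvw h1

open Classical in
theorem isStandard_of_leading [LinearOrder I] {P : Laurent (I := I) n} (hP : P ∈ wheelLaurent n)
    {v : Word I} {l : List (Vars n)} {d : Vars n → ℤ} (hv : IsLabelling v l d) (h0 : P d ≠ 0)
    (hlead : ∀ (w : Word I) (l : List (Vars n)) (d : Vars n → ℤ), IsLabelling w l d →
      wordLT v w → P d = 0) : IsStandard v := by
  intro hmem
  obtain ⟨c, hc, hsum⟩ := (Finsupp.mem_span_image_iff_linearCombination _).1 hmem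
  have hex : ∀ w : Word I, ∃ (l : List (Vars n)) (d : Vars n → ℤ), wordDim w = n →
      IsLabelling w l d ∧ wordElt w n = sym (wordTerm l d) := by
    intro w
    by_cases hw : wordDim w = n
    · obtain ⟨l, d, h1, h2, -⟩ := exists_isLabelling hw
      exact ⟨l, d, fun _ => ⟨h1, h2⟩⟩
    · exact ⟨[], 0, fun h => absurd h hw⟩
  choose L D hLD using hex
  have hvn := hv.wordDim_eq
  set T := c.support.filter fun w => wordDim w = n with hT
  have hTv : ∀ w ∈ T, wordLT v w ∧ wordDim w = n := fun w hw =>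
    ⟨hc (Finset.mem_filter.1 hw).1, (Finset.mem_filter.1 hw).2⟩
  have hcomp : ∑ w ∈ T, const n (c w) * sym (wordTerm (L w) (D w)) =
      sym (wordTerm (L v) (D v)) := by
    have h1 := congrArg (DirectSum.component (BaseField I) (I → ℕ)
      (fun m => RatFun (I := I) m) n) hsum
    rw [Finsupp.linearCombination_apply, Finsupp.sum, map_sum] at h1
    rw [← (hLD v hvn).2]
    refine Eq.trans ?_ h1
    rw [hT, Finset.sum_filter]
    refine Finset.sum_congr rfl fun w _ => ?_
    rw [map_smul]
    change _ = c w • wordElt w n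
    split_ifs with h
    · rw [(hLD w h).2, Algebra.smul_def]
      rfl
    · rw [wordElt_apply_of_ne h, smul_zero]
  have key := sum_pairing_reflect_eq_zero hP.2 (Finset.insertNone T)
    (fun o => o.elim v id) (fun o => L (o.elim v id)) (fun o => D (o.elim v id))
    (fun o ho => (hLD _ (by
      rcases o with - | w
      · exact hvn
      · exact (hTv w (Finset.some_mem_insertNone.1 ho)).2)).1)
    (fun o => o.elim (-1) c) (by
      rw [Finset.sum_insertNone]
      simp only [Option.elim_none, Option.elim_some, id]
      rw [hcomp, const, map_neg, map_one]
      ring)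
  rw [Finset.sum_insertNone] at key
  simp only [Option.elim_none, Option.elim_some, id] at key
  rw [Finset.sum_eq_zero (s := T), add_zero] at key
  · have h1 : ∀ s : ∀ i, Equiv.Perm (Fin (n i)), pairing ((L v).map (permVars s))
        (reflect (-1) (D v ∘ (permVars s).symm) P) = -invol I (P d) := by
      intro s
      have h2 := (hLD v hvn).1.map s
      rw [pairing_reflect hlead h2 (Or.inl rfl), hv.coeff_eq h2 hP.1]
      ring
    rw [Finset.sum_congr rfl fun s _ => h1 s, Finset.sum_const, nsmul_eq_mul, mul_neg,
      neg_eq_zero] at key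
    rcases mul_eq_zero.1 key with h | h
    · rw [Nat.cast_eq_zero, Finset.card_eq_zero] at h
      exact Finset.univ_nonempty.ne_empty h
    · exact h0 ((map_eq_zero _).1 h)
  · intro w hw
    obtain ⟨hvw, hwn⟩ := hTv w hw
    refine Finset.sum_eq_zero fun s _ => ?_
    have h2 := (hLD w hwn).1.map s
    rw [pairing_reflect hlead h2 (Or.inr hvw), hlead _ _ _ h2 hvw, map_zero, mul_zero]

end leading

end QuiverShuffle
end

noncomputable section
namespace QuiverShuffle

/-! ### Standard words are leading -/

section minimal

variable {I : Type*} [LinearOrder I]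

theorem letterLT_trichotomy (x y : I × ℤ) : letterLT x y ∨ x = y ∨ letterLT y x := by
  unfold letterLT
  rcases lt_trichotomy x.2 y.2 with h | h | h
  · exact Or.inr (Or.inr (Or.inl h))
  · rcases lt_trichotomy x.1 y.1 with h' | h' | h'
    · exact Or.inl (Or.inr ⟨h, h'⟩)
    · exact Or.inr (Or.inl (Prod.ext h' h))
    · exact Or.inr (Or.inr (Or.inr ⟨h.symm, h'⟩))
  · exact Or.inl (Or.inl h)

theorem wordLT_trichotomy (v : Word I) : ∀ w : Word I, wordLT v w ∨ v = w ∨ wordLT w v := by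
  induction v with
  | nil =>
    intro w
    cases w with
    | nil => exact Or.inr (Or.inl rfl)
    | cons y w => exact Or.inl List.Lex.nil
  | cons x v ih =>
    intro w
    cases w with
    | nil => exact Or.inr (Or.inr List.Lex.nil)
    | cons y w =>
      rcases letterLT_trichotomy x y with h | rfl | h
      · exact Or.inl (List.Lex.rel h)
      · rcases ih w with h | rfl | h
        · exact Or.inl (List.Lex.cons h)
        · exact Or.inr (Or.inl rfl)
        · exact Or.inr (Or.inr (List.Lex.cons h))
      · exact Or.inr (Or.inr (List.Lex.rel h))

theorem wordLT_irrefl (v : Word I) : ¬ wordLT v v := by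
  induction v with
  | nil => exact fun h => nomatch h
  | cons x v ih =>
    intro h
    cases h with
    | cons h => exact ih h
    | rel h =>
      rcases h with h | h
      · exact lt_irrefl _ h
      · exact lt_irrefl _ h.2

instance : IsStrictOrder (Word I) wordLT where
  irrefl := wordLT_irrefl
  trans _ _ _ := wordLT_trans

theorem _root_.Set.Finite.exists_not_rel {α : Type*} (r : α → α → Prop) [IsStrictOrder α r]
    {s : Set α} (hfin : s.Finite) (hs : s.Nonempty) : ∃ m ∈ s, ∀ w ∈ s, ¬ r w m := by
  obtain ⟨x, hx⟩ := hs
  obtain ⟨⟨m, hm⟩, -, h⟩ := (hfin.wellFoundedOn (r := r)).has_min Set.univ ⟨⟨x, hx⟩, trivial⟩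
  exact ⟨m, hm, fun w hw => h ⟨w, hw⟩ trivial⟩

theorem exists_min_word {s : Finset (Word I)} (hs : s.Nonempty) :
    ∃ m ∈ s, ∀ w ∈ s, w = m ∨ wordLT m w := by
  obtain ⟨m, hm, h⟩ := s.finite_toSet.exists_not_rel wordLT hs
  refine ⟨m, hm, fun w hw => ?_⟩
  rcases wordLT_trichotomy w m with h1 | h1 | h1
  · exact absurd h1 (h w hw)
  · exact Or.inl h1
  · exact Or.inr h1

end minimal

section counting

variable {I : Type*} [Quiver I] [Fintype I] [∀ i j : I, Fintype (i ⟶ j)] [LinearOrder I]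
  {n : I → ℕ}

/-- The word `w` is the leading word of the Laurent polynomial `P`. -/
def LeadsAt (P : Laurent (I := I) n) (w : Word I) : Prop :=
  (∃ (l : List (Vars n)) (d : Vars n → ℤ), IsLabelling w l d ∧ P d ≠ 0) ∧
    ∀ (w' : Word I) (l : List (Vars n)) (d : Vars n → ℤ), IsLabelling w' l d →
      wordLT w w' → P d = 0

open Classical in
/-- If the leading words of a space spanned by the elements of a finite set of words belong to this
set, then the standard words in the set are leading words. -/
theorem exists_leadsAt_of_isStandard (A : Finset (Word I)) (Q : Word I → Laurent (I := I) n)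
    (hQ : ∀ w ∈ A, Q w ∈ wheelLaurent n) (hdim : ∀ w ∈ A, wordDim w = n)
    (hQw : ∀ w ∈ A, wordElt w n = Laurent.toRat n (Q w))
    (H : ∀ P ∈ Submodule.span (BaseField I) (Q '' (A : Set (Word I))), P ≠ 0 →
      ∃ w ∈ A, LeadsAt P w)
    {v : Word I} (hv : v ∈ A) (hst : IsStandard v) :
    ∃ P ∈ Submodule.span (BaseField I) (Q '' (A : Set (Word I))), LeadsAt P v := by
  by_contra hno
  set V := Submodule.span (BaseField I) (Q '' (A : Set (Word I))) with hV
  have hVw : V ≤ wheelLaurent n := by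
    rw [hV, Submodule.span_le]
    rintro _ ⟨w, hw, rfl⟩
    exact hQ w hw
  set S := A.filter IsStandard with hS
  set T := S.filter fun w => ∃ P ∈ V, LeadsAt P w with hT
  have hlead : ∀ P ∈ V, P ≠ 0 → ∃ w ∈ T, LeadsAt P w := by
    intro P hP hP0
    obtain ⟨w, hw, hPw⟩ := H P hP hP0
    have hPw' := hPw
    obtain ⟨⟨l, d, h1, h2⟩, h3⟩ := hPw'
    exact ⟨w, Finset.mem_filter.2 ⟨Finset.mem_filter.2 ⟨hw,
      isStandard_of_leading (hVw hP) h1 h2 h3⟩, P, hP, hPw⟩, hPw⟩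
  have hex : ∀ w : Word I, ∃ d : Vars n → ℤ, wordDim w = n → ∃ l, IsLabelling w l d := by
    intro w
    by_cases hw : wordDim w = n
    · obtain ⟨l, d, h1, -⟩ := exists_isLabelling hw
      exact ⟨d, fun _ => ⟨l, h1⟩⟩
    · exact ⟨0, fun h => absurd h hw⟩
  choose D hD using hex
  have hcard : Module.finrank (BaseField I) (T → BaseField I) <
      Module.finrank (BaseField I) (S → BaseField I) := by
    rw [Module.finrank_fintype_fun_eq_card, Module.finrank_fintype_fun_eq_card,
      Fintype.card_coe, Fintype.card_coe]
    refine Finset.card_lt_card (Finset.ssubset_iff_subset_ne.2 ⟨Finset.filter_subset _ _, ?_⟩)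
    intro h
    have hvS : v ∈ S := Finset.mem_filter.2 ⟨hv, hst⟩
    rw [← h] at hvS
    exact hno (Finset.mem_filter.1 hvS).2
  set φ : (S → BaseField I) →ₗ[BaseField I] (T → BaseField I) :=
    LinearMap.pi fun w : T => (Finsupp.lapply (D w)).comp
      (Fintype.linearCombination (BaseField I) fun w' : S => Q w') with hφ
  obtain ⟨a, ha, ha0⟩ := (Submodule.ne_bot_iff _).1 (LinearMap.ker_ne_bot_of_finrank_lt (f := φ) hcard)
  have hmemV : ∑ w : S, a w • Q w ∈ V := V.sum_mem fun w _ => V.smul_mem _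
    (Submodule.subset_span ⟨w, (Finset.mem_filter.1 w.2).1, rfl⟩)
  have hP0 : ∑ w : S, a w • Q w = 0 := by
    by_contra hne
    obtain ⟨w, hw, ⟨l, d, h1, h2⟩, -⟩ := hlead _ hmemV hne
    obtain ⟨l', h3⟩ := hD w (hdim w (Finset.mem_filter.1 (Finset.mem_filter.1 hw).1).1)
    apply h2
    have hsym : ((∑ w : S, a w • Q w) : Laurent (I := I) n).IsSymmetric := (hVw hmemV).1
    rw [h3.coeff_eq h1 hsym]
    exact congrFun (LinearMap.mem_ker.1 ha) ⟨w, hw⟩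
  have hE0 : ∑ w : S, a w • wordElt (w : Word I) = 0 := by
    refine DFinsupp.ext fun m => ?_
    have hsum : (∑ w : S, a w • wordElt (w : Word I) : Ambient I) m =
        ∑ w : S, a w • wordElt (w : Word I) m := by
      have := map_sum (DirectSum.component (BaseField I) (I → ℕ) (fun m => RatFun (I := I) m) m)
        (fun w : S => a w • wordElt (w : Word I)) Finset.univ
      simp only [map_smul] at this
      exact this
    rw [hsum]
    by_cases hm : m = n
    · subst hm
      have := congrArg (Laurent.toRat m) hP0
      rw [map_sum, map_zero] at this
      refine Eq.trans (Finset.sum_congr rfl fun w _ => ?_) this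
      rw [map_smul, hQw _ (Finset.mem_filter.1 w.2).1]
    · refine Finset.sum_eq_zero fun w _ => ?_
      rw [wordElt_apply_of_ne, smul_zero]
      rw [hdim _ (Finset.mem_filter.1 w.2).1]
      exact Ne.symm hm
  have hsupp : ((Finset.univ.filter fun w : S => a w ≠ 0).image Subtype.val).Nonempty := by
    obtain ⟨w, hw⟩ := Function.ne_iff.1 ha0
    exact ⟨w, Finset.mem_image.2 ⟨w, by simpa using hw, rfl⟩⟩
  obtain ⟨m, hm, hmin⟩ := exists_min_word hsupp
  obtain ⟨m, hm', rfl⟩ := Finset.mem_image.1 hm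
  have ham : a m ≠ 0 := (Finset.mem_filter.1 hm').2
  refine (Finset.mem_filter.1 m.2).2 ?_
  have h4 : wordElt (m : Word I) = -∑ w ∈ Finset.univ.erase m, ((a m)⁻¹ * a w) •
      wordElt (w : Word I) := by
    rw [← Finset.add_sum_erase _ _ (Finset.mem_univ m)] at hE0
    have := congrArg (fun z => (a m)⁻¹ • z) hE0
    simp only [smul_add, smul_smul, inv_mul_cancel₀ ham, one_smul, smul_zero,
      Finset.smul_sum] at this
    exact eq_neg_of_add_eq_zero_left this
  rw [h4]
  refine Submodule.neg_mem _ (Submodule.sum_mem _ fun w hw => ?_)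
  by_cases haw : a w = 0
  · rw [haw, mul_zero, zero_smul]
    exact Submodule.zero_mem _
  · refine Submodule.smul_mem _ _ (Submodule.subset_span ⟨w, ?_, rfl⟩)
    rcases hmin w (Finset.mem_image.2 ⟨w, by simpa using haw, rfl⟩) with h | h
    · exact absurd (Subtype.ext h) (Finset.ne_of_mem_erase hw)
    · exact h

end counting

end QuiverShuffle
end

noncomputable section
namespace QuiverShuffle

/-! ### Bounds for the partial sums of exponents -/

section convexity

variable {X : Type*} [Fintype X]

/-- A convex function of the size of a set of variables, with second difference `2 * C` and
values at most `-B` on the sizes that occur. -/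
def convexBound (X : Type*) [Fintype X] (C B : ℤ) (k : ℤ) : ℤ := C * k * (k - Fintype.card X) - B

/-- The exponents have bounded total degree, and all their partial sums are bounded below by
`convexBound`. -/
def Confined (C B D : ℤ) (p : X → ℤ) : Prop :=
  ∑ x, p x ≤ D ∧ ∀ J : Finset X, convexBound X C B J.card ≤ ∑ x ∈ J, p x

/-- The set `J` is an initial segment of `l`. -/
def InitialIn (l : List X) (J : Finset X) : Prop := ∀ a b, Before l a b → b ∈ J → a ∈ J

open Classical in
/-- The exponents are confined, with a stronger bound for the sets that are not initial in `l`. -/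
def StronglyConfined (C B D : ℤ) (l : List X) (p : X → ℤ) : Prop :=
  ∑ x, p x ≤ D ∧ ∀ J : Finset X,
    convexBound X C B J.card + (if InitialIn l J then 0 else C) ≤ ∑ x ∈ J, p x

theorem StronglyConfined.confined {C B D : ℤ} (hC : 0 ≤ C) {l : List X} {p : X → ℤ}
    (h : StronglyConfined C B D l p) : Confined C B D p := by
  refine ⟨h.1, fun J => le_trans ?_ (h.2 J)⟩
  split_ifs <;> linarith

theorem finite_confined (C B D : ℤ) : {p : X → ℤ | Confined C B D p}.Finite := by
  classical
  refine (Set.finite_Icc (fun _ : X => convexBound X C B 1)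
    (fun _ : X => D - convexBound X C B (Fintype.card X - 1 : ℤ))).subset ?_
  rintro p ⟨h1, h2⟩
  refine ⟨fun x => ?_, fun x => ?_⟩
  · simpa using h2 {x}
  · have h3 := h2 (Finset.univ.erase x)
    rw [Finset.card_erase_of_mem (Finset.mem_univ x), Finset.card_univ,
      Nat.cast_sub (Fintype.card_pos_iff.2 ⟨x⟩), Nat.cast_one] at h3
    have h4 := Finset.add_sum_erase Finset.univ p (Finset.mem_univ x)
    change p x ≤ D - _
    linarith

theorem Confined.stronglyConfined {C B D : ℤ} {p : X → ℤ} (h : Confined C B D p) {l : List X}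
    (hp : ∀ a b, Before l a b → p a ≤ p b) : StronglyConfined C B D l p := by
  classical
  refine ⟨h.1, fun J => ?_⟩
  split_ifs with hJ
  · rw [add_zero]
    exact h.2 J
  · unfold InitialIn at hJ
    push Not at hJ
    obtain ⟨a, b, hab, hb, ha⟩ := hJ
    have h1 := h.2 (insert a J)
    have h2 := h.2 (J.erase b)
    rw [Finset.card_insert_of_notMem ha, Finset.sum_insert ha, Nat.cast_add, Nat.cast_one] at h1
    rw [Finset.card_erase_of_mem hb, Nat.cast_sub (Finset.card_pos.2 ⟨b, hb⟩), Nat.cast_one] at h2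
    have h3 := Finset.add_sum_erase J p hb
    have h4 := hp a b hab
    have h5 : convexBound X C B (J.card + 1) + convexBound X C B (J.card - 1) =
        2 * (convexBound X C B J.card + C) := by
      unfold convexBound
      ring
    linarith

theorem stronglyConfined_self {C : ℤ} (hC : 0 ≤ C) (l : List X) (p : X → ℤ) :
    StronglyConfined C (C + ∑ x, |p x|) (∑ x, p x) l p := by
  refine ⟨le_rfl, fun J => ?_⟩
  have h1 : -∑ x, |p x| ≤ ∑ x ∈ J, p x := by
    have h2 : ∑ x ∈ J, |p x| ≤ ∑ x, |p x| :=
      Finset.sum_le_sum_of_subset_of_nonneg (Finset.subset_univ J) fun _ _ _ => abs_nonneg _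
    have h3 : -∑ x ∈ J, |p x| ≤ ∑ x ∈ J, p x := by
      rw [← Finset.sum_neg_distrib]
      exact Finset.sum_le_sum fun _ _ => neg_abs_le _
    linarith
  have h2 : C * J.card * (J.card - Fintype.card X) ≤ 0 := by
    have h3 : (J.card : ℤ) ≤ Fintype.card X := by exact_mod_cast J.card_le_univ
    exact mul_nonpos_of_nonneg_of_nonpos (mul_nonneg hC (by positivity)) (by linarith)
  unfold convexBound
  split_ifs <;> linarith

theorem InitialIn.map {l : List X} {J : Finset X} (h : InitialIn l J) (e : X ≃ X) :
    InitialIn (l.map e) (J.map e.toEmbedding) := by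
  intro a b hab hb
  obtain ⟨b, hb', rfl⟩ := Finset.mem_map.1 hb
  obtain ⟨a, rfl⟩ := e.surjective a
  exact Finset.mem_map.2 ⟨a, h a b ((before_map e.injective).1 hab) hb', rfl⟩

end convexity

section loss

variable {I : Type*} [Quiver I] [Fintype I] [∀ i j : I, Fintype (i ⟶ j)] {n : I → ℕ}

/-- The number of pairs of variables and factors of the corresponding functions `ζ`. -/
def totalWeight (n : I → ℕ) : ℤ := ∑ x : Vars n, ∑ y : Vars n, ((weights x.1 y.1).card : ℤ)

theorem totalWeight_nonneg : 0 ≤ totalWeight n :=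
  Finset.sum_nonneg fun _ _ => Finset.sum_nonneg fun _ _ => Nat.cast_nonneg _

theorem neg_totalWeight_le_loss (l : List (Vars n)) (lam : Vars n → ℤ)
    (h : ∀ x y, -1 ≤ lam x - lam y) : -totalWeight n ≤ loss l lam := by
  unfold totalWeight loss
  rw [← Finset.sum_neg_distrib]
  refine Finset.sum_le_sum fun x _ => ?_
  rw [← Finset.sum_neg_distrib]
  refine Finset.sum_le_sum fun y _ => ?_
  have h0 : (0 : ℤ) ≤ (weights x.1 y.1).card := Nat.cast_nonneg _
  split_ifs
  · have h1 : -1 ≤ min 0 (lam x - lam y) := le_min (by norm_num) (h x y)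
    nlinarith
  · linarith

theorem loss_eq_zero (l : List (Vars n)) (lam : Vars n → ℤ)
    (h : ∀ x y, Before l x y → lam y ≤ lam x) : loss l lam = 0 := by
  refine Finset.sum_eq_zero fun x _ => Finset.sum_eq_zero fun y _ => ?_
  split_ifs with h1
  · rw [min_eq_left (sub_nonneg.2 (h x y h1)), mul_zero]
  · rfl

theorem confined_of_mem_support {l : List (Vars n)} {d : Vars n → ℤ} {P : Laurent (I := I) n}
    (hl : l.Nodup) (hP : Laurent.toRat n P = sym (wordTerm l d)) {B D : ℤ}
    (h : StronglyConfined (totalWeight n) B D l d) {p : Vars n → ℤ} (hp : P p ≠ 0) :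
    Confined (totalWeight n) B D p := by
  classical
  constructor
  · have h1 := le_weight_of_mem_support hl hP (fun _ => -1) (-D) (fun s => ?_) hp
    · rw [← Finset.sum_mul] at h1
      linarith
    · rw [loss_eq_zero _ _ fun _ _ _ => le_rfl, ← Finset.sum_mul]
      have h2 : ∑ x, (d ∘ (permVars s).symm) x = ∑ x, d x :=
        Equiv.sum_comp (permVars s).symm d
      have := h.1
      linarith
  · intro J
    have h1 := le_weight_of_mem_support hl hP (fun x => if x ∈ J then 1 else 0)
      (convexBound (Vars n) (totalWeight n) B J.card) (fun s => ?_) hp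
    · simpa using h1
    · set J' := J.map (permVars s).symm.toEmbedding with hJ'
      have h2 : ∑ x, (d ∘ (permVars s).symm) x * (if x ∈ J then 1 else 0) = ∑ x ∈ J', d x := by
        simp [hJ']
      have h3 := h.2 J'
      rw [hJ', Finset.card_map, ← hJ'] at h3
      rw [h2]
      split_ifs at h3 with h4
      · rw [loss_eq_zero]
        · linarith
        · intro x y hxy
          have h5 := h4.map (permVars s) x y hxy
          have h6 : J'.map (permVars s).toEmbedding = J := by
            ext z
            simp [hJ']
          rw [h6] at h5
          by_cases hy : y ∈ J
          · simp [hy, h5 hy]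
          · simp only [hy, if_false]
            split_ifs <;> norm_num
      · have h5 := neg_totalWeight_le_loss (l.map (permVars s)) (fun x => if x ∈ J then 1 else 0)
          (fun x y => by split_ifs <;> norm_num)
        linarith

end loss

/-! ### Leading words of Laurent polynomials -/

section leading

variable {I : Type*} [LinearOrder I]

theorem wordLT_map_swap {α : Type*} [DecidableEq α] {g : α → I × ℤ} {l : List α} (hl : l.Nodup)
    {a b : α} (hab : Before l a b) (h : letterLT (g a) (g b)) :
    wordLT (l.map g) ((l.map (Equiv.swap a b)).map g) := by
  induction l with
  | nil => exact hab.elim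
  | cons c l ih =>
    rcases hab with ⟨rfl, -⟩ | hab
    · rw [List.map_cons, List.map_cons, List.map_cons, Equiv.swap_apply_left]
      exact List.Lex.rel h
    · have hc := (List.nodup_cons.1 hl).1
      rw [List.map_cons, List.map_cons, List.map_cons, Equiv.swap_apply_of_ne_of_ne
        (ne_of_mem_of_not_mem hab.mem_left hc).symm
        (ne_of_mem_of_not_mem hab.mem_right hc).symm]
      exact List.Lex.cons (ih (List.nodup_cons.1 hl).2 hab)

variable {n : I → ℕ}

theorem finite_words_of_finite [Fintype I] {T : Set (Vars n → ℤ)} (hT : T.Finite) :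
    {w : Word I | ∃ l d, IsLabelling w l d ∧ d ∈ T}.Finite := by
  have h1 : {l : List (Vars n) | l.Nodup}.Finite :=
    Set.finite_coe_iff.1 (inferInstanceAs (Finite {l : List (Vars n) // l.Nodup}))
  refine ((h1.prod hT).image fun z => z.1.map fun x => (x.1, z.2 x)).subset ?_
  rintro w ⟨l, d, h, hd⟩
  exact ⟨(l, d), ⟨h.nodup, hd⟩, h.map_eq⟩

variable [Quiver I] [Fintype I] [∀ i j : I, Fintype (i ⟶ j)]

theorem exists_leadsAt {P : Laurent (I := I) n} (hP : P ≠ 0) :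
    ∃ (w : Word I) (l : List (Vars n)) (d : Vars n → ℤ), IsLabelling w l d ∧ P d ≠ 0 ∧
      LeadsAt P w ∧ ∀ a b, Before l a b → d a ≤ d b := by
  classical
  obtain ⟨p, hp⟩ := Finsupp.ne_iff.1 hP
  obtain ⟨w, ⟨l, d, h, hd⟩, hmax⟩ := (finite_words_of_finite (n := n)
    P.hasFiniteSupport).exists_not_rel (Function.swap wordLT)
      ⟨_, Finset.univ.toList, p, ⟨Finset.nodup_toList _, by simp, rfl⟩, hp⟩
  refine ⟨w, l, d, h, hd, ⟨⟨l, d, h, hd⟩, fun w' l' d' h' hlt => ?_⟩, fun a b hab => ?_⟩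
  · by_contra h0
    exact hmax w' ⟨l', d', h', h0⟩ hlt
  · by_contra hlt
    have h1 := wordLT_map_swap (g := fun x => (x.1, d x)) h.nodup hab
      (Or.inl (not_le.1 hlt))
    rw [h.map_eq] at h1
    refine hmax _ ⟨l.map (Equiv.swap a b), d, ⟨h.nodup.map (Equiv.swap a b).injective, fun x =>
      List.mem_map.2 ⟨Equiv.swap a b x, h.mem _, Equiv.swap_apply_self a b x⟩, rfl⟩, hd⟩ h1

theorem IsLabelling.wordElt_eq {w : Word I} {l : List (Vars n)} {d : Vars n → ℤ}
    (h : IsLabelling w l d) : wordElt w n = sym (wordTerm l d) := by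
  obtain ⟨l', d', h', hw, -⟩ := exists_isLabelling h.wordDim_eq
  obtain ⟨s, rfl, rfl⟩ := h'.exists_perm h
  rw [hw, ← sym_renameVars s (wordTerm l (d' ∘ permVars s)), renameVars_perm_wordTerm,
    Function.comp_assoc, Equiv.self_comp_symm, Function.comp_id]

/-- Every standard word is the leading word of an element of the shuffle algebra. -/
theorem exists_leadsAt_wheelLaurent {v : Word I} (hv : IsStandard v) :
    ∃ P ∈ wheelLaurent (wordDim v), LeadsAt P v := by
  classical
  set n := wordDim v with hn
  have hv0 : IsLabelling v (wordVars v) (wordExp v) := isLabelling_wordVars v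
  set C := totalWeight n with hC
  set B := C + ∑ x, |wordExp v x| with hB
  set D := ∑ x, wordExp v x with hD
  set A : Set (Word I) := {w | ∃ (l : List (Vars n)) (d : Vars n → ℤ), IsLabelling w l d ∧
    StronglyConfined C B D l d} with hA
  have hfin : A.Finite := (finite_words_of_finite (finite_confined C B D)).subset (by
    rintro w ⟨l, d, h, hd⟩
    exact ⟨l, d, h, hd.confined totalWeight_nonneg⟩)
  have hQ : ∀ w : Word I, ∃ Q : Laurent (I := I) n, w ∈ A → Q ∈ wheelLaurent n ∧
      wordElt w n = Laurent.toRat n Q ∧ ∀ p, Q p ≠ 0 → Confined C B D p := by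
    intro w
    by_cases hw : w ∈ A
    · obtain ⟨l, d, h, hd⟩ := hw
      obtain ⟨Q, hQ, hQ'⟩ := exists_mem_wheelLaurent h.nodup h.mem d
      exact ⟨Q, fun _ => ⟨hQ, h.wordElt_eq.trans hQ'.symm,
        fun p hp => confined_of_mem_support h.nodup hQ' hd hp⟩⟩
    · exact ⟨0, fun h => absurd h hw⟩
  choose Q hQ using hQ
  have hspan : ∀ P ∈ Submodule.span (BaseField I) (Q '' A), ∀ p, P p ≠ 0 → Confined C B D p := by
    intro P hP p
    induction hP using Submodule.span_induction with
    | mem x hx =>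
      obtain ⟨w, hw, rfl⟩ := hx
      exact (hQ w hw).2.2 p
    | zero => exact fun h => absurd rfl h
    | add x y _ _ hx hy =>
      intro h
      by_cases h1 : x p = 0
      · refine hy fun h2 => h ?_
        rw [Finsupp.add_apply, h1, h2, add_zero]
      · exact hx h1
    | smul a x _ hx =>
      intro h
      refine hx fun h2 => h ?_
      rw [Finsupp.smul_apply, h2, smul_zero]
  obtain ⟨P, hP, hlead⟩ := exists_leadsAt_of_isStandard hfin.toFinset Q
    (fun w hw => (hQ w (hfin.mem_toFinset.1 hw)).1)
    (fun w hw => by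
      obtain ⟨l, d, h, -⟩ := hfin.mem_toFinset.1 hw
      exact h.wordDim_eq)
    (fun w hw => (hQ w (hfin.mem_toFinset.1 hw)).2.1)
    (fun P hP hP0 => by
      rw [hfin.coe_toFinset] at hP
      obtain ⟨w, l, d, h, hd, hw, hs⟩ := exists_leadsAt hP0
      exact ⟨w, hfin.mem_toFinset.2 ⟨l, d, h, (hspan P hP d hd).stronglyConfined hs⟩, hw⟩)
    (v := v) (hfin.mem_toFinset.2 ⟨wordVars v, wordExp v, hv0,
      stronglyConfined_self totalWeight_nonneg _ _⟩) hv
  rw [hfin.coe_toFinset] at hP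
  refine ⟨P, (Submodule.span_le.2 ?_) hP, hlead⟩
  rintro _ ⟨w, hw, rfl⟩
  exact (hQ w hw).1

end leading

end QuiverShuffle
end

theorem proposition2p19 {I : Type*} [Quiver I] [Fintype I] [∀ i j : I, Fintype (i ⟶ j)]
    [LinearOrder I] (v : QuiverShuffle.Word I) :
    QuiverShuffle.IsStandard v ↔
      ∃ R ∈ QuiverShuffle.shuffleAlgebra I, R ≠ 0 ∧ QuiverShuffle.IsLeadingWord R v := by
  classical
  open QuiverShuffle in
  constructor
  · intro hv
    obtain ⟨P, hP, ⟨l, d, h, h0⟩, hlead⟩ := exists_leadsAt_wheelLaurent hv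
    set Q : ∀ m : I → ℕ, Laurent (I := I) m := Function.update (fun _ => 0) (wordDim v) P with hQ
    have hQn : Q (wordDim v) = P := Function.update_self _ _ _
    have hR : ∀ m, Laurent.toRat m (Q m) =
        DirectSum.of (fun n : I → ℕ => RatFun (I := I) n) (wordDim v)
        (Laurent.toRat (wordDim v) P) m := by
      intro m
      by_cases hm : m = wordDim v
      · subst hm
        rw [DirectSum.of_eq_same, hQn]
      · rw [DirectSum.of_eq_of_ne _ _ _ hm, hQ, Function.update_of_ne hm, map_zero]
    have hmem : ∀ m, Q m ∈ wheelLaurent m := by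
      intro m
      by_cases hm : m = wordDim v
      · subst hm
        rwa [hQn]
      · rw [hQ, Function.update_of_ne hm]
        exact Submodule.zero_mem _
    refine ⟨DirectSum.of (fun n : I → ℕ => RatFun (I := I) n) (wordDim v)
        (Laurent.toRat (wordDim v) P),
      (Submodule.mem_iInf _).2 fun m => ⟨Q m, hmem m, hR m⟩, fun hR0 => ?_, Q, hR, ?_, ?_⟩
    · have h1 := hR (wordDim v)
      rw [hR0, hQn] at h1
      have h2 : P = 0 := (map_eq_zero_iff _ toRat_injective).1 h1
      exact h0 (by rw [h2]; rfl)
    · rwa [hQn, h.coeff_eq (isLabelling_wordVars v) hP.1]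
    · intro w hw
      by_cases hwn : wordDim w = wordDim v
      · obtain ⟨l', d', h', -, h2⟩ := exists_isLabelling hwn
        rw [h2, hQn]
        exact hlead w l' d' h' hw
      · rw [hQ, Function.update_of_ne hwn]
        rfl
  · rintro ⟨R, hR, -, P, hP, h0, hlead⟩
    have hmem : P (wordDim v) ∈ wheelLaurent (wordDim v) := by
      obtain ⟨P', hP', h1⟩ := (Submodule.mem_iInf _).1 hR (wordDim v)
      rwa [toRat_injective ((hP (wordDim v)).trans h1.symm)]
    refine isStandard_of_leading hmem (isLabelling_wordVars v) h0 fun w l d h hw => ?_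
    obtain ⟨l', d', h', -, h2⟩ := exists_isLabelling h.wordDim_eq
    rw [h'.coeff_eq h hmem.1, ← hlead w hw, h2]
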